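/- Let $\mathbb R^3$ carry the Heisenberg group law $(x,y,z)\star(x',y',z')=(x+x',y+y',z+z'-xy')$, let $\Gamma=\{(x,y,z): x,y\in\sqrt{2\pi}\,\mathbb Z,\ z\in 2\pi\mathbb Z\}$, and let $M$ be the quotient of $\mathbb R^3$ by left multiplication by $\Gamma$, with the sub-Riemannian structure having the orthonormal frame $X=\partial_x$, $Y=\partial_y-x\partial_z$, the Laplacian $\Delta=-(X^2+Y^2)$, the contact form $\alpha=dz+x\,dy$, and its Reeb vector field $R$. For $\operatorname{Re} z>0$ let $Z(z)=\sum_\lambda \dim(E_\lambda)\,e^{-z\lambda}$ be the heat trace, where $E_\lambda$ is the space of eigenfunctions of $\Delta$ on $M$ with eigenvalue $\lambda$. Let $Z_T(z)$ and $Z_o(z)$ be the corresponding sums with $E_\lambda$ replaced by its subspace of functions pulled back from the torus $\mathbb R^2/\sqrt{2\pi}\,\mathbb Z^2$ (functions independent of the third coordinate), respectively by its subspace of functions whose integral over each circle in the direction of the third coordinate vanishes. 1. All $E_\lambda$ are finite-dimensional and, for $\operatorname{Re} z>0$, the three series converge absolutely, $Z=Z_T+Z_o$, and $$Z_o(z)=\sum_{m\ge1}2m\sum_{n\ge0}e^{-(2n+1)mz}=\sum_{m\ge1}\frac{m}{\sinh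 mz},$$ with absolute convergence. 2. The function $x/\sinh x$ is integrable on $\mathbb R$ and $\displaystyle\int_{\mathbb R}\frac{x}{\sinh x}\,e^{-ikx}\,dx=\frac{\pi^2}{1+\cosh \pi k}$ for every real $k$. 3. For $\operatorname{Re} z>0$, no denominator below vanishes, the series converges absolutely, and $$Z_o(z)=\frac{\pi^2}{4z^2}-\frac1{2z}+\frac{\pi^2}{z^2}\sum_{l\ge1}\frac1{1+\cosh(2\pi^2l/z)}.$$ 4. (Weyl term) $Z_o(t)\sim \pi^2/(4t^2)$ as $t\to0^+$. 5. (Exponentially small corrections) For $\operatorname{Re} z>0$, with absolute convergence, $$Z_o(z)=\frac{\pi^2}{4z^2}-\frac1{2z}+\frac{2\pi^2}{z^2}\sum_{N\ge1}a_N e^{-2\pi^2N/z},\qquad a_N=\sum_{d\mid N}(-1)^{d+1}d\neq0,$$ and $Z_o(t)-\frac{\pi^2}{4t^2}+\frac1{2t}\sim\frac{2\pi^2}{t^2}e^{-2\pi^2/t}$ as $t\to0^+$. The set of lengths $L$ of the closed geodesics of $M$ with nonzero vertical momentum (those which do not project to straight lines of the torus; multiply traversed ones included) is $\{2\pi\sqrt{2l}: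 l\ge1\}$, and the exponents which occur are exactly the numbers $2\pi^2N=L^2/4$. 6. (Boundary singularities) The poles of the functions $z\mapsto 1/(1+\cosh(2\pi^2l/z))$ on $\mathbb C\setminus\{0\}$, $l\ge1$, form together the set $P=\{2\pi i l/(2k+1): l\ge1,\ k\in\mathbb Z\}$. If $p\in\mathbb Z$ and $2k+1$ ($k\ge0$) are coprime, then $$\lim_{\varepsilon\to0^+}\varepsilon^2Z_o\Bigl(\varepsilon+\frac{2\pi i p}{2k+1}\Bigr)=\frac{\pi^2}{4(2k+1)^2},$$ whereas $\lim_{\varepsilon\to0^+}\varepsilon^2Z_o(\varepsilon+i\theta)=0$ for every real $\theta\ne0$ with $i\theta\notin P$. The closure of $P$ is the imaginary axis, and there is no meromorphic function on any open set $U$ meeting the imaginary axis that agrees with $Z_o$ on $U\cap\{\operatorname{Re} z>0\}$. 7. For every integer $k\ge0$ the positive periods (not only the primitive ones) of the closed orbits on $M$ of the vector field $(2k+1)R$ are the numbers $2\pi l/(2k+1)$, $l\ge1$. Hence $\{\tau>0: i\tau\in P\}$ is the set of all periods of the fields $(2k+1)R$, $k\ge0$. -/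

import Mathlib

open Filter Topology Asymptotics MeasureTheory
open scoped ContDiff

noncomputable section

namespace Heisenberg

/-- Points of the Heisenberg group `ℝ³`, in the coordinates `(x, y, z)`. -/
@[ext] structure Heis where
  x : ℝ
  y : ℝ
  z : ℝ

/-- The group law `(x,y,z) ⋆ (x',y',z') = (x + x', y + y', z + z' - x y')`. -/
instance : Mul Heis := ⟨fun p q => ⟨p.x + q.x, p.y + q.y, p.z + q.z - p.x * q.y⟩⟩

instance : One Heis := ⟨⟨0, 0, 0⟩⟩

instance : Inv Heis := ⟨fun p => ⟨-p.x, -p.y, -p.z - p.x * p.y⟩⟩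

theorem mul_def (p q : Heis) :
    p * q = ⟨p.x + q.x, p.y + q.y, p.z + q.z - p.x * q.y⟩ := rfl

theorem one_def : (1 : Heis) = ⟨0, 0, 0⟩ := rfl

theorem inv_def (p : Heis) : p⁻¹ = ⟨-p.x, -p.y, -p.z - p.x * p.y⟩ := rfl

instance : Group Heis where
  mul_assoc p q r := by ext <;> simp only [mul_def] <;> ring
  one_mul p := by ext <;> simp [mul_def, one_def]
  mul_one p := by ext <;> simp [mul_def, one_def]
  inv_mul_cancel p := by ext <;> simp only [mul_def, one_def, inv_def] <;> ring

/-- The lattice `{(x,y,z) | x, y ∈ √(2π) ℤ, z ∈ 2π ℤ}`. -/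
def lattice : Subgroup Heis where
  carrier := {p | (∃ a : ℤ, p.x = √(2 * Real.pi) * a) ∧ (∃ b : ℤ, p.y = √(2 * Real.pi) * b) ∧
    ∃ c : ℤ, p.z = 2 * Real.pi * c}
  one_mem' := ⟨⟨0, by simp [one_def]⟩, ⟨0, by simp [one_def]⟩, ⟨0, by simp [one_def]⟩⟩
  mul_mem' := by
    rintro p q ⟨⟨a, ha⟩, ⟨b, hb⟩, ⟨c, hc⟩⟩ ⟨⟨a', ha'⟩, ⟨b', hb'⟩, ⟨c', hc'⟩⟩
    have h : √(2 * Real.pi) * √(2 * Real.pi) = 2 * Real.pi :=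
      Real.mul_self_sqrt (by positivity)
    refine ⟨⟨a + a', ?_⟩, ⟨b + b', ?_⟩, ⟨c + c' - a * b', ?_⟩⟩
    · simp only [mul_def, ha, ha']; push_cast; ring
    · simp only [mul_def, hb, hb']; push_cast; ring
    · simp only [mul_def, ha, hb', hc, hc']; push_cast
      linear_combination (-(a : ℝ) * b') * h
  inv_mem' := by
    rintro p ⟨⟨a, ha⟩, ⟨b, hb⟩, ⟨c, hc⟩⟩
    have h : √(2 * Real.pi) * √(2 * Real.pi) = 2 * Real.pi :=
      Real.mul_self_sqrt (by positivity)
    refine ⟨⟨-a, ?_⟩, ⟨-b, ?_⟩, ⟨-c - a * b, ?_⟩⟩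
    · simp only [inv_def, ha]; push_cast; ring
    · simp only [inv_def, hb]; push_cast; ring
    · simp only [inv_def, ha, hb, hc]; push_cast
      linear_combination (-(a : ℝ) * b) * h

/-- The nilmanifold: the quotient of `ℝ³` by left multiplication by the lattice. -/
abbrev Nilmanifold : Type := Quotient (QuotientGroup.rightRel lattice)

/-- The projection from `ℝ³` to the nilmanifold. -/
def proj (p : Heis) : Nilmanifold := Quotient.mk _ p

/-- Components of tangent vectors and covectors in the coordinates `(x, y, z)`. -/
abbrev Vec : Type := ℝ × ℝ × ℝ

/-- The point with given coordinates. -/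
def ofVec (v : Vec) : Heis := ⟨v.1, v.2.1, v.2.2⟩

/-! ### The sub-Laplacian and its eigenspaces -/

/-- The vector field `X = ∂_x`, acting on functions. -/
def opX (f : Heis → ℂ) (p : Heis) : ℂ := deriv (fun s : ℝ => f ⟨s, p.y, p.z⟩) p.x

/-- The vector field `Y = ∂_y - x ∂_z`, acting on functions. -/
def opY (f : Heis → ℂ) (p : Heis) : ℂ :=
  deriv (fun s : ℝ => f ⟨p.x, s, p.z⟩) p.y - p.x * deriv (fun s : ℝ => f ⟨p.x, p.y, s⟩) p.z

/-- The sub-Riemannian Laplacian `Δ = -(X² + Y²)`. -/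
def laplacian (f : Heis → ℂ) (p : Heis) : ℂ := -(opX (opX f) p + opY (opY f) p)

/-- Smoothness of a function on `ℝ³`. -/
def Smooth (f : Heis → ℂ) : Prop := ContDiff ℝ ∞ (fun v : Vec => f (ofVec v))

theorem opX_eq {f : Heis → ℂ} (hf : Smooth f) (p : Heis) :
    HasDerivAt (fun s : ℝ => f ⟨s, p.y, p.z⟩)
      (fderiv ℝ (fun v : Vec => f (ofVec v)) (p.x, p.y, p.z) (1, 0, 0)) p.x := by
  have h1 : HasFDerivAt (fun v : Vec => f (ofVec v)) _ (p.x, p.y, p.z) :=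
    (hf.differentiable (by simp) (p.x, p.y, p.z)).hasFDerivAt
  exact h1.comp_hasDerivAt p.x (f := fun s : ℝ => ((s, p.y, p.z) : Vec))
    ((hasDerivAt_id p.x).prodMk ((hasDerivAt_const _ _).prodMk (hasDerivAt_const _ _)))

theorem opy_eq {f : Heis → ℂ} (hf : Smooth f) (p : Heis) :
    HasDerivAt (fun s : ℝ => f ⟨p.x, s, p.z⟩)
      (fderiv ℝ (fun v : Vec => f (ofVec v)) (p.x, p.y, p.z) (0, 1, 0)) p.y := by
  have h1 : HasFDerivAt (fun v : Vec => f (ofVec v)) _ (p.x, p.y, p.z) :=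
    (hf.differentiable (by simp) (p.x, p.y, p.z)).hasFDerivAt
  exact h1.comp_hasDerivAt p.y (f := fun s : ℝ => ((p.x, s, p.z) : Vec))
    ((hasDerivAt_const _ _).prodMk ((hasDerivAt_id p.y).prodMk (hasDerivAt_const _ _)))

theorem opz_eq {f : Heis → ℂ} (hf : Smooth f) (p : Heis) :
    HasDerivAt (fun s : ℝ => f ⟨p.x, p.y, s⟩)
      (fderiv ℝ (fun v : Vec => f (ofVec v)) (p.x, p.y, p.z) (0, 0, 1)) p.z := by
  have h1 : HasFDerivAt (fun v : Vec => f (ofVec v)) _ (p.x, p.y, p.z) :=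
    (hf.differentiable (by simp) (p.x, p.y, p.z)).hasFDerivAt
  exact h1.comp_hasDerivAt p.z (f := fun s : ℝ => ((p.x, p.y, s) : Vec))
    ((hasDerivAt_const _ _).prodMk ((hasDerivAt_const _ _).prodMk (hasDerivAt_id p.z)))

theorem Smooth.opX {f : Heis → ℂ} (hf : Smooth f) : Smooth (opX f) := by
  have h : (fun v : Vec => Heisenberg.opX f (ofVec v)) = fun v : Vec =>
      fderiv ℝ (fun v : Vec => f (ofVec v)) v (1, 0, 0) := by
    funext v; exact (opX_eq hf (ofVec v)).deriv
  unfold Smooth at *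
  rw [h]
  exact (hf.fderiv_right (m := ∞) (by simp)).clm_apply contDiff_const

theorem Smooth.opY {f : Heis → ℂ} (hf : Smooth f) : Smooth (opY f) := by
  have h : (fun v : Vec => Heisenberg.opY f (ofVec v)) = fun v : Vec =>
      fderiv ℝ (fun v : Vec => f (ofVec v)) v (0, 1, 0) -
        v.1 • fderiv ℝ (fun v : Vec => f (ofVec v)) v (0, 0, 1) := by
    funext v
    rw [Complex.real_smul]
    unfold Heisenberg.opY
    rw [(opy_eq hf (ofVec v)).deriv, (opz_eq hf (ofVec v)).deriv]
    rfl
  unfold Smooth at *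
  rw [h]
  exact ((hf.fderiv_right (m := ∞) (by simp)).clm_apply contDiff_const).sub
    (contDiff_fst.smul ((hf.fderiv_right (m := ∞) (by simp)).clm_apply contDiff_const))

theorem opX_add {f g : Heis → ℂ} (hf : Smooth f) (hg : Smooth g) :
    opX (f + g) = opX f + opX g := by
  funext p
  exact ((opX_eq hf p).add (opX_eq hg p)).deriv.trans
    (congrArg₂ (· + ·) (opX_eq hf p).deriv.symm (opX_eq hg p).deriv.symm)

theorem opY_add {f g : Heis → ℂ} (hf : Smooth f) (hg : Smooth g) :
    opY (f + g) = opY f + opY g := by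
  funext p
  have h1 := ((opy_eq hf p).add (opy_eq hg p)).deriv
  have h2 := ((opz_eq hf p).add (opz_eq hg p)).deriv
  simp only [opY, Pi.add_apply, (opy_eq hf p).deriv, (opy_eq hg p).deriv,
    (opz_eq hf p).deriv, (opz_eq hg p).deriv]
  have h1' : deriv (fun s : ℝ => f ⟨p.x, s, p.z⟩ + g ⟨p.x, s, p.z⟩) p.y = _ := h1
  have h2' : deriv (fun s : ℝ => f ⟨p.x, p.y, s⟩ + g ⟨p.x, p.y, s⟩) p.z = _ := h2
  rw [h1', h2']; ring

theorem opX_smul (c : ℂ) (f : Heis → ℂ) : opX (c • f) = c • opX f := by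
  funext p; simp [opX]

theorem opY_smul (c : ℂ) (f : Heis → ℂ) : opY (c • f) = c • opY f := by
  funext p; simp [opY]; ring

/-- The `μ`-eigenspace of the Laplacian of the nilmanifold. Functions on the nilmanifold are
lattice-invariant functions on `ℝ³`; eigenfunctions are smooth, as `Δ` is hypoelliptic. -/
def eigenspace (μ : ℝ) : Submodule ℂ (Heis → ℂ) where
  carrier := {f | Smooth f ∧ (∀ γ ∈ lattice, ∀ p, f (γ * p) = f p) ∧
    ∀ p, laplacian f p = μ * f p}
  add_mem' := by
    rintro f g ⟨hf, hf', hf''⟩ ⟨hg, hg', hg''⟩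
    refine ⟨ContDiff.add hf hg, fun γ hγ p => by simp [hf' γ hγ p, hg' γ hγ p], fun p => ?_⟩
    have h1 := hf'' p
    have h2 := hg'' p
    simp only [laplacian] at h1 h2 ⊢
    rw [opX_add hf hg, opY_add hf hg, opX_add hf.opX hg.opX, opY_add hf.opY hg.opY]
    simp only [Pi.add_apply]
    linear_combination h1 + h2
  zero_mem' := by
    refine ⟨contDiff_const, fun _ _ _ => rfl, fun p => ?_⟩
    simp [laplacian, opX, opY]
  smul_mem' := by
    rintro c f ⟨hf, hf', hf''⟩
    refine ⟨ContDiff.const_smul c hf, fun γ hγ p => by simp [hf' γ hγ p], fun p => ?_⟩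
    have h1 := hf'' p
    simp only [laplacian] at h1 ⊢
    rw [opX_smul, opY_smul, opX_smul, opY_smul]
    simp only [Pi.smul_apply, smul_eq_mul]
    linear_combination c * h1

/-- Functions of `(x, y)` only: among the functions on the nilmanifold, those which are pulled
back from the flat torus `ℝ² / √(2π) ℤ²`. -/
def torusFunctions : Submodule ℂ (Heis → ℂ) where
  carrier := {f | ∀ x y z : ℝ, f ⟨x, y, z⟩ = f ⟨x, y, 0⟩}
  add_mem' := fun hf hg x y z => congrArg₂ (· + ·) (hf x y z) (hg x y z)
  zero_mem' := fun _ _ _ => rfl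
  smul_mem' := fun c _ hf x y z => congrArg (c * ·) (hf x y z)

/-- The torus part of the `μ`-eigenspace. -/
def torusEigenspace (μ : ℝ) : Submodule ℂ (Heis → ℂ) := eigenspace μ ⊓ torusFunctions

/-- The non-torus part of the `μ`-eigenspace: the eigenfunctions with mean zero over each circle
`z ↦ (x, y, z)`, that is, orthogonal to the functions pulled back from the torus. -/
def nonTorusEigenspace (μ : ℝ) : Submodule ℂ (Heis → ℂ) where
  carrier := {f | f ∈ eigenspace μ ∧ ∀ x y : ℝ, ∫ z in (0 : ℝ)..2 * Real.pi, f ⟨x, y, z⟩ = 0}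
  add_mem' := by
    rintro f g ⟨hf, hf'⟩ ⟨hg, hg'⟩
    have key : ∀ h ∈ eigenspace μ, ∀ x y : ℝ, Continuous fun z : ℝ => h ⟨x, y, z⟩ := by
      intro h hh x y
      exact hh.1.continuous.comp (g := fun v : Vec => h (ofVec v))
        (f := fun z : ℝ => ((x, y, z) : Vec)) (by fun_prop)
    refine ⟨add_mem hf hg, fun x y => ?_⟩
    simp only [Pi.add_apply]
    rw [intervalIntegral.integral_add ((key f hf x y).intervalIntegrable _ _)
      ((key g hg x y).intervalIntegrable _ _), hf' x y, hg' x y, add_zero]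
  zero_mem' := ⟨zero_mem _, fun x y => by simp⟩
  smul_mem' := by
    rintro c f ⟨hf, hf'⟩
    exact ⟨Submodule.smul_mem _ c hf, fun x y => by
      simp only [Pi.smul_apply, intervalIntegral.integral_smul, hf' x y, smul_zero]⟩

/-- The contribution `dim(E μ) e^{-z μ}` of a number `μ` to the heat trace of an operator with
eigenspaces `E μ`. -/
def traceTerm (E : ℝ → Submodule ℂ (Heis → ℂ)) (z : ℂ) (μ : ℝ) : ℂ :=
  (Module.finrank ℂ (E μ) : ℂ) * Complex.exp (-z * μ)

/-- The sum of `e^{-z λ_j}` over the eigenvalues `λ_j`, repeated with their multiplicities. -/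
def trace (E : ℝ → Submodule ℂ (Heis → ℂ)) (z : ℂ) : ℂ := ∑' μ : ℝ, traceTerm E z μ

/-- The non-torus part of the heat trace of the nilmanifold. -/
def Zo (z : ℂ) : ℂ := trace nonTorusEigenspace z

/-! ### Geodesics -/

/-- The pairing of a covector and a tangent vector. -/
def pairing (ξ v : Vec) : ℝ := ξ.1 * v.1 + ξ.2.1 * v.2.1 + ξ.2.2 * v.2.2

/-- The cometric `g*(q, ξ) = ξ(X)² + ξ(Y)²`, where `X = ∂_x`, `Y = ∂_y - x ∂_z`. -/
def cometric (q : Heis) (ξ : Vec) : ℝ :=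
  pairing ξ (1, 0, 0) ^ 2 + pairing ξ (0, 1, -q.x) ^ 2

/-- The Hamiltonian `g* / 2` of the geodesic flow. -/
def hamiltonian (q : Heis) (ξ : Vec) : ℝ := cometric q ξ / 2

/-- `(q, ξ)` is an integral curve of the Hamiltonian vector field of `g* / 2` which lies in the
unit cotangent bundle `g* = 1`. So `q` is a geodesic of unit speed. -/
structure IsUnitGeodesic (q : ℝ → Heis) (ξ : ℝ → Vec) : Prop where
  unit : ∀ t, cometric (q t) (ξ t) = 1
  dx : ∀ t, HasDerivAt (fun s => (q s).x)
    (deriv (fun u => hamiltonian (q t) (u, (ξ t).2.1, (ξ t).2.2)) (ξ t).1) t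
  dy : ∀ t, HasDerivAt (fun s => (q s).y)
    (deriv (fun u => hamiltonian (q t) ((ξ t).1, u, (ξ t).2.2)) (ξ t).2.1) t
  dz : ∀ t, HasDerivAt (fun s => (q s).z)
    (deriv (fun u => hamiltonian (q t) ((ξ t).1, (ξ t).2.1, u)) (ξ t).2.2) t
  dξx : ∀ t, HasDerivAt (fun s => (ξ s).1)
    (-deriv (fun u => hamiltonian ⟨u, (q t).y, (q t).z⟩ (ξ t)) (q t).x) t
  dξy : ∀ t, HasDerivAt (fun s => (ξ s).2.1)
    (-deriv (fun u => hamiltonian ⟨(q t).x, u, (q t).z⟩ (ξ t)) (q t).y) t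
  dξz : ∀ t, HasDerivAt (fun s => (ξ s).2.2)
    (-deriv (fun u => hamiltonian ⟨(q t).x, (q t).y, u⟩ (ξ t)) (q t).z) t

/-- The lengths of the closed geodesics of the nilmanifold with nonzero vertical momentum `ξ(∂_z)`,
that is, of those which do not project to straight lines of the torus. The parametrization has unit
speed, so the length of a closed geodesic is its period. -/
def nonTorusLengths : Set ℝ :=
  {L | 0 < L ∧ ∃ q ξ, IsUnitGeodesic q ξ ∧ (∀ t, pairing (ξ t) (0, 0, 1) ≠ 0) ∧
    ∀ t, proj (q (t + L)) = proj (q t)}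

/-! ### The Reeb flow -/

/-- The contact form `α = dz + x dy`. -/
def contactForm (p : Heis) (v : Vec) : ℝ := v.2.2 + p.x * v.2.1

/-- The exterior derivative `dα(v, w) = v(α(w)) - w(α(v))`, for constant vector fields `v`, `w`. -/
def dContactForm (p : Heis) (v w : Vec) : ℝ :=
  deriv (fun t : ℝ => contactForm ⟨p.x + t * v.1, p.y + t * v.2.1, p.z + t * v.2.2⟩ w) 0 -
    deriv (fun t : ℝ => contactForm ⟨p.x + t * w.1, p.y + t * w.2.1, p.z + t * w.2.2⟩ v) 0

/-- `v` is the value at `p` of the Reeb vector field `R`: `α(R) = 1` and `dα(R, ·) = 0`. -/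
def IsReebVector (p : Heis) (v : Vec) : Prop :=
  contactForm p v = 1 ∧ ∀ w, dContactForm p v w = 0

/-- `c` is an orbit of the vector field `s R`, a multiple of the Reeb vector field `R`. -/
def IsReebOrbit (s : ℝ) (c : ℝ → Heis) : Prop :=
  ∀ t, ∃ v, IsReebVector (c t) v ∧ HasDerivAt (fun u => (c u).x) (s * v.1) t ∧
    HasDerivAt (fun u => (c u).y) (s * v.2.1) t ∧ HasDerivAt (fun u => (c u).z) (s * v.2.2) t

/-- The positive periods (not only the primitive ones) of the closed orbits of `s R` in the
nilmanifold. -/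
def reebPeriods (s : ℝ) : Set ℝ :=
  {τ | 0 < τ ∧ ∃ c, IsReebOrbit s c ∧ ∀ t, proj (c (t + τ)) = proj (c t)}

/-! ### The terms of the trace formula -/

/-- The poles `w ≠ 0` of the functions `z ↦ 1 / (1 + cosh(2π² l / z))`, `l ≥ 1`. -/
def boundaryPoles : Set ℂ :=
  {w | w ≠ 0 ∧ ∃ l : ℕ+, 1 + Complex.cosh (2 * (Real.pi : ℂ) ^ 2 * l / w) = 0}

/-- `∑_{d ∣ N} (-1)^{d+1} d`. -/
def correctionCoeff (N : ℕ) : ℤ := ∑ d ∈ N.divisors, (-1) ^ (d + 1) * (d : ℤ)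

end Heisenberg

end

open Heisenberg

/-!
The multiplicities of the spectrum are found by representation theory, the trace formula by
Poisson summation, and the boundary behaviour from a second expression of the same double series.

**Spectrum.** Averaging over the centre splits an eigenspace of `Δ` into vertical modes, on which
`∂_z` acts as `im`; the mode `m = 0` is the torus part. On the mode `m` the commutation relation
`[X, Y] = -∂_z` gives the factorization `(X + iεY)(X - iεY) = -(Δ + εm)` for `ε = ±1`
(`ladder_neg_ladder`), so that the ladder operators `X ± iY` shift the eigenvalue by `±2m`, and for
`m > 0` the lowering one is an isomorphism except at the eigenvalue `m`. As `Δ` has no negative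
eigenvalue, by the maximum principle on the compact quotient (`eigenspace_eq_bot_of_neg`), the
eigenvalues of the mode `m > 0` are `(2n + 1) m`, all with the multiplicity of the lowest one
(`modeSpace_eq_bot`, `nonempty_modeSpace_equiv_lowest`). The lowest level is the kernel of `X + iY`.
In terms of Fourier series in `y` it embeds into `ℂ^m`: each coefficient solves a first-order
equation in `x`, and quasi-periodicity in `x` shifts the index by `m`. Conversely the `m` theta
functions of level `m` belong to it and are eigenvectors of a translation with distinct eigenvalues
(`finrank_modeSpace_lowest`). A reflection treats `m < 0`. Hence `Zo z = ∑ 2m e^{-(2n+1)mz}`.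

**Trace formula.** The Fourier transform of `x / sinh x` follows from the expansion
`x / sinh x = ∑ 2x e^{-(2n+1)x}` for `x > 0`, and the Lipschitz formula for `∑ (τ + n)⁻²`
(`integral_fourierIntegrand`). Poisson summation of `x / sinh (tx)` gives the formula for real `t`
(`Zo_ofReal`), and the identity theorem extends it to the half-plane (`trace_formula`). Expanding
`1 / (1 + cosh w)` in powers of `e^{-w}` and collecting equal exponents yields the coefficients
`a_N` (`hasSum_correction`); they do not vanish, as the even divisors of an even number outweigh
its odd ones.

**Geodesics and Reeb orbits.** Hamilton's equations make the velocity rotate with the constant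
frequency `w = ξ(∂_z)`. A geodesic closed in the quotient already closes in the `(x, y)`-plane, so
`wL ∈ 2πℤ`, and it rises by `L / (2w) ∈ 2πℤ`; hence `L² ∈ 8π² ℤ` (`exists_length_eq`). The Reeb
vector field is `∂_z`.

**Boundary.** Summing over `m` first gives `Zo z = ∑ 1 / (2 sinh² ((2n+1)z/2))`, in the form
`2q / (1 - q)²` with `q = e^{-(2n+1)z}` (`hasSum_Zo_odd`). At `z = ε + iθ` the terms multiplied by
`ε²` are bounded by `2 / (2n+1)²`, and they tend to `2 / (2n+1)²` if `(2n+1)θ ∈ 2πℤ` and to `0`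
otherwise (`tendsto_sq_mul_Zo`). For `θ = 2πp/(2k+1)` in lowest terms these `2n+1` are the odd
multiples of `2k+1`, and `∑ 1/(2j+1)² = π²/8` gives the limit. Such points being dense, a
meromorphic function cannot continue `Zo`, since it would be continuous near all but isolated
points of the axis.
-/

noncomputable section

namespace Heisenberg

/-! ### Differentiation along one-parameter subgroups -/

/-- The vertical vector field `Z = ∂_z`, acting on functions. -/
def opZ (f : Heis → ℂ) (p : Heis) : ℂ := deriv (fun s : ℝ => f ⟨p.x, p.y, s⟩) p.z

/-- The partial derivative `∂_y`, acting on functions. -/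
def opy (f : Heis → ℂ) (p : Heis) : ℂ := deriv (fun s : ℝ => f ⟨p.x, s, p.z⟩) p.y

theorem opY_eq_sub (f : Heis → ℂ) (p : Heis) : opY f p = opy f p - p.x * opZ f p := rfl

theorem Smooth.continuous_ofVec {f : Heis → ℂ} (hf : Smooth f) :
    Continuous fun v : Vec => f (ofVec v) := ContDiff.continuous hf

theorem Smooth.hasFDerivAt {f : Heis → ℂ} (hf : Smooth f) (v : Vec) :
    HasFDerivAt (fun v : Vec => f (ofVec v)) (fderiv ℝ (fun v : Vec => f (ofVec v)) v) v :=
  (ContDiff.differentiable hf (by simp) v).hasFDerivAt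

theorem opX_eq_fderiv {f : Heis → ℂ} (hf : Smooth f) (p : Heis) :
    opX f p = fderiv ℝ (fun v : Vec => f (ofVec v)) (p.x, p.y, p.z) (1, 0, 0) :=
  (opX_eq hf p).deriv

theorem opy_eq_fderiv {f : Heis → ℂ} (hf : Smooth f) (p : Heis) :
    opy f p = fderiv ℝ (fun v : Vec => f (ofVec v)) (p.x, p.y, p.z) (0, 1, 0) :=
  (opy_eq hf p).deriv

theorem opZ_eq_fderiv {f : Heis → ℂ} (hf : Smooth f) (p : Heis) :
    opZ f p = fderiv ℝ (fun v : Vec => f (ofVec v)) (p.x, p.y, p.z) (0, 0, 1) :=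
  (opz_eq hf p).deriv

theorem Smooth.opy {f : Heis → ℂ} (hf : Smooth f) : Smooth (opy f) := by
  have h : (fun v : Vec => Heisenberg.opy f (ofVec v)) = fun v : Vec =>
      fderiv ℝ (fun v : Vec => f (ofVec v)) v (0, 1, 0) := by
    funext v; exact opy_eq_fderiv hf (ofVec v)
  unfold Smooth at *
  rw [h]
  exact (hf.fderiv_right (m := ∞) (by simp)).clm_apply contDiff_const

theorem Smooth.opZ {f : Heis → ℂ} (hf : Smooth f) : Smooth (opZ f) := by
  have h : (fun v : Vec => Heisenberg.opZ f (ofVec v)) = fun v : Vec =>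
      fderiv ℝ (fun v : Vec => f (ofVec v)) v (0, 0, 1) := by
    funext v; exact opZ_eq_fderiv hf (ofVec v)
  unfold Smooth at *
  rw [h]
  exact (hf.fderiv_right (m := ∞) (by simp)).clm_apply contDiff_const

theorem Smooth.add {f g : Heis → ℂ} (hf : Smooth f) (hg : Smooth g) : Smooth (f + g) :=
  ContDiff.add hf hg

theorem Smooth.smul {f : Heis → ℂ} (c : ℂ) (hf : Smooth f) : Smooth (c • f) :=
  ContDiff.const_smul c hf

/-- `X` differentiates along the flow `p ↦ p ⋆ (s, 0, 0)`. -/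
theorem hasDerivAt_opX {f : Heis → ℂ} (hf : Smooth f) (p : Heis) (t : ℝ) :
    HasDerivAt (fun s : ℝ => f (p * ⟨s, 0, 0⟩)) (opX f (p * ⟨t, 0, 0⟩)) t := by
  have h := (hf.hasFDerivAt (p.x + t, p.y, p.z)).comp_hasDerivAt t
    (f := fun s : ℝ => ((p.x + s, p.y, p.z) : Vec))
    (((hasDerivAt_id t).const_add p.x).prodMk
      ((hasDerivAt_const _ _).prodMk (hasDerivAt_const _ _)))
  rw [opX_eq_fderiv hf]
  simpa [mul_def, ofVec, Function.comp_def] using h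

/-- `Y` differentiates along the flow `p ↦ p ⋆ (0, s, 0)`. -/
theorem hasDerivAt_opY {f : Heis → ℂ} (hf : Smooth f) (p : Heis) (t : ℝ) :
    HasDerivAt (fun s : ℝ => f (p * ⟨0, s, 0⟩)) (opY f (p * ⟨0, t, 0⟩)) t := by
  have h := (hf.hasFDerivAt (p.x, p.y + t, p.z - p.x * t)).comp_hasDerivAt t
    (f := fun s : ℝ => ((p.x, p.y + s, p.z - p.x * s) : Vec))
    ((hasDerivAt_const _ _).prodMk (((hasDerivAt_id t).const_add p.y).prodMk
      (((hasDerivAt_id t).const_mul p.x).const_sub p.z)))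
  have h2 : ((0 : ℝ), (1 : ℝ), -(p.x * 1)) = ((0, 1, 0) : Vec) + (-p.x) • ((0, 0, 1) : Vec) := by
    simp
  rw [h2, map_add, map_smul] at h
  rw [opY_eq_sub, opy_eq_fderiv hf, opZ_eq_fderiv hf]
  simpa [mul_def, ofVec, Function.comp_def, sub_eq_add_neg] using h

theorem Smooth.comp_mul_left {f : Heis → ℂ} (hf : Smooth f) (γ : Heis) :
    Smooth fun p => f (γ * p) := by
  have h : ContDiff ℝ ∞ fun v : Vec =>
      ((γ.x + v.1, γ.y + v.2.1, γ.z + v.2.2 - γ.x * v.2.1) : Vec) := by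
    fun_prop
  exact ContDiff.comp (g := fun v : Vec => f (ofVec v)) hf h

/-- The vector field `X` is left-invariant. -/
theorem opX_comp_mul_left {f : Heis → ℂ} (hf : Smooth f) (γ : Heis) :
    opX (fun p => f (γ * p)) = fun p => opX f (γ * p) := by
  funext p
  have h1 := hasDerivAt_opX hf (γ * p) 0
  simp only [mul_assoc] at h1
  have h2 := (hasDerivAt_opX (hf.comp_mul_left γ) p 0).unique h1
  have h3 : (⟨0, 0, 0⟩ : Heis) = 1 := rfl
  rwa [h3, mul_one] at h2

/-- The vector field `Y` is left-invariant. -/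
theorem opY_comp_mul_left {f : Heis → ℂ} (hf : Smooth f) (γ : Heis) :
    opY (fun p => f (γ * p)) = fun p => opY f (γ * p) := by
  funext p
  have h1 := hasDerivAt_opY hf (γ * p) 0
  simp only [mul_assoc] at h1
  have h2 := (hasDerivAt_opY (hf.comp_mul_left γ) p 0).unique h1
  have h3 : (⟨0, 0, 0⟩ : Heis) = 1 := rfl
  rwa [h3, mul_one] at h2

/-! ### The maximum principle -/

/-- The nilmanifold is compact: a box is mapped onto it. -/
theorem exists_lattice_mul_mem_box (p : Heis) : ∃ γ ∈ lattice, ∃ v ∈ Set.Icc (0 : ℝ) √(2 * Real.pi) ×ˢ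
    (Set.Icc (0 : ℝ) √(2 * Real.pi) ×ˢ Set.Icc (0 : ℝ) (2 * Real.pi)), γ * p = ofVec v := by
  have hA : 0 < √(2 * Real.pi) := Real.sqrt_pos.2 (by positivity)
  have hB : 0 < 2 * Real.pi := by positivity
  have key : ∀ (A t : ℝ), 0 < A → ∃ n : ℤ, A * n + t ∈ Set.Icc 0 A := by
    intro A t hA
    refine ⟨-⌊t / A⌋, ?_⟩
    have h1 := Int.floor_le (t / A)
    have h2 := Int.lt_floor_add_one (t / A)
    rw [le_div_iff₀ hA] at h1
    rw [div_lt_iff₀ hA] at h2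
    push_cast
    constructor <;> nlinarith
  obtain ⟨a, ha⟩ := key _ p.x hA
  obtain ⟨b, hb⟩ := key _ p.y hA
  obtain ⟨c, hc⟩ := key _ (p.z - √(2 * Real.pi) * a * p.y) hB
  refine ⟨⟨√(2 * Real.pi) * a, √(2 * Real.pi) * b, 2 * Real.pi * c⟩,
    ⟨⟨a, rfl⟩, ⟨b, rfl⟩, ⟨c, rfl⟩⟩,
    (√(2 * Real.pi) * a + p.x, √(2 * Real.pi) * b + p.y,
      2 * Real.pi * c + (p.z - √(2 * Real.pi) * a * p.y)), ⟨ha, hb, hc⟩, ?_⟩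
  simp only [mul_def, ofVec]
  ext <;> simp only
  ring

theorem exists_isMax_of_invariant {g : Heis → ℝ} (hg : Continuous fun v : Vec => g (ofVec v))
    (hinv : ∀ γ ∈ lattice, ∀ p, g (γ * p) = g p) : ∃ p₀, ∀ p, g p ≤ g p₀ := by
  have hK : IsCompact (Set.Icc (0 : ℝ) √(2 * Real.pi) ×ˢ
    (Set.Icc (0 : ℝ) √(2 * Real.pi) ×ˢ Set.Icc (0 : ℝ) (2 * Real.pi))) :=
    isCompact_Icc.prod (isCompact_Icc.prod isCompact_Icc)
  obtain ⟨v₀, -, hv₀⟩ := hK.exists_isMaxOn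
    ⟨(0, 0, 0), ⟨by simp, by simp, by simp [Real.pi_pos.le]⟩⟩ hg.continuousOn
  refine ⟨ofVec v₀, fun p => ?_⟩
  obtain ⟨γ, hγ, v, hv, h⟩ := exists_lattice_mul_mem_box p
  rw [← hinv γ hγ p, h]
  exact hv₀ hv

/-- The contrapositive of the second derivative test for a strict local minimum. -/
theorem second_deriv_nonpos_of_isLocalMax {φ φ' : ℝ → ℝ} {a c : ℝ}
    (h1 : ∀ t, HasDerivAt φ (φ' t) t) (h2 : HasDerivAt φ' c a) (hmax : IsLocalMax φ a) :
    c ≤ 0 := by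
  by_contra! hc
  have hφ' : deriv φ = φ' := funext fun t => (h1 t).deriv
  have hmin : IsLocalMin φ a := by
    refine isLocalMin_of_deriv_deriv_pos ?_ ?_ (h1 a).continuousAt
    · rw [hφ', h2.deriv]; exact hc
    · exact hmax.deriv_eq_zero
  -- a local maximum that is a local minimum is locally constant
  have hconst : φ =ᶠ[𝓝 a] fun _ => φ a := by
    filter_upwards [hmin, hmax] with t ht ht' using le_antisymm ht' ht
  have h3 : φ' =ᶠ[𝓝 a] fun _ => 0 := by
    rw [← hφ']
    filter_upwards [hconst.eventuallyEq_nhds] with t ht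
    rw [ht.deriv_eq]; simp
  have h4 := h2.unique ((hasDerivAt_const a (0 : ℝ)).congr_of_eventuallyEq h3)
  exact hc.ne' h4

theorem hasDerivAt_re {f : ℝ → ℂ} {f' : ℂ} {t : ℝ} (h : HasDerivAt f f' t) :
    HasDerivAt (fun s => (f s).re) f'.re t :=
  (Complex.reCLM.hasFDerivAt.comp_hasDerivAt t h)

theorem re_nonpos_of_mem_eigenspace {μ : ℝ} (hμ : μ < 0) {f : Heis → ℂ} (hf : f ∈ eigenspace μ)
    (p : Heis) : (f p).re ≤ 0 := by
  obtain ⟨hs, hinv, hev⟩ := hf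
  obtain ⟨p₀, hp₀⟩ := exists_isMax_of_invariant (g := fun p => (f p).re)
    (Complex.continuous_re.comp hs.continuous_ofVec) (fun γ hγ p => by simp only [hinv γ hγ p])
  have h1 : (⟨0, 0, 0⟩ : Heis) = 1 := rfl
  have hX : (opX (opX f) p₀).re ≤ 0 := by
    have h2 := hasDerivAt_re (hasDerivAt_opX hs.opX p₀ 0)
    rw [h1, mul_one] at h2
    refine second_deriv_nonpos_of_isLocalMax (fun t => hasDerivAt_re (hasDerivAt_opX hs p₀ t)) h2
      (Eventually.of_forall fun t => ?_)
    simp only [h1, mul_one]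
    exact hp₀ _
  have hY : (opY (opY f) p₀).re ≤ 0 := by
    have h2 := hasDerivAt_re (hasDerivAt_opY hs.opY p₀ 0)
    rw [h1, mul_one] at h2
    refine second_deriv_nonpos_of_isLocalMax (fun t => hasDerivAt_re (hasDerivAt_opY hs p₀ t)) h2
      (Eventually.of_forall fun t => ?_)
    simp only [h1, mul_one]
    exact hp₀ _
  have h3 := congrArg Complex.re (hev p₀)
  simp only [laplacian, Complex.neg_re, Complex.add_re, Complex.re_ofReal_mul] at h3
  have h4 : (f p₀).re ≤ 0 := by
    by_contra! h5
    nlinarith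
  exact (hp₀ p).trans h4

/-- The sub-Laplacian is non-negative: at a maximum of the real part of an eigenfunction the
second derivatives along `X` and `Y` are non-positive. -/
theorem eigenspace_eq_bot_of_neg {μ : ℝ} (hμ : μ < 0) : eigenspace μ = ⊥ := by
  rw [eq_bot_iff]
  intro f hf
  rw [Submodule.mem_bot]
  funext p
  have h1 := re_nonpos_of_mem_eigenspace hμ hf p
  have h2 := re_nonpos_of_mem_eigenspace hμ (neg_mem hf) p
  have h3 := re_nonpos_of_mem_eigenspace hμ ((eigenspace μ).smul_mem Complex.I hf) p
  have h4 := re_nonpos_of_mem_eigenspace hμ ((eigenspace μ).smul_mem (-Complex.I) hf) p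
  simp at h1 h2 h3 h4
  apply Complex.ext <;> simp <;> linarith

/-! ### Vertical modes and ladder operators -/

theorem opX_opy {f : Heis → ℂ} (hf : Smooth f) : opX (opy f) = opy (opX f) := by
  funext p
  have hF : ContDiff ℝ ∞ fun v : Vec => f (ofVec v) := hf
  have hd : Differentiable ℝ (fderiv ℝ fun v : Vec => f (ofVec v)) :=
    (hF.fderiv_right (m := ∞) (by simp)).differentiable (by simp)
  have h1 : (fun v : Vec => opy f (ofVec v)) = fun v : Vec =>
      fderiv ℝ (fun v : Vec => f (ofVec v)) v (0, 1, 0) := by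
    funext v; exact opy_eq_fderiv hf (ofVec v)
  have h2 : (fun v : Vec => opX f (ofVec v)) = fun v : Vec =>
      fderiv ℝ (fun v : Vec => f (ofVec v)) v (1, 0, 0) := by
    funext v; exact opX_eq_fderiv hf (ofVec v)
  rw [opX_eq_fderiv hf.opy, opy_eq_fderiv hf.opX, h1, h2,
    fderiv_clm_apply (hd _) (differentiableAt_const _),
    fderiv_clm_apply (hd _) (differentiableAt_const _)]
  simpa using (hF.contDiffAt.isSymmSndFDerivAt
    (by rw [minSmoothness_of_isRCLikeNormedField]
        exact WithTop.coe_le_coe.2 (le_top : (2 : ℕ∞) ≤ ⊤))).eq (1, 0, 0) (0, 1, 0)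

theorem opX_opZ {f : Heis → ℂ} (hf : Smooth f) : opX (opZ f) = opZ (opX f) := by
  funext p
  have hF : ContDiff ℝ ∞ fun v : Vec => f (ofVec v) := hf
  have hd : Differentiable ℝ (fderiv ℝ fun v : Vec => f (ofVec v)) :=
    (hF.fderiv_right (m := ∞) (by simp)).differentiable (by simp)
  have h1 : (fun v : Vec => opZ f (ofVec v)) = fun v : Vec =>
      fderiv ℝ (fun v : Vec => f (ofVec v)) v (0, 0, 1) := by
    funext v; exact opZ_eq_fderiv hf (ofVec v)
  have h2 : (fun v : Vec => opX f (ofVec v)) = fun v : Vec =>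
      fderiv ℝ (fun v : Vec => f (ofVec v)) v (1, 0, 0) := by
    funext v; exact opX_eq_fderiv hf (ofVec v)
  rw [opX_eq_fderiv hf.opZ, opZ_eq_fderiv hf.opX, h1, h2,
    fderiv_clm_apply (hd _) (differentiableAt_const _),
    fderiv_clm_apply (hd _) (differentiableAt_const _)]
  simpa using (hF.contDiffAt.isSymmSndFDerivAt
    (by rw [minSmoothness_of_isRCLikeNormedField]
        exact WithTop.coe_le_coe.2 (le_top : (2 : ℕ∞) ≤ ⊤))).eq (1, 0, 0) (0, 0, 1)

/-- The commutation relation `[X, Y] = -Z`. -/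
theorem opX_opY {f : Heis → ℂ} (hf : Smooth f) : opX (opY f) = opY (opX f) - opZ f := by
  funext p
  have h1 := opX_eq hf.opy p
  have h2 := opX_eq hf.opZ p
  have h3 : HasDerivAt (fun s : ℝ => (s : ℂ)) 1 p.x := Complex.ofRealCLM.hasDerivAt
  have h4 := (h1.sub (h3.mul h2)).deriv
  rw [← opX_eq_fderiv hf.opy, ← opX_eq_fderiv hf.opZ] at h4
  have h5 : opX (opY f) p = _ := h4
  rw [h5, opX_opy hf, opX_opZ hf, Pi.sub_apply, opY_eq_sub]
  ring

/-- Functions on which the centre acts by the character `s ↦ e^{ims}`. -/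
def verticalMode (m : ℤ) : Submodule ℂ (Heis → ℂ) where
  carrier := {f | ∀ (s : ℝ) (p : Heis), f (⟨0, 0, s⟩ * p) = Complex.exp (Complex.I * m * s) * f p}
  add_mem' := fun hf hg s p => by
    simp only [Pi.add_apply, hf s p, hg s p, mul_add]
  zero_mem' := fun s p => by simp
  smul_mem' := fun c f hf s p => by
    simp only [Pi.smul_apply, hf s p, smul_eq_mul]; ring

/-- The part of the `μ`-eigenspace on which the centre acts by the character `s ↦ e^{ims}`. -/
def modeSpace (m : ℤ) (μ : ℝ) : Submodule ℂ (Heis → ℂ) := eigenspace μ ⊓ verticalMode m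

theorem vertical_mul (x y z s : ℝ) : (⟨0, 0, s⟩ : Heis) * ⟨x, y, z⟩ = ⟨x, y, z + s⟩ := by
  simp [mul_def, add_comm]

theorem apply_eq_of_mem_verticalMode {m : ℤ} {f : Heis → ℂ} (hf : f ∈ verticalMode m)
    (x y z : ℝ) : f ⟨x, y, z⟩ = Complex.exp (Complex.I * m * z) * f ⟨x, y, 0⟩ := by
  have h := hf z ⟨x, y, 0⟩
  rwa [vertical_mul, zero_add] at h

theorem opZ_of_mem_verticalMode {m : ℤ} {f : Heis → ℂ} (hf : f ∈ verticalMode m) :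
    opZ f = (Complex.I * m) • f := by
  funext p
  have h1 : (fun s : ℝ => f ⟨p.x, p.y, s⟩) =
      fun s : ℝ => Complex.exp (Complex.I * m * s) * f ⟨p.x, p.y, 0⟩ :=
    funext fun s => apply_eq_of_mem_verticalMode hf _ _ _
  have h3 : HasDerivAt (fun s : ℝ => Complex.I * m * (s : ℂ)) (Complex.I * m * 1) p.z :=
    (Complex.ofRealCLM.hasDerivAt (x := p.z)).const_mul (Complex.I * m)
  have h4 := (h3.cexp.mul_const (f ⟨p.x, p.y, 0⟩)).deriv
  have h5 := apply_eq_of_mem_verticalMode hf p.x p.y p.z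
  have h6 : f p = f ⟨p.x, p.y, p.z⟩ := rfl
  rw [opZ, h1, h4, Pi.smul_apply, h6, h5, smul_eq_mul]
  ring

/-- The operators `X - iεY`. For `ε = ±1` they raise and lower the eigenvalue of the Laplacian
on a vertical mode. -/
def ladder (ε : ℝ) (f : Heis → ℂ) : Heis → ℂ := opX f + (-(ε * Complex.I)) • opY f

theorem Smooth.ladder {f : Heis → ℂ} (hf : Smooth f) (ε : ℝ) : Smooth (ladder ε f) :=
  hf.opX.add (hf.opY.smul _)

theorem ladder_add {f g : Heis → ℂ} (hf : Smooth f) (hg : Smooth g) (ε : ℝ) :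
    ladder ε (f + g) = ladder ε f + ladder ε g := by
  simp only [ladder, opX_add hf hg, opY_add hf hg, smul_add]
  abel

theorem ladder_smul (c : ℂ) (f : Heis → ℂ) (ε : ℝ) : ladder ε (c • f) = c • ladder ε f := by
  simp only [ladder, opX_smul, opY_smul, smul_add, smul_comm c]

theorem ladder_comp_mul_left {f : Heis → ℂ} (hf : Smooth f) (ε : ℝ) (γ : Heis) :
    ladder ε (fun p => f (γ * p)) = fun p => ladder ε f (γ * p) := by
  simp only [ladder, opX_comp_mul_left hf, opY_comp_mul_left hf]
  rfl

theorem ladder_mem_verticalMode {f : Heis → ℂ} (hf : Smooth f) {m : ℤ} (hm : f ∈ verticalMode m)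
    (ε : ℝ) : ladder ε f ∈ verticalMode m := by
  intro s p
  have h1 := congrFun (ladder_comp_mul_left hf ε ⟨0, 0, s⟩) p
  have h2 : (fun p => f (⟨0, 0, s⟩ * p)) = Complex.exp (Complex.I * m * s) • f :=
    funext fun p => hm s p
  rw [h2, ladder_smul] at h1
  exact h1.symm

/-- The factorization of the Laplacian `Δ` on a vertical mode:
`(X + iεY)(X - iεY) = -(Δ + εm)`. -/
theorem ladder_neg_ladder {f : Heis → ℂ} (hf : Smooth f) {m : ℤ} (hm : f ∈ verticalMode m)
    {ε : ℝ} (hε : ε ^ 2 = 1) :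
    ladder (-ε) (ladder ε f) = -(laplacian f) - ((ε * m : ℝ) : ℂ) • f := by
  have hε' : (ε : ℂ) ^ 2 = 1 := by exact_mod_cast hε
  have h1 : opX (ladder ε f) = opX (opX f) + (-(ε * Complex.I)) • opX (opY f) := by
    rw [ladder, opX_add hf.opX (hf.opY.smul _), opX_smul]
  have h2 : opY (ladder ε f) = opY (opX f) + (-(ε * Complex.I)) • opY (opY f) := by
    rw [ladder, opY_add hf.opX (hf.opY.smul _), opY_smul]
  rw [ladder, h1, h2, opX_opY hf, opZ_of_mem_verticalMode hm]
  funext p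
  simp only [Pi.add_apply, Pi.sub_apply, Pi.smul_apply, Pi.neg_apply, smul_eq_mul, laplacian]
  push_cast
  linear_combination (opY (opY f) p) * ((-Complex.I ^ 2) * hε' - Complex.I_sq) +
    (ε * m * f p) * Complex.I_sq

theorem laplacian_eq_smul_of_mem {f : Heis → ℂ} {μ : ℝ} (hf : f ∈ eigenspace μ) :
    laplacian f = (μ : ℂ) • f := funext hf.2.2

theorem ladder_neg_ladder_of_mem {f : Heis → ℂ} {m : ℤ} {μ : ℝ} (hf : f ∈ modeSpace m μ)
    {ε : ℝ} (hε : ε ^ 2 = 1) :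
    ladder (-ε) (ladder ε f) = (-((μ + ε * m : ℝ) : ℂ)) • f := by
  rw [ladder_neg_ladder hf.1.1 hf.2 hε, laplacian_eq_smul_of_mem hf.1]
  push_cast
  rw [neg_smul, add_smul, neg_add, sub_eq_add_neg]

/-- Composing the two factorizations shows that a ladder operator shifts the eigenvalue by `2εm`. -/
theorem ladder_mem_modeSpace {f : Heis → ℂ} {m : ℤ} {μ μ' : ℝ} (hf : f ∈ modeSpace m μ)
    {ε : ℝ} (hε : ε ^ 2 = 1) (hμ' : μ' = μ + 2 * ε * m) : ladder ε f ∈ modeSpace m μ' := by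
  -- `Δ + εm = -DD'` and `Δ - εm = -D'D` for `D' = X - iεY` and `D = X + iεY`; apply `D'` to the
  -- equation `DD' f = -(μ + εm) f`
  have hs := hf.1.1
  have hm := ladder_mem_verticalMode hs hf.2 ε
  refine ⟨⟨hs.ladder ε, fun γ hγ p => ?_, fun p => ?_⟩, hm⟩
  · have h1 := congrFun (ladder_comp_mul_left hs ε γ) p
    have h2 : (fun p => f (γ * p)) = f := funext fun p => hf.1.2.1 γ hγ p
    rw [h2] at h1
    exact h1.symm
  · have h1 := ladder_neg_ladder (hs.ladder ε) hm (ε := -ε) (by rwa [neg_sq])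
    rw [ladder_neg_ladder_of_mem hf hε, ladder_smul, neg_neg] at h1
    have h2 := congrFun h1 p
    simp only [Pi.sub_apply, Pi.smul_apply, Pi.neg_apply, smul_eq_mul] at h2
    rw [hμ']
    push_cast at h2 ⊢
    linear_combination h2

/-- The lowering operator is an isomorphism except at the lowest eigenvalue of a vertical mode. -/
theorem nonempty_modeSpace_equiv {m : ℤ} {μ : ℝ} (h : μ ≠ m) :
    Nonempty (modeSpace m μ ≃ₗ[ℂ] modeSpace m (μ - 2 * m)) := by
  have hc : ((μ + -1 * m : ℝ) : ℂ) ≠ 0 := by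
    rw [Ne, Complex.ofReal_eq_zero]
    intro h'
    exact h (by linarith)
  let L : modeSpace m μ →ₗ[ℂ] modeSpace m (μ - 2 * m) :=
    { toFun := fun f => ⟨ladder (-1) f, ladder_mem_modeSpace f.2 (by norm_num) (by ring)⟩
      map_add' := fun f g => Subtype.ext (ladder_add f.2.1.1 g.2.1.1 _)
      map_smul' := fun c f => Subtype.ext (ladder_smul c _ _) }
  refine ⟨LinearEquiv.ofBijective L ⟨?_, fun g => ?_⟩⟩
  · rw [injective_iff_map_eq_zero]
    intro f hf
    have h0 : ladder (-1) (f : Heis → ℂ) = 0 := congrArg Subtype.val hf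
    have h1 := ladder_neg_ladder_of_mem f.2 (ε := -1) (by norm_num)
    have h2 : ladder (-(-1)) (0 : Heis → ℂ) = 0 := by
      simpa using ladder_smul 0 (0 : Heis → ℂ) (-(-1))
    rw [h0, h2] at h1
    exact Subtype.ext ((smul_eq_zero.1 h1.symm).resolve_left (neg_ne_zero.2 hc))
  · have hg := ladder_mem_modeSpace g.2 (ε := 1) (μ' := μ) (by norm_num) (by ring)
    refine ⟨(-((μ + -1 * m : ℝ) : ℂ))⁻¹ • ⟨_, hg⟩, Subtype.ext ?_⟩
    have h1 := ladder_neg_ladder_of_mem g.2 (ε := 1) (by norm_num)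
    have h2 : (μ - 2 * m + 1 * m : ℝ) = μ + -1 * m := by ring
    rw [h2] at h1
    change ladder (-1) ((-((μ + -1 * m : ℝ) : ℂ))⁻¹ • ladder 1 (g : Heis → ℂ)) = g
    rw [ladder_smul, h1, smul_smul, inv_mul_cancel₀ (neg_ne_zero.2 hc), one_smul]

theorem modeSpace_eq_bot_of_neg (m : ℤ) {μ : ℝ} (hμ : μ < 0) : modeSpace m μ = ⊥ := by
  rw [modeSpace, eigenspace_eq_bot_of_neg hμ, bot_inf_eq]

/-- Landau levels: a vertical mode `m > 0` only has the eigenvalues `(2k+1)m`. -/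
theorem modeSpace_eq_bot {m : ℤ} (hm : 0 < m) {μ : ℝ} (h : ∀ k : ℕ, μ ≠ (2 * k + 1) * m) :
    modeSpace m μ = ⊥ := by
  have hm' : (0 : ℝ) < m := by exact_mod_cast hm
  -- the lowering operator is injective on the way down to a negative eigenvalue
  obtain ⟨N, hN⟩ := exists_nat_gt (μ / (2 * m))
  rw [div_lt_iff₀ (by positivity)] at hN
  induction N generalizing μ with
  | zero => exact modeSpace_eq_bot_of_neg m (by simpa using hN)
  | succ N ih =>
    have hμ : μ ≠ m := by simpa using h 0
    obtain ⟨e⟩ := nonempty_modeSpace_equiv hμ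
    have h1 : modeSpace m (μ - 2 * m) = ⊥ := by
      refine ih (fun k hk => h (k + 1) ?_) ?_
      · push_cast; linarith
      · push_cast at hN; linarith
    rw [← Submodule.subsingleton_iff_eq_bot] at h1 ⊢
    exact e.toEquiv.subsingleton

/-- Each Landau level of a vertical mode is mapped isomorphically to the lowest one. -/
theorem nonempty_modeSpace_equiv_lowest {m : ℤ} (hm : m ≠ 0) (k : ℕ) :
    Nonempty (modeSpace m ((2 * k + 1) * m) ≃ₗ[ℂ] modeSpace m m) := by
  have hm' : (m : ℝ) ≠ 0 := by exact_mod_cast hm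
  induction k with
  | zero => exact ⟨LinearEquiv.ofEq _ _ (by simp)⟩
  | succ k ih =>
    obtain ⟨e⟩ := ih
    have h1 : ((2 * (k + 1 : ℕ) + 1) * m : ℝ) ≠ m := by
      intro h
      have h2 : ((2 * k + 2 : ℝ)) * m = 0 := by push_cast at h; linarith
      rcases mul_eq_zero.1 h2 with h3 | h3
      · have : (0 : ℝ) ≤ k := Nat.cast_nonneg k
        linarith
      · exact hm' h3
    obtain ⟨e'⟩ := nonempty_modeSpace_equiv h1
    have h2 : ((2 * (k + 1 : ℕ) + 1) * m - 2 * m : ℝ) = (2 * k + 1) * m := by push_cast; ring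
    rw [h2] at e'
    exact ⟨e'.trans e⟩

/-- The lowest Landau level consists of the functions annihilated by `X + iY`. -/
theorem mem_modeSpace_lowest_iff {m : ℤ} (hm : 0 < m) {f : Heis → ℂ} :
    f ∈ modeSpace m m ↔ Smooth f ∧ (∀ γ ∈ lattice, ∀ p, f (γ * p) = f p) ∧ f ∈ verticalMode m ∧
      ladder (-1) f = 0 := by
  constructor
  · intro hf
    refine ⟨hf.1.1, hf.1.2.1, hf.2, ?_⟩
    have h1 := ladder_mem_modeSpace hf (ε := -1) (μ' := -m) (by norm_num) (by ring)
    have hm' : (0 : ℝ) < m := by exact_mod_cast hm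
    rw [modeSpace_eq_bot_of_neg m (by linarith)] at h1
    exact h1
  · rintro ⟨hs, hinv, hv, h0⟩
    refine ⟨⟨hs, hinv, fun p => ?_⟩, hv⟩
    have h1 := congrFun (ladder_neg_ladder hs hv (ε := -1) (by norm_num)) p
    have h2 : ladder (-(-1)) (0 : Heis → ℂ) = 0 := by
      simpa using ladder_smul 0 (0 : Heis → ℂ) (-(-1))
    rw [h0, h2] at h1
    simp only [Pi.sub_apply, Pi.smul_apply, Pi.neg_apply, smul_eq_mul, Pi.zero_apply] at h1
    push_cast at h1 ⊢
    linear_combination h1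

/-! ### The reflection symmetry -/

/-- The automorphism `(x, y, z) ↦ (-x, y, -z)` of the Heisenberg group. -/
def reflection (p : Heis) : Heis := ⟨-p.x, p.y, -p.z⟩

theorem reflection_reflection (p : Heis) : reflection (reflection p) = p := by
  simp [reflection]

theorem reflection_mul (p q : Heis) : reflection (p * q) = reflection p * reflection q := by
  simp only [reflection, mul_def]
  ext <;> simp only <;> ring

theorem reflection_mem_lattice {γ : Heis} (hγ : γ ∈ lattice) : reflection γ ∈ lattice := by
  obtain ⟨⟨a, ha⟩, ⟨b, hb⟩, ⟨c, hc⟩⟩ := hγ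
  exact ⟨⟨-a, by simp [reflection, ha]⟩, ⟨b, by simp [reflection, hb]⟩,
    ⟨-c, by simp [reflection, hc]⟩⟩

theorem Smooth.comp_reflection {f : Heis → ℂ} (hf : Smooth f) :
    Smooth fun p => f (reflection p) := by
  have h : ContDiff ℝ ∞ fun v : Vec => ((-v.1, v.2.1, -v.2.2) : Vec) := by fun_prop
  exact ContDiff.comp (g := fun v : Vec => f (ofVec v)) hf h

theorem opX_comp_reflection {f : Heis → ℂ} (hf : Smooth f) :
    opX (fun p => f (reflection p)) = -fun p => opX f (reflection p) := by
  funext p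
  have h1 := (hasDerivAt_opX hf (reflection p) (-0)).scomp (0 : ℝ) (hasDerivAt_neg (0 : ℝ))
  have h2 := hasDerivAt_opX hf.comp_reflection p 0
  have h3 : (fun s : ℝ => f (reflection (p * ⟨s, 0, 0⟩))) =
      (fun s : ℝ => f (reflection p * ⟨s, 0, 0⟩)) ∘ Neg.neg := by
    funext s
    simp only [reflection_mul, Function.comp_apply]
    simp [reflection]
  rw [h3] at h2
  have h4 : (⟨0, 0, 0⟩ : Heis) = 1 := rfl
  have h5 := h2.unique h1
  rw [neg_zero, h4, mul_one, mul_one] at h5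
  simpa using h5

theorem opY_comp_reflection {f : Heis → ℂ} (hf : Smooth f) :
    opY (fun p => f (reflection p)) = fun p => opY f (reflection p) := by
  funext p
  have h1 := hasDerivAt_opY hf (reflection p) 0
  have h2 := hasDerivAt_opY hf.comp_reflection p 0
  have h3 : (fun s : ℝ => f (reflection (p * ⟨0, s, 0⟩))) =
      (fun s : ℝ => f (reflection p * ⟨0, s, 0⟩)) := by
    funext s
    simp only [reflection_mul]
    simp [reflection]
  rw [h3] at h2
  have h4 : (⟨0, 0, 0⟩ : Heis) = 1 := rfl
  have h5 := h2.unique h1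
  rwa [h4, mul_one, mul_one] at h5

theorem comp_reflection_mem_modeSpace {f : Heis → ℂ} {m m' : ℤ} {μ : ℝ} (hf : f ∈ modeSpace m μ)
    (hm : m' = -m) : (fun p => f (reflection p)) ∈ modeSpace m' μ := by
  have hs := hf.1.1
  refine ⟨⟨hs.comp_reflection, fun γ hγ p => ?_, fun p => ?_⟩, fun s p => ?_⟩
  · simp only [reflection_mul, hf.1.2.1 _ (reflection_mem_lattice hγ)]
  · have h1 := hf.1.2.2 (reflection p)
    rw [laplacian, opY_comp_reflection hs, opY_comp_reflection hs.opY, opX_comp_reflection hs,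
      ← neg_one_smul ℂ (fun p => opX f (reflection p)), opX_smul, opX_comp_reflection hs.opX,
      neg_one_smul, neg_neg]
    exact h1
  · have h1 := hf.2 (-s) (reflection p)
    have h2 : reflection ⟨0, 0, s⟩ = ⟨0, 0, -s⟩ := by simp [reflection]
    simp only [reflection_mul]
    rw [h2, h1, hm]
    push_cast
    ring_nf

/-- The reflection maps `X` to `-X`, fixes `Y` and inverts the centre, so it exchanges the vertical
modes `m` and `-m` and preserves the Laplacian. -/
theorem nonempty_modeSpace_neg_equiv (m : ℤ) (μ : ℝ) :
    Nonempty (modeSpace m μ ≃ₗ[ℂ] modeSpace (-m) μ) :=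
  ⟨{ toFun := fun f => ⟨_, comp_reflection_mem_modeSpace f.2 rfl⟩
     map_add' := fun _ _ => rfl
     map_smul' := fun _ _ => rfl
     invFun := fun f => ⟨_, comp_reflection_mem_modeSpace f.2 (neg_neg m).symm⟩
     left_inv := fun f => Subtype.ext (funext fun p => by
      simp only [reflection_reflection])
     right_inv := fun f => Subtype.ext (funext fun p => by
      simp only [reflection_reflection]) }⟩

/-! ### Smooth dependence of integrals on parameters -/

section ParametricIntegral

variable {V : Type} [NormedAddCommGroup V] [NormedSpace ℝ V] [ProperSpace V]

theorem hasFDerivAt_intervalIntegral_of_contDiff {E : Type} [NormedAddCommGroup E]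
    [NormedSpace ℝ E] {G : ℝ × V → E} (hG : ContDiff ℝ 1 G) (v₀ : V) :
    HasFDerivAt (fun v => ∫ s in (0 : ℝ)..1, G (s, v))
      (∫ s in (0 : ℝ)..1, (fderiv ℝ G (s, v₀)).comp (ContinuousLinearMap.inr ℝ ℝ V)) v₀ := by
  have hc : Continuous fun q : ℝ × V => (fderiv ℝ G q).comp (ContinuousLinearMap.inr ℝ ℝ V) :=
    (hG.continuous_fderiv (by simp)).clm_comp continuous_const
  obtain ⟨C, hC⟩ := (isCompact_Icc.prod (isCompact_closedBall v₀ 1)).exists_bound_of_continuousOn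
    (s := Set.Icc (0 : ℝ) 1 ×ˢ Metric.closedBall v₀ 1) hc.continuousOn
  have hcs : ∀ v, Continuous fun s : ℝ => G (s, v) := fun v =>
    hG.continuous.comp (by fun_prop)
  refine intervalIntegral.hasFDerivAt_integral_of_dominated_of_fderiv_le
    (F := fun v s => G (s, v)) (bound := fun _ => C)
    (F' := fun v s => (fderiv ℝ G (s, v)).comp (ContinuousLinearMap.inr ℝ ℝ V))
    (Metric.closedBall_mem_nhds v₀ one_pos)
    (Eventually.of_forall fun v => (hcs v).aestronglyMeasurable)
    ((hcs v₀).intervalIntegrable _ _) ?_ ?_ intervalIntegrable_const ?_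
  · exact (hc.comp (by fun_prop : Continuous fun s : ℝ => (s, v₀))).aestronglyMeasurable
  · refine Eventually.of_forall fun s hs v hv => hC (s, v) ⟨?_, hv⟩
    rw [Set.uIoc_of_le zero_le_one] at hs
    exact Set.Ioc_subset_Icc_self hs
  · refine Eventually.of_forall fun s _ v _ => ?_
    exact ((hG.differentiable (by simp) (s, v)).hasFDerivAt).comp v (hasFDerivAt_prodMk_right s v)

theorem contDiff_intervalIntegral_nat (n : ℕ) : ∀ {E : Type} [NormedAddCommGroup E]
    [NormedSpace ℝ E] {G : ℝ × V → E}, ContDiff ℝ n G →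
      ContDiff ℝ n fun v => ∫ s in (0 : ℝ)..1, G (s, v) := by
  induction n with
  | zero =>
    intro E _ _ G hG
    rw [Nat.cast_zero, contDiff_zero] at hG ⊢
    exact intervalIntegral.continuous_parametric_intervalIntegral_of_continuous'
      (f := fun v s => G (s, v)) (by exact hG.comp continuous_swap) 0 1
  | succ n ih =>
    intro E _ _ G hG
    have h1 : ContDiff ℝ 1 G := hG.of_le (by exact_mod_cast Nat.le_add_left 1 n)
    have hd := hasFDerivAt_intervalIntegral_of_contDiff h1
    rw [Nat.cast_succ, contDiff_succ_iff_fderiv] at hG ⊢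
    refine ⟨fun v => (hd v).differentiableAt, by simp, ?_⟩
    have h2 : (fderiv ℝ fun v => ∫ s in (0 : ℝ)..1, G (s, v)) = fun v =>
        ∫ s in (0 : ℝ)..1, (fderiv ℝ G (s, v)).comp (ContinuousLinearMap.inr ℝ ℝ V) :=
      funext fun v => (hd v).fderiv
    rw [h2]
    exact ih (G := fun q => (fderiv ℝ G q).comp (ContinuousLinearMap.inr ℝ ℝ V))
      (hG.2.2.clm_comp contDiff_const)

theorem contDiff_intervalIntegral {E : Type} [NormedAddCommGroup E] [NormedSpace ℝ E]
    {G : ℝ × V → E} (hG : ContDiff ℝ ∞ G) :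
    ContDiff ℝ ∞ fun v => ∫ s in (0 : ℝ)..1, G (s, v) :=
  contDiff_infty.2 fun n => contDiff_intervalIntegral_nat n (contDiff_infty.1 hG n)

end ParametricIntegral

/-! ### Fourier coefficients along lines -/

/-- The translate of a point of `ℝ³` by a vector. -/
def translate (w : Vec) (s : ℝ) (p : Heis) : Heis :=
  ⟨p.x + s * w.1, p.y + s * w.2.1, p.z + s * w.2.2⟩

theorem translate_translate (w : Vec) (s t : ℝ) (p : Heis) :
    translate w s (translate w t p) = translate w (t + s) p := by
  simp only [translate, add_mul, add_assoc]

theorem translate_zero (w : Vec) (p : Heis) : translate w 0 p = p := by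
  simp [translate]

/-- The `k`-th Fourier coefficient of `s ↦ f (p + s w)` on `[0, 1]`, as a function of `p`. -/
def fourierAverage (w : Vec) (k : ℤ) (f : Heis → ℂ) (p : Heis) : ℂ :=
  ∫ s in (0 : ℝ)..1, Complex.exp (-(2 * Real.pi * Complex.I * k * s)) * f (translate w s p)

/-- The integrand of `fourierAverage`, as a function on `ℝ × ℝ³`. -/
def averageIntegrand (w : Vec) (k : ℤ) (f : Heis → ℂ) (q : ℝ × Vec) : ℂ :=
  Complex.exp (-(2 * Real.pi * Complex.I * k * q.1)) * f (translate w q.1 (ofVec q.2))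

theorem Smooth.averageIntegrand {f : Heis → ℂ} (hf : Smooth f) (w : Vec) (k : ℤ) :
    ContDiff ℝ ∞ (averageIntegrand w k f) := by
  have h1 : ContDiff ℝ ∞ fun q : ℝ × Vec => f (translate w q.1 (ofVec q.2)) := by
    have h : ContDiff ℝ ∞ fun q : ℝ × Vec => ((q.2.1 + q.1 * w.1, q.2.2.1 + q.1 * w.2.1,
        q.2.2.2 + q.1 * w.2.2) : Vec) := by fun_prop
    exact ContDiff.comp (g := fun v : Vec => f (ofVec v)) hf h
  have h2 : ContDiff ℝ ∞ fun q : ℝ × Vec =>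
      Complex.exp (-(2 * Real.pi * Complex.I * k * q.1)) := by
    have h3 : ContDiff ℝ ∞ fun q : ℝ × Vec => (q.1 : ℂ) :=
      Complex.ofRealCLM.contDiff.comp contDiff_fst
    exact (contDiff_const.mul h3).neg.cexp
  exact h2.mul h1

theorem Smooth.fourierAverage {f : Heis → ℂ} (hf : Smooth f) (w : Vec) (k : ℤ) :
    Smooth (fourierAverage w k f) :=
  contDiff_intervalIntegral (hf.averageIntegrand w k)

theorem continuous_translate {f : Heis → ℂ} (hf : Smooth f) (w : Vec) (p : Heis) :
    Continuous fun s : ℝ => f (translate w s p) := by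
  have h : Continuous fun s : ℝ => ((p.x + s * w.1, p.y + s * w.2.1, p.z + s * w.2.2) : Vec) := by
    fun_prop
  exact hf.continuous_ofVec.comp h

theorem intervalIntegrable_average {f : Heis → ℂ} (hf : Smooth f) (w : Vec) (k : ℤ) (p : Heis) :
    IntervalIntegrable (fun s : ℝ => Complex.exp (-(2 * Real.pi * Complex.I * k * s)) *
      f (translate w s p)) volume 0 1 := by
  have h : Continuous fun s : ℝ => Complex.exp (-(2 * Real.pi * Complex.I * k * s)) := by fun_prop
  exact (h.mul (continuous_translate hf w p)).intervalIntegrable _ _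

/-- Differentiation under the integral sign commutes with translations. -/
theorem fderiv_fourierAverage {f : Heis → ℂ} (hf : Smooth f) (w : Vec) (k : ℤ) (p : Heis)
    (e : Vec) :
    fderiv ℝ (fun v : Vec => fourierAverage w k f (ofVec v)) (p.x, p.y, p.z) e =
      ∫ s in (0 : ℝ)..1, Complex.exp (-(2 * Real.pi * Complex.I * k * s)) *
        fderiv ℝ (fun v : Vec => f (ofVec v))
          (p.x + s * w.1, p.y + s * w.2.1, p.z + s * w.2.2) e := by
  have hG : ContDiff ℝ 1 (averageIntegrand w k f) := (hf.averageIntegrand w k).of_le (by simp)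
  have h1 := (hasFDerivAt_intervalIntegral_of_contDiff hG (p.x, p.y, p.z)).fderiv
  have h2 : (fun v : Vec => fourierAverage w k f (ofVec v)) =
    fun v => ∫ s in (0 : ℝ)..1, averageIntegrand w k f (s, v) := rfl
  have hc : Continuous fun s : ℝ => (fderiv ℝ (averageIntegrand w k f) (s, (p.x, p.y, p.z))).comp
      (ContinuousLinearMap.inr ℝ ℝ Vec) :=
    ((hG.continuous_fderiv (by simp)).comp (by fun_prop)).clm_comp continuous_const
  rw [h2, h1, ContinuousLinearMap.intervalIntegral_apply (hc.intervalIntegrable _ _)]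
  refine intervalIntegral.integral_congr fun s _ => ?_
  have h3 := ((hG.differentiable (by simp) (s, (p.x, p.y, p.z))).hasFDerivAt).comp
    ((p.x, p.y, p.z) : Vec) (hasFDerivAt_prodMk_right s ((p.x, p.y, p.z) : Vec))
  have h4 : HasFDerivAt (fun v : Vec => ((v.1 + s * w.1, v.2.1 + s * w.2.1,
      v.2.2 + s * w.2.2) : Vec)) (ContinuousLinearMap.id ℝ Vec) (p.x, p.y, p.z) :=
    (hasFDerivAt_id (𝕜 := ℝ) ((p.x, p.y, p.z) : Vec)).add_const
      ((s * w.1, s * w.2.1, s * w.2.2) : Vec)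
  have h5 := ((hf.hasFDerivAt (p.x + s * w.1, p.y + s * w.2.1, p.z + s * w.2.2)).comp
    ((p.x, p.y, p.z) : Vec) h4).const_smul (Complex.exp (-(2 * Real.pi * Complex.I * k * s)))
  have h6 := h3.unique h5
  exact DFunLike.congr_fun h6 e

theorem opX_fourierAverage {f : Heis → ℂ} (hf : Smooth f) (w : Vec) (k : ℤ) :
    opX (fourierAverage w k f) = fourierAverage w k (opX f) := by
  funext p
  rw [opX_eq_fderiv (hf.fourierAverage w k), fderiv_fourierAverage hf]
  simp only [fourierAverage, opX_eq_fderiv hf]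
  rfl

/-- Averaging along a vector commutes with `Y` if the vector has no `x`-component, or if the
function does not depend on the vertical coordinate. -/
theorem opY_fourierAverage {f : Heis → ℂ} (hf : Smooth f) {w : Vec} (k : ℤ)
    (hw : w.1 = 0 ∨ opZ f = 0) :
    opY (fourierAverage w k f) = fourierAverage w k (opY f) := by
  funext p
  rw [opY_eq_sub, opy_eq_fderiv (hf.fourierAverage w k), opZ_eq_fderiv (hf.fourierAverage w k),
    fderiv_fourierAverage hf, fderiv_fourierAverage hf, ← intervalIntegral.integral_const_mul]
  have h1 := intervalIntegrable_average hf.opy w k p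
  have h2 := (intervalIntegrable_average hf.opZ w k p).const_mul (p.x : ℂ)
  simp only [opy_eq_fderiv hf] at h1
  have h3 : ∀ s : ℝ, fderiv ℝ (fun v : Vec => f (ofVec v))
      (p.x + s * w.1, p.y + s * w.2.1, p.z + s * w.2.2) (0, 0, 1) = opZ f (translate w s p) :=
    fun s => (opZ_eq_fderiv hf (translate w s p)).symm
  simp only [h3]
  refine (intervalIntegral.integral_sub h1 h2).symm.trans ?_
  refine intervalIntegral.integral_congr fun s _ => ?_
  simp only [opY_eq_sub, opy_eq_fderiv hf]
  rcases hw with hw | hw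
  · simp only [translate, hw]
    push_cast
    ring
  · simp [hw]

theorem fourierAverage_smul (w : Vec) (k : ℤ) (c : ℂ) (f : Heis → ℂ) :
    fourierAverage w k (c • f) = c • fourierAverage w k f := by
  funext p
  simp only [fourierAverage, Pi.smul_apply, smul_eq_mul, ← intervalIntegral.integral_const_mul]
  congr 1
  funext s
  ring

theorem fourierAverage_add (w : Vec) (k : ℤ) {f g : Heis → ℂ} (hf : Smooth f) (hg : Smooth g) :
    fourierAverage w k (f + g) = fourierAverage w k f + fourierAverage w k g := by
  funext p
  simp only [fourierAverage, Pi.add_apply, mul_add]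
  exact intervalIntegral.integral_add (intervalIntegrable_average hf w k p)
    (intervalIntegrable_average hg w k p)

theorem exp_two_pi_int (k : ℤ) : Complex.exp (-(2 * Real.pi * Complex.I * k)) = 1 := by
  rw [Complex.exp_eq_one_iff]
  exact ⟨-k, by push_cast; ring⟩

/-- A Fourier mode is multiplied by a character under translations along its line. -/
theorem fourierAverage_translate {f : Heis → ℂ} {w : Vec} (hw : ∀ p, f (translate w 1 p) = f p)
    (k : ℤ) (t : ℝ) (p : Heis) : fourierAverage w k f (translate w t p) =
      Complex.exp (2 * Real.pi * Complex.I * k * t) * fourierAverage w k f p := by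
  have hper : Function.Periodic (fun s : ℝ => Complex.exp (-(2 * Real.pi * Complex.I * k * s)) *
      f (translate w s p)) 1 := by
    intro s
    have h1 : translate w (s + 1) p = translate w 1 (translate w s p) := by
      rw [translate_translate]
    have h2 : -(2 * Real.pi * Complex.I * k * ((s + 1 : ℝ) : ℂ)) =
      -(2 * Real.pi * Complex.I * k * s) + -(2 * Real.pi * Complex.I * k) := by push_cast; ring
    simp only [h1, hw, h2, Complex.exp_add, exp_two_pi_int, mul_one]
  have h1 := hper.intervalIntegral_add_eq t 0
  rw [zero_add] at h1
  rw [fourierAverage, fourierAverage, ← h1, ← intervalIntegral.integral_const_mul]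
  have h2 := intervalIntegral.integral_comp_add_left (fun s : ℝ =>
    Complex.exp (2 * Real.pi * Complex.I * k * t) *
    (Complex.exp (-(2 * Real.pi * Complex.I * k * s)) * f (translate w s p))) t (a := 0) (b := 1)
  rw [add_zero] at h2
  rw [← h2]
  refine intervalIntegral.integral_congr fun s _ => ?_
  simp only [translate_translate, ← mul_assoc, ← Complex.exp_add]
  congr 2
  push_cast
  ring

theorem integral_exp_two_pi (j : ℤ) :
    ∫ s in (0 : ℝ)..1, Complex.exp (2 * Real.pi * Complex.I * j * s) = if j = 0 then 1 else 0 := by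
  split_ifs with h
  · simp [h]
  · have h1 : (2 * Real.pi * Complex.I * j : ℂ) ≠ 0 := by
      simp [Real.pi_ne_zero, h]
    rw [integral_exp_mul_complex h1]
    have h2 := exp_two_pi_int (-j)
    push_cast at h2
    rw [mul_neg, neg_neg] at h2
    simp [h2]

theorem fourierAverage_of_character {f : Heis → ℂ} {w : Vec} {j : ℤ}
    (h : ∀ (t : ℝ) p, f (translate w t p) = Complex.exp (2 * Real.pi * Complex.I * j * t) * f p)
    (k : ℤ) : fourierAverage w k f = if j = k then f else 0 := by
  funext p
  have h1 : ∀ s : ℝ, Complex.exp (-(2 * Real.pi * Complex.I * k * s)) * f (translate w s p) =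
      Complex.exp (2 * Real.pi * Complex.I * (j - k : ℤ) * s) * f p := by
    intro s
    rw [h, ← mul_assoc, ← Complex.exp_add]
    congr 2
    push_cast
    ring
  simp only [fourierAverage, h1, intervalIntegral.integral_mul_const,
    integral_exp_two_pi, sub_eq_zero]
  split_ifs <;> simp

/-- A periodic function all of whose Fourier coefficients along a line vanish is zero. -/
theorem eq_zero_of_fourierAverage_eq_zero {f : Heis → ℂ} (hf : Smooth f) {w : Vec}
    (hw : ∀ p, f (translate w 1 p) = f p) {p : Heis} (h : ∀ k, fourierAverage w k f p = 0) :
    f p = 0 := by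
  have hper : Function.Periodic (fun s : ℝ => f (translate w s p)) 1 := by
    intro s
    have h1 : translate w (s + 1) p = translate w 1 (translate w s p) := by
      rw [translate_translate]
    simp only [h1, hw]
  have hc : Continuous hper.lift := by
    exact continuous_coinduced_dom.2 (continuous_translate hf w p)
  let g : C(UnitAddCircle, ℂ) := ⟨hper.lift, hc⟩
  have hcoef : fourierCoeff g = 0 := by
    funext k
    rw [fourierCoeff_eq_intervalIntegral _ _ 0]
    have h2 := h k
    rw [fourierAverage] at h2
    simp only [zero_add, div_one, one_smul, Pi.zero_apply]
    rw [← h2]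
    refine intervalIntegral.integral_congr fun s _ => ?_
    simp only [fourier_coe_apply, g, ContinuousMap.coe_mk, Function.Periodic.lift_coe, smul_eq_mul]
    congr 2
    push_cast
    ring
  have h3 := has_pointwise_sum_fourier_series_of_summable (f := g)
    (by rw [hcoef]; exact summable_zero)
    ((0 : ℝ) : UnitAddCircle)
  rw [hcoef] at h3
  simp only [Pi.zero_apply, zero_smul] at h3
  have h4 := h3.unique hasSum_zero
  have h5 : g ((0 : ℝ) : UnitAddCircle) = f (translate w 0 p) := by
    simp only [g, ContinuousMap.coe_mk, Function.Periodic.lift_coe]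
  rwa [h5, translate_zero] at h4

/-! ### The lowest Landau level -/

/-- The side `√(2π)` of the square torus. -/
def side : ℝ := √(2 * Real.pi)

theorem side_pos : 0 < side := Real.sqrt_pos.2 (by positivity)

theorem side_mul_side : side * side = 2 * Real.pi := Real.mul_self_sqrt (by positivity)

theorem side_mul_side_complex : (side : ℂ) * side = 2 * Real.pi := by
  exact_mod_cast congrArg ((↑) : ℝ → ℂ) side_mul_side

theorem mem_lattice_x : (⟨side, 0, 0⟩ : Heis) ∈ lattice :=
  ⟨⟨1, by simp [side]⟩, ⟨0, by simp⟩, ⟨0, by simp⟩⟩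

theorem mem_lattice_y : (⟨0, side, 0⟩ : Heis) ∈ lattice :=
  ⟨⟨0, by simp⟩, ⟨1, by simp [side]⟩, ⟨0, by simp⟩⟩

theorem mem_lattice_z : (⟨0, 0, 2 * Real.pi⟩ : Heis) ∈ lattice :=
  ⟨⟨0, by simp⟩, ⟨0, by simp⟩, ⟨1, by simp⟩⟩

theorem translate_y_eq_mul (b s : ℝ) (p : Heis) :
    translate (0, b, 0) s p = ⟨0, s * b, 0⟩ * p := by
  simp [translate, mul_def, add_comm]

theorem translate_z_eq_mul (c s : ℝ) (p : Heis) :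
    translate (0, 0, c) s p = ⟨0, 0, s * c⟩ * p := by
  simp [translate, mul_def, add_comm]

theorem fourierAverage_mem_verticalMode {f : Heis → ℂ} {m : ℤ} (hf : f ∈ verticalMode m)
    (w : Vec) (k : ℤ) : fourierAverage w k f ∈ verticalMode m := by
  intro t p
  rw [fourierAverage, fourierAverage, ← intervalIntegral.integral_const_mul]
  refine intervalIntegral.integral_congr fun s _ => ?_
  have h1 : translate w s (⟨0, 0, t⟩ * p) = ⟨0, 0, t⟩ * translate w s p := by
    simp [translate, mul_def, add_assoc]
  simp only [h1, hf t]
  ring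

theorem fourierAverage_zero (w : Vec) (k : ℤ) : fourierAverage w k 0 = 0 := by
  funext p
  simp [fourierAverage]

theorem opX_of_character {f : Heis → ℂ} (hf : Smooth f) {j : ℤ}
    (h : ∀ (t : ℝ) p, f (translate (side, 0, 0) t p) =
      Complex.exp (2 * Real.pi * Complex.I * j * t) * f p) :
    opX f = (Complex.I * side * j) • f := by
  funext p
  have h1 := hasDerivAt_opX hf p 0
  have h0 : (⟨0, 0, 0⟩ : Heis) = 1 := rfl
  rw [h0, mul_one] at h1
  have hs := side_pos.ne'
  have h2 : (fun s : ℝ => f (p * ⟨s, 0, 0⟩)) =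
      fun s : ℝ => Complex.exp (Complex.I * side * j * s) * f p := by
    funext s
    have h3 := h (s / side) p
    have h4 : translate (side, 0, 0) (s / side) p = p * ⟨s, 0, 0⟩ := by
      simp [translate, mul_def, div_mul_cancel₀ _ hs]
    rw [h4] at h3
    rw [h3]
    congr 2
    push_cast
    have hs' : (side : ℂ) ≠ 0 := by exact_mod_cast hs
    field_simp
    linear_combination -((j : ℂ) * s) * side_mul_side_complex
  rw [h2] at h1
  have h3 : HasDerivAt (fun s : ℝ => Complex.I * side * j * (s : ℂ)) (Complex.I * side * j * 1) 0 :=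
    (Complex.ofRealCLM.hasDerivAt (x := 0)).const_mul (Complex.I * side * j)
  have h4 := h1.unique (h3.cexp.mul_const (f p))
  rw [h4]
  simp

theorem opy_of_character {f : Heis → ℂ} {j : ℤ}
    (h : ∀ (t : ℝ) p, f (translate (0, side, 0) t p) =
      Complex.exp (2 * Real.pi * Complex.I * j * t) * f p) :
    opy f = (Complex.I * side * j) • f := by
  funext p
  have hs := side_pos.ne'
  have h2 : (fun s : ℝ => f ⟨p.x, s, p.z⟩) =
      fun s : ℝ => Complex.exp (Complex.I * side * j * (s - p.y : ℝ)) * f p := by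
    funext s
    have h3 := h ((s - p.y) / side) p
    have h4 : translate (0, side, 0) ((s - p.y) / side) p = ⟨p.x, s, p.z⟩ := by
      simp [translate, div_mul_cancel₀ _ hs]
    rw [h4] at h3
    rw [h3]
    congr 2
    push_cast
    have hs' : (side : ℂ) ≠ 0 := by exact_mod_cast hs
    field_simp
    linear_combination -((j : ℂ) * (s - p.y)) * side_mul_side_complex
  have h3 : HasDerivAt (fun s : ℝ => Complex.I * side * j * ((s - p.y : ℝ) : ℂ))
      (Complex.I * side * j * (1 : ℝ)) p.y :=
    (((hasDerivAt_id p.y).sub_const p.y).ofReal_comp).const_mul _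
  rw [opy, h2, (h3.cexp.mul_const (f p)).deriv]
  simp

section LowestLevel

variable {m : ℕ} {f : Heis → ℂ}

theorem periodic_translate_y (hf : ∀ γ ∈ lattice, ∀ p, f (γ * p) = f p) (p : Heis) :
    f (translate (0, side, 0) 1 p) = f p := by
  rw [translate_y_eq_mul, one_mul, hf _ mem_lattice_y]

theorem ladder_fourierAverage_y (hf : Smooth f) (n : ℤ) (ε : ℝ) :
    ladder ε (fourierAverage (0, side, 0) n f) = fourierAverage (0, side, 0) n (ladder ε f) := by
  rw [ladder, ladder, opX_fourierAverage hf, opY_fourierAverage hf n (Or.inl rfl),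
    fourierAverage_add _ _ hf.opX (hf.opY.smul _), fourierAverage_smul]

/-- On the `n`-th Fourier mode in `y`, the equation `(X + iY) f = 0` is a first-order linear
differential equation in `x`. -/
theorem opX_fourierAverage_lowest (hf : f ∈ modeSpace m m) (hm : 0 < m) (n : ℤ) (p : Heis) :
    opX (fourierAverage (0, side, 0) n f) p =
      ((side * n - m * p.x : ℝ) : ℂ) * fourierAverage (0, side, 0) n f p := by
  have hm' : (0 : ℤ) < m := by exact_mod_cast hm
  obtain ⟨hs, hinv, hv, h0⟩ := (mem_modeSpace_lowest_iff hm').1 (by simpa using hf)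
  have h1 := congrFun (ladder_fourierAverage_y hs n (-1)) p
  rw [h0, fourierAverage_zero] at h1
  simp only [ladder, Pi.add_apply, Pi.smul_apply, Pi.zero_apply, opY_eq_sub,
    opZ_of_mem_verticalMode (fourierAverage_mem_verticalMode hv (0, side, 0) n),
    opy_of_character (fourierAverage_translate (periodic_translate_y hinv) n), smul_eq_mul] at h1
  push_cast at h1 ⊢
  linear_combination h1 - (fourierAverage (0, side, 0) n f p) *
    (side * n - m * p.x) * Complex.I_sq

/-- The differential equation in `x` has the solutions `c e^{√(2π) n x - m x²/2}`. -/
theorem fourierAverage_lowest_eq (hf : f ∈ modeSpace m m) (hm : 0 < m) (n : ℤ) (x : ℝ) :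
    fourierAverage (0, side, 0) n f ⟨x, 0, 0⟩ =
      Complex.exp ((side * n * x - m * x ^ 2 / 2 : ℝ) : ℂ) *
        fourierAverage (0, side, 0) n f ⟨0, 0, 0⟩ := by
  have hs := (hf.1.1).fourierAverage (0, side, 0) n
  set g := fourierAverage (0, side, 0) n f with hg
  have hd : ∀ t : ℝ, HasDerivAt (fun s : ℝ => Complex.exp (-(side * n * s - m * s ^ 2 / 2 : ℝ)) *
      g ⟨s, 0, 0⟩) 0 t := by
    intro t
    have h1 := opX_eq hs ⟨t, 0, 0⟩
    rw [← opX_eq_fderiv hs ⟨t, 0, 0⟩, opX_fourierAverage_lowest hf hm, ← hg] at h1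
    have h2 : HasDerivAt (fun s : ℝ => (side * n * s - m * s ^ 2 / 2 : ℝ)) (side * n - m * t) t := by
      have h3 := ((hasDerivAt_id t).const_mul (side * n)).sub
        (((hasDerivAt_pow 2 t).const_mul (m : ℝ)).div_const 2)
      exact h3.congr_deriv (by norm_num; ring)
    have h4 := (h2.ofReal_comp.neg.cexp).mul h1
    refine h4.congr_deriv ?_
    push_cast
    ring
  have h5 := is_const_of_deriv_eq_zero (fun t => (hd t).differentiableAt)
    (fun t => (hd t).deriv) x 0
  simp only [mul_zero, ne_eq, OfNat.ofNat_ne_zero, not_false_eq_true, zero_pow, zero_div, sub_zero,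
    neg_zero, Complex.ofReal_zero, Complex.exp_zero, one_mul] at h5
  rw [← h5, ← mul_assoc, ← Complex.exp_add, add_neg_cancel, Complex.exp_zero, one_mul]

theorem fourierAverage_lowest_eq_zero (hf : f ∈ modeSpace m m) (hm : 0 < m) {n : ℤ} {x : ℝ}
    (h : fourierAverage (0, side, 0) n f ⟨x, 0, 0⟩ = 0) : fourierAverage (0, side, 0) n f = 0 := by
  rw [fourierAverage_lowest_eq hf hm] at h
  have h0 := (mul_eq_zero.1 h).resolve_left (Complex.exp_ne_zero _)
  have h1 : ∀ x : ℝ, fourierAverage (0, side, 0) n f ⟨x, 0, 0⟩ = 0 := fun x => by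
    rw [fourierAverage_lowest_eq hf hm, h0, mul_zero]
  have hs := side_pos.ne'
  funext p
  have h2 := fourierAverage_translate (periodic_translate_y hf.1.2.1) n (p.y / side) ⟨p.x, 0, p.z⟩
  have h3 : translate (0, side, 0) (p.y / side) ⟨p.x, 0, p.z⟩ = p := by
    simp [translate, div_mul_cancel₀ _ hs]
  have hv := fourierAverage_mem_verticalMode hf.2 (0, side, 0) n
  rw [h3, apply_eq_of_mem_verticalMode hv p.x 0 p.z, h1] at h2
  simpa using h2

/-- Quasi-periodicity in `x` shifts the Fourier modes in `y` by `m`. -/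
theorem fourierAverage_lowest_shift (hf : f ∈ modeSpace m m) (n : ℤ) (x : ℝ) :
    fourierAverage (0, side, 0) (n + m) f ⟨x + side, 0, 0⟩ =
      fourierAverage (0, side, 0) n f ⟨x, 0, 0⟩ := by
  refine intervalIntegral.integral_congr fun s _ => ?_
  have h1 := hf.1.2.1 _ mem_lattice_x ⟨x, s * side, s * side * side⟩
  have h2 : (⟨side, 0, 0⟩ : Heis) * ⟨x, s * side, s * side * side⟩ =
      translate (0, side, 0) s ⟨x + side, 0, 0⟩ := by
    simp only [translate, mul_def]
    ext <;> simp only <;> ring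
  have h3 := apply_eq_of_mem_verticalMode hf.2 x (s * side) (s * side * side)
  have h4 : translate (0, side, 0) s ⟨x, 0, 0⟩ = ⟨x, s * side, 0⟩ := by simp [translate]
  rw [h2, h3] at h1
  simp only [h1, h4, ← mul_assoc, ← Complex.exp_add]
  congr 2
  push_cast
  linear_combination (Complex.I * m * s) * side_mul_side_complex

theorem fourierAverage_lowest_periodic (hf : f ∈ modeSpace m m) (hm : 0 < m) {r : ℤ}
    (h : fourierAverage (0, side, 0) r f = 0) (j : ℤ) :
    fourierAverage (0, side, 0) (r + j * m) f = 0 := by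
  induction j with
  | zero => simpa using h
  | succ j ih =>
    have h1 := fourierAverage_lowest_shift hf (r + j * m) 0
    rw [ih] at h1
    have h2 : r + ((j : ℤ) + 1) * m = r + j * m + m := by ring
    rw [h2]
    exact fourierAverage_lowest_eq_zero hf hm h1
  | pred j ih =>
    have h1 := fourierAverage_lowest_shift hf (r + (-(j : ℤ) - 1) * m) 0
    have h2 : r + (-(j : ℤ) - 1) * m + m = r + -(j : ℤ) * m := by ring
    rw [h2, ih] at h1
    exact fourierAverage_lowest_eq_zero hf hm h1.symm

end LowestLevel

/-- The values at the origin of the Fourier modes `0, …, m - 1` in `y`. -/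
def lowestCoefficients (m : ℕ) : modeSpace m m →ₗ[ℂ] (Fin m → ℂ) where
  toFun f r := fourierAverage (0, side, 0) r f ⟨0, 0, 0⟩
  map_add' f g := by
    funext r
    simp [fourierAverage_add _ _ f.2.1.1 g.2.1.1]
  map_smul' c f := by
    funext r
    simp [fourierAverage_smul]

/-- The Fourier modes `0, …, m - 1` in `y` determine the others by quasi-periodicity, and each of them
is determined by its value at the origin: a lowest Landau level has dimension at most `m`. -/
theorem lowestCoefficients_injective {m : ℕ} (hm : 0 < m) :
    Function.Injective (lowestCoefficients m) := by
  rw [injective_iff_map_eq_zero]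
  rintro ⟨f, hf⟩ h0
  have hm' : (0 : ℤ) < m := by exact_mod_cast hm
  refine Subtype.ext (funext fun p => ?_)
  refine eq_zero_of_fourierAverage_eq_zero (w := (0, side, 0)) hf.1.1
    (periodic_translate_y hf.1.2.1) fun k => ?_
  have hr : ((k % m).toNat : ℤ) = k % m := Int.toNat_of_nonneg (Int.emod_nonneg _ hm'.ne')
  have hlt : (k % m).toNat < m := by
    have := Int.emod_lt_of_pos k hm'
    omega
  have h1 := congrFun h0 ⟨_, hlt⟩
  have h2 : fourierAverage (0, side, 0) ((k % m).toNat : ℤ) f ⟨0, 0, 0⟩ = 0 := h1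
  rw [hr] at h2
  have h3 := fourierAverage_lowest_periodic hf hm (fourierAverage_lowest_eq_zero hf hm h2) (k / m)
  rw [mul_comm, Int.emod_add_mul_ediv] at h3
  rw [h3]; rfl

/-! ### Theta functions -/

/-- Invariance under the lattice has to be checked on its two horizontal generators only, as
`2πℤ` acts trivially on a vertical mode. -/
theorem invariant_of_generators {f : Heis → ℂ} {m : ℤ} (hv : f ∈ verticalMode m)
    (hx : ∀ p, f (⟨side, 0, 0⟩ * p) = f p) (hy : ∀ p, f (⟨0, side, 0⟩ * p) = f p) :
    ∀ γ ∈ lattice, ∀ p, f (γ * p) = f p := by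
  let S : Subgroup Heis :=
    { carrier := {γ | ∀ p, f (γ * p) = f p}
      one_mem' := fun p => by rw [one_mul]
      mul_mem' := fun {γ δ} hγ hδ p => by rw [mul_assoc, hγ, hδ]
      inv_mem' := fun {γ} hγ p => by
        have := hγ (γ⁻¹ * p)
        rwa [mul_inv_cancel_left, eq_comm] at this }
  have hX : ∀ n : ℤ, (⟨side, 0, 0⟩ : Heis) ^ n = ⟨side * n, 0, 0⟩ := by
    intro n
    induction n with
    | zero => simp [one_def]
    | succ n ih => rw [zpow_add_one, ih]; simp [mul_def]; ring
    | pred n ih => rw [zpow_sub_one, ih]; simp [mul_def, inv_def]; ring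
  have hY : ∀ n : ℤ, (⟨0, side, 0⟩ : Heis) ^ n = ⟨0, side * n, 0⟩ := by
    intro n
    induction n with
    | zero => simp [one_def]
    | succ n ih => rw [zpow_add_one, ih]; simp [mul_def]; ring
    | pred n ih => rw [zpow_sub_one, ih]; simp [mul_def, inv_def]; ring
  rintro γ ⟨⟨a, ha⟩, ⟨b, hb⟩, ⟨c, hc⟩⟩
  change γ ∈ S
  have hZ : (⟨0, 0, 2 * Real.pi * (c + a * b : ℤ)⟩ : Heis) ∈ S := by
    intro p
    rw [hv]
    have h1 : Complex.I * m * ((2 * Real.pi * (c + a * b : ℤ) : ℝ) : ℂ) =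
        ((m * (c + a * b) : ℤ) : ℂ) * (2 * Real.pi * Complex.I) := by push_cast; ring
    rw [h1, Complex.exp_int_mul_two_pi_mul_I, one_mul]
  have hγ : γ = ⟨0, 0, 2 * Real.pi * (c + a * b : ℤ)⟩ *
      ((⟨side, 0, 0⟩ : Heis) ^ a * (⟨0, side, 0⟩ : Heis) ^ b) := by
    rw [hX, hY]
    simp only [mul_def]
    ext
    · simp [ha, side]
    · simp [hb, side]
    · simp only [hc]
      push_cast
      linear_combination ((a : ℝ) * b) * side_mul_side
  rw [hγ]
  exact S.mul_mem hZ (S.mul_mem (S.zpow_mem hx a) (S.zpow_mem hy b))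

/-- The function `e^{imz - mx²/2} h(x + iy)`. -/
def holomorphicMode (m : ℕ) (h : ℂ → ℂ) (p : Heis) : ℂ :=
  Complex.exp (Complex.I * m * p.z - m * p.x ^ 2 / 2) * h (p.x + Complex.I * p.y)

theorem smooth_holomorphicMode (m : ℕ) {h : ℂ → ℂ} (hh : Differentiable ℂ h) :
    Smooth (holomorphicMode m h) := by
  have hx : ContDiff ℝ ∞ fun v : Vec => (v.1 : ℂ) := Complex.ofRealCLM.contDiff.comp contDiff_fst
  have hy : ContDiff ℝ ∞ fun v : Vec => (v.2.1 : ℂ) :=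
    Complex.ofRealCLM.contDiff.comp (contDiff_fst.comp contDiff_snd)
  have hz : ContDiff ℝ ∞ fun v : Vec => (v.2.2 : ℂ) :=
    Complex.ofRealCLM.contDiff.comp (contDiff_snd.comp contDiff_snd)
  have h1 : ContDiff ℝ ∞ h := (hh.contDiff (n := ∞)).restrict_scalars ℝ
  exact (((contDiff_const.mul hz).sub ((contDiff_const.mul (hx.pow 2)).div_const 2)).cexp).mul
    (h1.comp (hx.add (contDiff_const.mul hy)))

theorem holomorphicMode_mem_verticalMode (m : ℕ) (h : ℂ → ℂ) :
    holomorphicMode m h ∈ verticalMode m := by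
  intro s p
  simp only [holomorphicMode, mul_def, zero_add, zero_mul, sub_zero, ← mul_assoc,
    ← Complex.exp_add]
  congr 2
  push_cast
  ring

/-- On `e^{imz - mx²/2} h(x + iy)` the operator `X + iY` acts as the Cauchy-Riemann operator
on `h`. -/
theorem ladder_holomorphicMode (m : ℕ) {h : ℂ → ℂ} (hh : Differentiable ℂ h) :
    ladder (-1) (holomorphicMode m h) = 0 := by
  funext p
  have hE : ∀ {t : ℝ}, HasDerivAt (fun s : ℝ => (s : ℂ)) 1 t := Complex.ofRealCLM.hasDerivAt
  have h1 : opX (holomorphicMode m h) p = Complex.exp (Complex.I * m * p.z - m * p.x ^ 2 / 2) *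
      (-(m * p.x)) * h (p.x + Complex.I * p.y) +
      Complex.exp (Complex.I * m * p.z - m * p.x ^ 2 / 2) * deriv h (p.x + Complex.I * p.y) := by
    have h2 : HasDerivAt (fun s : ℝ => Complex.I * m * p.z - m * (s : ℂ) ^ 2 / 2)
        (-((m : ℂ) * p.x)) p.x := by
      have h3 := ((((hE (t := p.x)).pow 2).const_mul (m : ℂ)).div_const 2).const_sub
        (Complex.I * m * p.z)
      exact h3.congr_deriv (by norm_num; ring)
    have h4 := (hh (p.x + Complex.I * p.y)).hasDerivAt.comp_of_eq p.x
      ((hE (t := p.x)).add_const (Complex.I * p.y)) rfl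
    rw [mul_one] at h4
    exact (h2.cexp.mul h4).deriv
  have h5 : opy (holomorphicMode m h) p = Complex.exp (Complex.I * m * p.z - m * p.x ^ 2 / 2) *
      (deriv h (p.x + Complex.I * p.y) * Complex.I) := by
    have h4 := (hh (p.x + Complex.I * p.y)).hasDerivAt.comp_of_eq p.y
      (((hE (t := p.y)).const_mul Complex.I).const_add (p.x : ℂ)) rfl
    rw [mul_one] at h4
    exact (h4.const_mul (Complex.exp (Complex.I * m * p.z - m * p.x ^ 2 / 2))).deriv
  simp only [ladder, Pi.add_apply, Pi.smul_apply, Pi.zero_apply, smul_eq_mul, opY_eq_sub, h1, h5,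
    opZ_of_mem_verticalMode (holomorphicMode_mem_verticalMode m h)]
  rw [holomorphicMode]
  push_cast
  linear_combination Complex.exp (Complex.I * m * p.z - m * p.x ^ 2 / 2) *
    (deriv h (p.x + Complex.I * p.y) - m * p.x * h (p.x + Complex.I * p.y)) * Complex.I_sq

/-- The holomorphic part of the `r`-th theta function of level `m`:
`∑_{n ≡ r mod m} e^{√(2π) n w - π (n² - r²)/m}`. -/
def thetaEntire (m r : ℕ) (w : ℂ) : ℂ :=
  Complex.exp (side * r * w) *
    jacobiTheta₂ ((side * m * w - 2 * Real.pi * r) / (2 * Real.pi * Complex.I)) (Complex.I * m)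

theorem im_I_mul_nat_pos {m : ℕ} (hm : 0 < m) : 0 < (Complex.I * m).im := by
  simpa using hm

theorem differentiable_thetaEntire {m : ℕ} (hm : 0 < m) (r : ℕ) :
    Differentiable ℂ (thetaEntire m r) := by
  intro w
  have h1 := differentiableAt_jacobiTheta₂_fst
    ((side * m * w - 2 * Real.pi * r) / (2 * Real.pi * Complex.I)) (im_I_mul_nat_pos hm)
  have h2 : DifferentiableAt ℂ (fun w : ℂ =>
      (side * m * w - 2 * Real.pi * r) / (2 * Real.pi * Complex.I)) w := by fun_prop
  have h3 : DifferentiableAt ℂ (fun w : ℂ => Complex.exp (side * r * w)) w := by fun_prop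
  exact h3.mul (DifferentiableAt.comp (g := fun z => jacobiTheta₂ z (Complex.I * m)) w h1 h2)

theorem thetaEntire_add_side {m : ℕ} (r : ℕ) (w : ℂ) :
    thetaEntire m r (w + side) = Complex.exp (m * side * w + m * Real.pi) * thetaEntire m r w := by
  set ζ := (side * m * (w + side) - 2 * Real.pi * r) / (2 * Real.pi * Complex.I) with hζ
  have hI := Complex.two_pi_I_ne_zero
  have h0 : ζ * (2 * Real.pi * Complex.I) = side * m * (w + side) - 2 * Real.pi * r :=
    div_mul_cancel₀ _ hI
  have h1 : (side * m * w - 2 * Real.pi * r) / (2 * Real.pi * Complex.I) = ζ + Complex.I * m := by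
    rw [div_eq_iff hI, add_mul, h0]
    linear_combination -(m : ℂ) * side_mul_side_complex - 2 * Real.pi * m * Complex.I_sq
  rw [thetaEntire, thetaEntire, h1, ← hζ, jacobiTheta₂_add_left', ← mul_assoc, ← mul_assoc,
    ← Complex.exp_add, ← Complex.exp_add]
  congr 2
  linear_combination h0 + (r + m) * side_mul_side_complex + m * Real.pi * Complex.I_sq

theorem thetaEntire_add_I {m : ℕ} (hm : 0 < m) (r : ℕ) (w : ℂ) :
    thetaEntire m r (w + Complex.I * (side / m)) =
      Complex.exp (2 * Real.pi * Complex.I / m) ^ r * thetaEntire m r w := by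
  have hI := Complex.two_pi_I_ne_zero
  have hm' : (m : ℂ) ≠ 0 := by exact_mod_cast hm.ne'
  have h1 : (side * m * (w + Complex.I * (side / m)) - 2 * Real.pi * r) / (2 * Real.pi * Complex.I) =
      (side * m * w - 2 * Real.pi * r) / (2 * Real.pi * Complex.I) + 1 := by
    field_simp
    linear_combination (Complex.I) * side_mul_side_complex
  rw [thetaEntire, thetaEntire, h1, jacobiTheta₂_add_left, ← Complex.exp_nat_mul, ← mul_assoc,
    ← Complex.exp_add]
  congr 2
  field_simp
  linear_combination (Complex.I * r) * side_mul_side_complex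

/-- The `r`-th theta function of level `m`, as a function on the Heisenberg group. -/
def theta (m r : ℕ) : Heis → ℂ := holomorphicMode m (thetaEntire m r)

theorem theta_translate {m : ℕ} (hm : 0 < m) (r : ℕ) (p : Heis) :
    theta m r (translate (0, side / m, 0) 1 p) =
      Complex.exp (2 * Real.pi * Complex.I / m) ^ r * theta m r p := by
  have h1 : ((p.x : ℂ) + Complex.I * ((p.y + side / m : ℝ) : ℂ)) =
      p.x + Complex.I * p.y + Complex.I * (side / m) := by push_cast; ring
  simp only [theta, holomorphicMode, translate, one_mul, mul_zero, add_zero, h1,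
    thetaEntire_add_I hm]
  ring

theorem theta_mem {m : ℕ} (hm : 0 < m) (r : ℕ) : theta m r ∈ modeSpace m m := by
  have hm' : (0 : ℤ) < m := by exact_mod_cast hm
  have hv : theta m r ∈ verticalMode m := holomorphicMode_mem_verticalMode m _
  have h := (mem_modeSpace_lowest_iff hm' (f := theta m r)).2
    ⟨smooth_holomorphicMode m (differentiable_thetaEntire hm r), ?_, hv,
      ladder_holomorphicMode m (differentiable_thetaEntire hm r)⟩
  · simpa using h
  refine invariant_of_generators hv (fun p => ?_) fun p => ?_
  · have h1 : (((side + p.x : ℝ) : ℂ) + Complex.I * ((0 + p.y : ℝ) : ℂ)) =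
        p.x + Complex.I * p.y + side := by push_cast; ring
    simp only [theta, holomorphicMode, mul_def, h1, thetaEntire_add_side, ← mul_assoc,
      ← Complex.exp_add]
    congr 2
    push_cast
    linear_combination (-(m : ℂ) / 2) * side_mul_side_complex
  · have h2 : ∀ j : ℕ, theta m r (translate (0, side / m, 0) j p) =
        (Complex.exp (2 * Real.pi * Complex.I / m) ^ r) ^ j * theta m r p := by
      intro j
      induction j with
      | zero => simp [translate_zero]
      | succ j ih =>
        rw [Nat.cast_succ, ← translate_translate, theta_translate hm, ih, pow_succ]
        ring
    have h3 := h2 m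
    have h4 : translate (0, side / m, 0) m p = ⟨0, side, 0⟩ * p := by
      have hm'' : (m : ℝ) ≠ 0 := by exact_mod_cast hm.ne'
      rw [translate_y_eq_mul, mul_div_cancel₀ _ hm'']
    rw [h4, ← pow_mul, mul_comm r m, pow_mul, (Complex.isPrimitiveRoot_exp m hm.ne').pow_eq_one,
      one_pow, one_mul] at h3
    exact h3

/-- The constant term dominates the theta series at `im`. -/
theorem jacobiTheta_I_mul_ne_zero {m : ℕ} (hm : 0 < m) : jacobiTheta₂ 0 (Complex.I * m) ≠ 0 := by
  rw [← jacobiTheta_eq_jacobiTheta₂]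
  intro h
  have h1 := norm_jacobiTheta_sub_one_le (im_I_mul_nat_pos hm)
  have h2 : (Complex.I * m).im = m := by simp
  rw [h, h2, zero_sub, norm_neg, norm_one] at h1
  have hm' : (1 : ℝ) ≤ m := by exact_mod_cast hm
  have h3 : Real.exp (-Real.pi * m) ≤ 1 / 4 := by
    have h4 : (4 : ℝ) ≤ Real.exp (Real.pi * m) := by
      have h5 := Real.add_one_le_exp (Real.pi * m)
      nlinarith [Real.pi_gt_three]
    rw [neg_mul, Real.exp_neg, one_div]
    exact inv_anti₀ (by norm_num) h4
  have h6 : 0 < Real.exp (-Real.pi * m) := Real.exp_pos _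
  rw [div_mul_eq_mul_div, le_div_iff₀ (by linarith)] at h1
  linarith

/-- The theta function is nonzero at the point where the argument of Jacobi's function vanishes. -/
theorem theta_ne_zero {m : ℕ} (hm : 0 < m) (r : ℕ) : theta m r ≠ 0 := by
  intro h
  have hm' : (m : ℂ) ≠ 0 := by exact_mod_cast hm.ne'
  have h1 := congrFun h ⟨side * r / m, 0, 0⟩
  have h2 : (side * m * (((side * r / m : ℝ) : ℂ) + Complex.I * ((0 : ℝ) : ℂ)) - 2 * Real.pi * r) /
      (2 * Real.pi * Complex.I) = 0 := by
    rw [div_eq_zero_iff]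
    left
    push_cast
    field_simp
    linear_combination (r : ℂ) * side_mul_side_complex
  simp only [theta, holomorphicMode, thetaEntire, h2, Pi.zero_apply, mul_eq_zero,
    Complex.exp_ne_zero, jacobiTheta_I_mul_ne_zero hm, or_self] at h1

/-- Translation by a vector, as a linear map on functions. -/
def translateLinear (w : Vec) : (Heis → ℂ) →ₗ[ℂ] (Heis → ℂ) where
  toFun f p := f (translate w 1 p)
  map_add' _ _ := rfl
  map_smul' _ _ := rfl

/-- The theta functions of level `m` are eigenvectors of the translation by `√(2π)/m` in `y`, with
distinct eigenvalues. -/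
theorem linearIndependent_theta {m : ℕ} (hm : 0 < m) :
    LinearIndependent ℂ fun r : Fin m => theta m r := by
  refine Module.End.eigenvectors_linearIndependent' (translateLinear (0, side / m, 0))
    (fun r : Fin m => Complex.exp (2 * Real.pi * Complex.I / m) ^ (r : ℕ)) ?_ _ fun r => ?_
  · intro r s hrs
    exact Fin.ext ((Complex.isPrimitiveRoot_exp m hm.ne').pow_inj r.2 s.2 hrs)
  · exact ⟨Module.End.mem_eigenspace_iff.2 (funext fun p => theta_translate hm r p),
      theta_ne_zero hm r⟩

theorem finiteDimensional_modeSpace_lowest {m : ℕ} (hm : 0 < m) :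
    FiniteDimensional ℂ (modeSpace m m) :=
  Module.Finite.of_injective _ (lowestCoefficients_injective hm)

theorem finrank_modeSpace_lowest {m : ℕ} (hm : 0 < m) :
    Module.finrank ℂ (modeSpace m m) = m := by
  have := finiteDimensional_modeSpace_lowest hm
  apply le_antisymm
  · simpa using LinearMap.finrank_le_finrank_of_injective (lowestCoefficients_injective hm)
  · have h1 : LinearIndependent ℂ fun r : Fin m => (⟨theta m r, theta_mem hm r⟩ : modeSpace m m) :=
      LinearIndependent.of_comp (modeSpace m m).subtype (linearIndependent_theta hm)
    simpa using h1.fintype_card_le_finrank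

/-! ### The torus part of the spectrum -/

theorem torusEigenspace_eq (μ : ℝ) : torusEigenspace μ = modeSpace 0 μ := by
  have h : torusFunctions = verticalMode 0 := by
    ext f
    constructor
    · intro hf s p
      have h1 : (⟨0, 0, s⟩ : Heis) * p = ⟨p.x, p.y, p.z + s⟩ := vertical_mul p.x p.y p.z s
      have h2 := hf p.x p.y p.z
      rw [h1, hf p.x p.y, ← h2]
      simp
    · intro hf x y z
      rw [apply_eq_of_mem_verticalMode hf]
      simp
  rw [torusEigenspace, h, modeSpace]

/-- The frequencies of the exponentials with eigenvalue `μ` on the torus `ℝ² / √(2π) ℤ²`. -/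
def frequencies (μ : ℝ) : Set (ℤ × ℤ) := {q | 2 * Real.pi * ((q.1 : ℝ) ^ 2 + (q.2 : ℝ) ^ 2) = μ}

theorem abs_le_of_sq_le {j : ℤ} {N : ℕ} (h : (j : ℝ) ^ 2 ≤ N) : j ∈ Set.Icc (-(N : ℤ)) N := by
  have h1 : j ^ 2 ≤ (N : ℤ) := by exact_mod_cast h
  constructor <;> nlinarith

theorem finite_frequencies (μ : ℝ) : (frequencies μ).Finite := by
  obtain ⟨N, hN⟩ := exists_nat_gt μ
  refine ((Set.finite_Icc (-(N : ℤ)) N).prod (Set.finite_Icc (-(N : ℤ)) N)).subset ?_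
  intro q (hq : _ = _)
  have hπ := Real.pi_gt_three
  have h1 := sq_nonneg (q.1 : ℝ)
  have h2 := sq_nonneg (q.2 : ℝ)
  exact ⟨abs_le_of_sq_le (by nlinarith), abs_le_of_sq_le (by nlinarith)⟩

/-- The `(j, k)`-th Fourier mode on the torus. -/
def torusMode (j k : ℤ) (f : Heis → ℂ) : Heis → ℂ :=
  fourierAverage (side, 0, 0) j (fourierAverage (0, side, 0) k f)

section Torus

variable {μ : ℝ} {f : Heis → ℂ}

theorem Smooth.torusMode (hf : Smooth f) (j k : ℤ) : Smooth (torusMode j k f) :=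
  (hf.fourierAverage _ k).fourierAverage _ j

theorem torusMode_mem_verticalMode (hf : f ∈ verticalMode 0) (j k : ℤ) :
    torusMode j k f ∈ verticalMode 0 :=
  fourierAverage_mem_verticalMode (fourierAverage_mem_verticalMode hf _ _) _ _

theorem opZ_eq_zero_of_mem (hf : f ∈ verticalMode 0) : opZ f = 0 := by
  rw [opZ_of_mem_verticalMode hf]
  simp

theorem periodic_translate_x (hf : f ∈ modeSpace 0 μ) (p : Heis) :
    f (translate (side, 0, 0) 1 p) = f p := by
  have h1 := hf.1.2.1 _ mem_lattice_x p
  have h2 : (⟨side, 0, 0⟩ : Heis) * p = ⟨0, 0, -(side * p.y)⟩ * translate (side, 0, 0) 1 p := by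
    simp only [translate, mul_def]
    ext <;> simp only <;> ring
  rw [h2, hf.2] at h1
  simpa using h1

theorem translate_comm (v w : Vec) (s t : ℝ) (p : Heis) :
    translate v s (translate w t p) = translate w t (translate v s p) := by
  simp only [translate]
  ext <;> simp only <;> ring

theorem fourierAverage_comp_translate {c : ℂ} {v : Vec} {t : ℝ}
    (h : ∀ p, f (translate v t p) = c * f p) (w : Vec) (k : ℤ) (p : Heis) :
    fourierAverage w k f (translate v t p) = c * fourierAverage w k f p := by
  rw [fourierAverage, fourierAverage, ← intervalIntegral.integral_const_mul]
  refine intervalIntegral.integral_congr fun s _ => ?_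
  simp only [translate_comm w v, h]
  ring

theorem torusMode_translate_x (hf : f ∈ modeSpace 0 μ) (j k : ℤ) (t : ℝ) (p : Heis) :
    torusMode j k f (translate (side, 0, 0) t p) =
      Complex.exp (2 * Real.pi * Complex.I * j * t) * torusMode j k f p := by
  refine fourierAverage_translate (fun p => ?_) j t p
  rw [fourierAverage_comp_translate (c := 1) (fun p => by rw [periodic_translate_x hf, one_mul]),
    one_mul]

theorem torusMode_translate_y (hf : f ∈ modeSpace 0 μ) (j k : ℤ) (t : ℝ) (p : Heis) :
    torusMode j k f (translate (0, side, 0) t p) =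
      Complex.exp (2 * Real.pi * Complex.I * k * t) * torusMode j k f p :=
  fourierAverage_comp_translate (fun p =>
    fourierAverage_translate (periodic_translate_y hf.1.2.1) k t p) _ _ _

theorem opX_torusMode (hf : Smooth f) (j k : ℤ) :
    opX (torusMode j k f) = torusMode j k (opX f) := by
  rw [torusMode, opX_fourierAverage (hf.fourierAverage _ _), opX_fourierAverage hf, torusMode]

theorem opY_torusMode (hf : Smooth f) (hv : opZ f = 0) (hv' : f ∈ verticalMode 0) (j k : ℤ) :
    opY (torusMode j k f) = torusMode j k (opY f) := by
  rw [torusMode, opY_fourierAverage (hf.fourierAverage _ _) _ (Or.inr ?_),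
    opY_fourierAverage hf _ (Or.inr hv), torusMode]
  exact opZ_eq_zero_of_mem (fourierAverage_mem_verticalMode hv' _ _)

theorem opY_mem_verticalMode (hf : Smooth f) {m : ℤ} (hv : f ∈ verticalMode m) :
    opY f ∈ verticalMode m := by
  intro s p
  have h1 := congrFun (opY_comp_mul_left hf ⟨0, 0, s⟩) p
  have h2 : (fun p => f (⟨0, 0, s⟩ * p)) = Complex.exp (Complex.I * m * s) • f :=
    funext fun p => hv s p
  rw [h2, opY_smul] at h1
  exact h1.symm

theorem laplacian_torusMode (hf : f ∈ modeSpace 0 μ) (j k : ℤ) :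
    laplacian (torusMode j k f) = (μ : ℂ) • torusMode j k f := by
  have hs := hf.1.1
  have hv := opY_mem_verticalMode hs hf.2
  have h1 : laplacian (torusMode j k f) = (-1 : ℂ) • torusMode j k (opX (opX f) + opY (opY f)) := by
    have h2 : torusMode j k (opX (opX f) + opY (opY f)) =
        torusMode j k (opX (opX f)) + torusMode j k (opY (opY f)) := by
      rw [torusMode, fourierAverage_add _ _ hs.opX.opX hs.opY.opY,
        fourierAverage_add _ _ (hs.opX.opX.fourierAverage _ _) (hs.opY.opY.fourierAverage _ _)]
      rfl
    rw [h2, ← opX_torusMode hs.opX, ← opX_torusMode hs,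
      ← opY_torusMode hs.opY (opZ_eq_zero_of_mem hv) hv,
      ← opY_torusMode hs (opZ_eq_zero_of_mem hf.2) hf.2, neg_one_smul]
    rfl
  have h3 : opX (opX f) + opY (opY f) = (-(μ : ℂ)) • f := by
    funext p
    have h4 := hf.1.2.2 p
    simp only [laplacian] at h4
    simp only [Pi.add_apply, Pi.smul_apply, smul_eq_mul]
    linear_combination -h4
  rw [h1, h3, torusMode, fourierAverage_smul, fourierAverage_smul, smul_smul]
  simp [torusMode]

/-- A Fourier mode of an eigenfunction is an eigenfunction for the same eigenvalue, and an exponential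
of its frequency: so it vanishes unless the frequency matches the eigenvalue. -/
theorem torusMode_eq_zero_or (hf : f ∈ modeSpace 0 μ) (j k : ℤ) :
    torusMode j k f = 0 ∨ (j, k) ∈ frequencies μ := by
  have hs := hf.1.1.torusMode j k
  have hX := opX_of_character hs (torusMode_translate_x hf j k)
  have hY : opY (torusMode j k f) = (Complex.I * side * k) • torusMode j k f := by
    funext p
    rw [opY_eq_sub, opy_of_character (torusMode_translate_y hf j k),
      opZ_eq_zero_of_mem (torusMode_mem_verticalMode hf.2 j k)]
    simp
  have h1 : laplacian (torusMode j k f) =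
      ((2 * Real.pi * ((j : ℝ) ^ 2 + (k : ℝ) ^ 2) : ℝ) : ℂ) • torusMode j k f := by
    funext p
    rw [laplacian, hX, hY, opX_smul, opY_smul, hX, hY]
    simp only [Pi.smul_apply, smul_eq_mul]
    push_cast
    linear_combination ((j : ℂ) ^ 2 + k ^ 2) * torusMode j k f p *
      (side_mul_side_complex - side ^ 2 * Complex.I_sq)
  rw [laplacian_torusMode hf, ← sub_eq_zero, ← sub_smul, smul_eq_zero] at h1
  rcases h1 with h1 | h1
  · right
    rw [sub_eq_zero] at h1
    exact (Complex.ofReal_injective h1).symm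
  · exact Or.inl h1

theorem torusMode_eq_zero (hf : f ∈ modeSpace 0 μ) (j k : ℤ)
    (h : torusMode j k f ⟨0, 0, 0⟩ = 0) : torusMode j k f = 0 := by
  funext p
  have hs := side_pos.ne'
  have h1 := torusMode_translate_x hf j k (p.x / side) ⟨0, p.y, p.z⟩
  have h2 := torusMode_translate_y hf j k (p.y / side) ⟨0, 0, p.z⟩
  have h3 : translate (side, 0, 0) (p.x / side) ⟨0, p.y, p.z⟩ = p := by
    simp [translate, div_mul_cancel₀ _ hs]
  have h4 : translate (0, side, 0) (p.y / side) ⟨0, 0, p.z⟩ = ⟨0, p.y, p.z⟩ := by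
    simp [translate, div_mul_cancel₀ _ hs]
  rw [h4, apply_eq_of_mem_verticalMode (torusMode_mem_verticalMode hf.2 j k) 0 0 p.z, h] at h2
  rw [h3, h2] at h1
  simpa using h1

end Torus

/-- The Fourier coefficients of an eigenfunction of the torus at the frequencies of its
eigenvalue. -/
def torusCoefficients (μ : ℝ) : modeSpace 0 μ →ₗ[ℂ] (frequencies μ → ℂ) where
  toFun f q := torusMode q.1.1 q.1.2 f ⟨0, 0, 0⟩
  map_add' f g := by
    funext q
    simp [torusMode, fourierAverage_add _ _ f.2.1.1 g.2.1.1,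
      fourierAverage_add _ _ (f.2.1.1.fourierAverage _ _) (g.2.1.1.fourierAverage _ _)]
  map_smul' c f := by
    funext q
    simp [torusMode, fourierAverage_smul]

theorem torusCoefficients_injective (μ : ℝ) : Function.Injective (torusCoefficients μ) := by
  rw [injective_iff_map_eq_zero]
  rintro ⟨f, hf⟩ h0
  refine Subtype.ext (funext fun p => ?_)
  refine eq_zero_of_fourierAverage_eq_zero (w := (0, side, 0)) hf.1.1
    (periodic_translate_y hf.1.2.1) fun k => ?_
  refine eq_zero_of_fourierAverage_eq_zero (w := (side, 0, 0)) (hf.1.1.fourierAverage _ _)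
    (fun p => ?_) fun j => ?_
  · rw [fourierAverage_comp_translate (c := 1)
      (fun p => by rw [periodic_translate_x hf, one_mul]), one_mul]
  · rcases torusMode_eq_zero_or hf j k with h | h
    · exact congrFun h p
    · exact congrFun (torusMode_eq_zero hf j k (congrFun h0 ⟨_, h⟩)) p

theorem finiteDimensional_modeSpace_zero (μ : ℝ) : FiniteDimensional ℂ (modeSpace 0 μ) := by
  have := (finite_frequencies μ).to_subtype
  exact Module.Finite.of_injective _ (torusCoefficients_injective μ)

theorem finrank_modeSpace_zero_le (μ : ℝ) :
    Module.finrank ℂ (modeSpace 0 μ) ≤ Nat.card (frequencies μ) := by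
  have := (finite_frequencies μ).fintype
  simpa using LinearMap.finrank_le_finrank_of_injective (torusCoefficients_injective μ)

/-! ### Decomposition of eigenspaces into vertical modes -/

theorem finiteDimensional_modeSpace_of_pos {m : ℕ} (hm : 0 < m) (μ : ℝ) :
    FiniteDimensional ℂ (modeSpace m μ) := by
  have hm' : (0 : ℤ) < m := by exact_mod_cast hm
  by_cases h : ∃ k : ℕ, μ = (2 * k + 1) * m
  · obtain ⟨k, rfl⟩ := h
    obtain ⟨e⟩ := nonempty_modeSpace_equiv_lowest hm'.ne' k
    rw [Int.cast_natCast] at e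
    have := finiteDimensional_modeSpace_lowest hm
    exact e.symm.finiteDimensional
  · push Not at h
    rw [modeSpace_eq_bot hm' (by simpa using h)]
    infer_instance

open Classical in
theorem finrank_modeSpace_of_pos {m : ℕ} (hm : 0 < m) (μ : ℝ) :
    Module.finrank ℂ (modeSpace m μ) = if ∃ k : ℕ, μ = (2 * k + 1) * m then m else 0 := by
  have hm' : (0 : ℤ) < m := by exact_mod_cast hm
  split_ifs with h
  · obtain ⟨k, rfl⟩ := h
    obtain ⟨e⟩ := nonempty_modeSpace_equiv_lowest hm'.ne' k
    rw [Int.cast_natCast] at e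
    rw [e.finrank_eq, finrank_modeSpace_lowest hm]
  · push Not at h
    rw [modeSpace_eq_bot hm' (by simpa using h), finrank_bot]

theorem finrank_modeSpace_neg (m : ℤ) (μ : ℝ) :
    Module.finrank ℂ (modeSpace (-m) μ) = Module.finrank ℂ (modeSpace m μ) := by
  obtain ⟨e⟩ := nonempty_modeSpace_neg_equiv m μ
  exact e.finrank_eq.symm

theorem finiteDimensional_modeSpace (m : ℤ) (μ : ℝ) : FiniteDimensional ℂ (modeSpace m μ) := by
  obtain ⟨n, rfl | rfl⟩ := m.eq_nat_or_neg
  · rcases n.eq_zero_or_pos with rfl | hn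
    · exact finiteDimensional_modeSpace_zero μ
    · exact finiteDimensional_modeSpace_of_pos hn μ
  · rcases n.eq_zero_or_pos with rfl | hn
    · exact finiteDimensional_modeSpace_zero μ
    · obtain ⟨e⟩ := nonempty_modeSpace_neg_equiv n μ
      have := finiteDimensional_modeSpace_of_pos hn μ
      exact e.finiteDimensional

theorem modeSpace_eq_bot_of_lt {m : ℤ} {μ : ℝ} (hm : m ≠ 0) (h : μ < |(m : ℝ)|) :
    modeSpace m μ = ⊥ := by
  have key : ∀ m : ℤ, 0 < m → μ < m → modeSpace m μ = ⊥ := by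
    intro m hm h
    refine modeSpace_eq_bot hm fun k hk => ?_
    have hm' : (0 : ℝ) < m := by exact_mod_cast hm
    have hk' : (0 : ℝ) ≤ k := Nat.cast_nonneg k
    nlinarith
  rcases lt_or_gt_of_ne hm with h0 | h0
  · have h1 := key (-m) (by omega) (by
      push_cast
      rwa [abs_of_neg (by exact_mod_cast h0)] at h)
    obtain ⟨e⟩ := nonempty_modeSpace_neg_equiv m μ
    rw [← Submodule.subsingleton_iff_eq_bot] at h1 ⊢
    exact e.toEquiv.subsingleton
  · exact key m h0 (by rwa [abs_of_pos (by exact_mod_cast h0)] at h)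

/-- The `m`-th Fourier mode in the vertical direction. -/
def verticalAverage (m : ℤ) (f : Heis → ℂ) : Heis → ℂ := fourierAverage (0, 0, 2 * Real.pi) m f

theorem periodic_translate_z {f : Heis → ℂ} (hf : ∀ γ ∈ lattice, ∀ p, f (γ * p) = f p) (p : Heis) :
    f (translate (0, 0, 2 * Real.pi) 1 p) = f p := by
  rw [translate_z_eq_mul, one_mul, hf _ mem_lattice_z]

theorem verticalAverage_mem_modeSpace {f : Heis → ℂ} {μ : ℝ} (hf : f ∈ eigenspace μ) (m : ℤ) :
    verticalAverage m f ∈ modeSpace m μ := by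
  obtain ⟨hs, hinv, hev⟩ := hf
  have hπ : (2 * Real.pi : ℝ) ≠ 0 := by positivity
  refine ⟨⟨hs.fourierAverage _ _, fun γ hγ p => ?_, fun p => ?_⟩, fun s p => ?_⟩
  · refine intervalIntegral.integral_congr fun s _ => ?_
    have h1 : translate (0, 0, 2 * Real.pi) s (γ * p) = γ * translate (0, 0, 2 * Real.pi) s p := by
      simp only [translate, mul_def]
      ext <;> simp only <;> ring
    simp only [h1, hinv γ hγ]
  · have h1 : opX (opX f) + opY (opY f) = (-(μ : ℂ)) • f := by
      funext p
      have h4 := hev p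
      simp only [laplacian] at h4
      simp only [Pi.add_apply, Pi.smul_apply, smul_eq_mul]
      linear_combination -h4
    have h2 := fourierAverage_add (0, 0, 2 * Real.pi) m hs.opX.opX hs.opY.opY
    rw [h1, fourierAverage_smul, ← opX_fourierAverage hs.opX, ← opX_fourierAverage hs,
      ← opY_fourierAverage hs.opY _ (Or.inl rfl), ← opY_fourierAverage hs _ (Or.inl rfl)] at h2
    have h3 := congrFun h2 p
    simp only [Pi.add_apply, Pi.smul_apply, smul_eq_mul] at h3
    rw [laplacian, verticalAverage, ← h3]
    ring
  · have h1 := fourierAverage_translate (periodic_translate_z hinv) m (s / (2 * Real.pi)) p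
    rw [translate_z_eq_mul, div_mul_cancel₀ _ hπ] at h1
    rw [verticalAverage, h1]
    congr 2
    push_cast
    have hπ' : (Real.pi : ℂ) ≠ 0 := by exact_mod_cast Real.pi_ne_zero
    field_simp

theorem verticalAverage_of_mem {f : Heis → ℂ} {m : ℤ} (hf : f ∈ verticalMode m) (k : ℤ) :
    verticalAverage k f = if m = k then f else 0 := by
  refine fourierAverage_of_character (fun t p => ?_) k
  rw [translate_z_eq_mul, hf]
  congr 2
  push_cast
  ring

/-- The sum of a family of vertical modes. -/
def modeSum (S : Finset ℤ) (μ : ℝ) : ((m : S) → modeSpace m μ) →ₗ[ℂ] (Heis → ℂ) where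
  toFun h := ∑ m, (h m : Heis → ℂ)
  map_add' g h := by simp [Finset.sum_add_distrib]
  map_smul' c h := by simp [Finset.smul_sum]

theorem Smooth.sum {ι : Type*} (T : Finset ι) {g : ι → Heis → ℂ} (hg : ∀ i ∈ T, Smooth (g i)) :
    Smooth (∑ i ∈ T, g i) := by
  classical
  induction T using Finset.induction_on with
  | empty => exact contDiff_const
  | insert i T hi ih =>
    rw [Finset.sum_insert hi]
    exact (hg i (Finset.mem_insert_self i T)).add
      (ih fun j hj => hg j (Finset.mem_insert_of_mem hj))

theorem fourierAverage_sum {ι : Type*} (T : Finset ι) {g : ι → Heis → ℂ}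
    (hg : ∀ i ∈ T, Smooth (g i)) (w : Vec) (k : ℤ) :
    fourierAverage w k (∑ i ∈ T, g i) = ∑ i ∈ T, fourierAverage w k (g i) := by
  classical
  induction T using Finset.induction_on with
  | empty => simp [fourierAverage_zero]
  | insert i T hi ih =>
    have h1 : ∀ j ∈ T, Smooth (g j) := fun j hj => hg j (Finset.mem_insert_of_mem hj)
    rw [Finset.sum_insert hi, Finset.sum_insert hi,
      fourierAverage_add _ _ (hg i (Finset.mem_insert_self i T)) (Smooth.sum T h1), ih h1]

theorem verticalAverage_modeSum {S : Finset ℤ} {μ : ℝ} (h : (m : S) → modeSpace m μ) (k : ℤ) :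
    verticalAverage k (modeSum S μ h) = ∑ m : S, if (m : ℤ) = k then (h m : Heis → ℂ) else 0 := by
  change fourierAverage _ k (∑ m, (h m : Heis → ℂ)) = _
  rw [fourierAverage_sum _ fun m _ => (h m).2.1.1]
  exact Finset.sum_congr rfl fun m _ => verticalAverage_of_mem (h m).2.2 k

/-- Vertical averages recover the summands. -/
theorem modeSum_injective (S : Finset ℤ) (μ : ℝ) : Function.Injective (modeSum S μ) := by
  rw [injective_iff_map_eq_zero]
  intro h h0
  funext k
  have h1 := verticalAverage_modeSum h k
  rw [h0, verticalAverage, fourierAverage_zero] at h1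
  simp only [Subtype.coe_inj, Finset.sum_ite_eq', Finset.mem_univ, if_true] at h1
  exact Subtype.ext h1.symm

/-- A space of eigenfunctions with vertical frequencies in `S` is the direct sum of its modes. -/
theorem range_modeSum {S : Finset ℤ} {μ : ℝ} {W : Submodule ℂ (Heis → ℂ)}
    (hW : ∀ f ∈ W, f ∈ eigenspace μ ∧ ∀ k ∉ S, verticalAverage k f = 0)
    (hS : ∀ m ∈ S, modeSpace m μ ≤ W) : LinearMap.range (modeSum S μ) = W := by
  apply le_antisymm
  · rintro _ ⟨h, rfl⟩
    exact Submodule.sum_mem _ fun m _ => hS m m.2 (h m).2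
  · intro f hf
    obtain ⟨hf1, hf2⟩ := hW f hf
    let h : (m : S) → modeSpace m μ := fun m => ⟨_, verticalAverage_mem_modeSpace hf1 m⟩
    refine ⟨h, ?_⟩
    have hsm : modeSum S μ h ∈ eigenspace μ := Submodule.sum_mem _ fun m _ => (h m).2.1
    have hg : f - modeSum S μ h ∈ eigenspace μ := sub_mem hf1 hsm
    rw [eq_comm, ← sub_eq_zero]
    funext p
    refine eq_zero_of_fourierAverage_eq_zero (w := (0, 0, 2 * Real.pi)) hg.1
      (periodic_translate_z hg.2.1) fun k => ?_
    have h1 : verticalAverage k (f - modeSum S μ h) =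
        verticalAverage k f - verticalAverage k (modeSum S μ h) := by
      have h2 : f - modeSum S μ h = f + (-1 : ℂ) • modeSum S μ h := by
        rw [neg_one_smul, sub_eq_add_neg]
      rw [h2, verticalAverage, fourierAverage_add _ _ hf1.1 (hsm.1.smul _), fourierAverage_smul,
        neg_one_smul, ← sub_eq_add_neg]
      rfl
    have h3 : verticalAverage k (modeSum S μ h) = verticalAverage k f := by
      rw [verticalAverage_modeSum]
      by_cases hk : k ∈ S
      · rw [Finset.sum_eq_single (⟨k, hk⟩ : S)]
        · simp [h]
        · intro m _ hm
          rw [if_neg]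
          exact fun h => hm (Subtype.ext h)
        · simp
      · rw [hf2 k hk]
        refine Finset.sum_eq_zero fun m _ => if_neg ?_
        rintro rfl
        exact hk m.2
    have h4 := congrFun h1 p
    rw [h3, sub_self] at h4
    exact h4

theorem finrank_eq_sum_modeSpace {S : Finset ℤ} {μ : ℝ} {W : Submodule ℂ (Heis → ℂ)}
    (hW : ∀ f ∈ W, f ∈ eigenspace μ ∧ ∀ k ∉ S, verticalAverage k f = 0)
    (hS : ∀ m ∈ S, modeSpace m μ ≤ W) : FiniteDimensional ℂ W ∧
      Module.finrank ℂ W = ∑ m ∈ S, Module.finrank ℂ (modeSpace m μ) := by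
  have h1 := range_modeSum hW hS
  have h2 : ∀ m : S, FiniteDimensional ℂ (modeSpace m μ) := fun m => finiteDimensional_modeSpace m μ
  let e := LinearEquiv.ofInjective (modeSum S μ) (modeSum_injective S μ)
  rw [h1] at e
  refine ⟨e.finiteDimensional, ?_⟩
  rw [← e.finrank_eq, Module.finrank_pi_fintype]
  exact Finset.sum_coe_sort S fun m => Module.finrank ℂ (modeSpace m μ)

theorem verticalAverage_eq_zero_of_lt {f : Heis → ℂ} {μ : ℝ} (hf : f ∈ eigenspace μ) {N : ℕ}
    (hN : μ < N) {k : ℤ} (hk0 : k ≠ 0) (hk : k ∉ Finset.Icc (-(N : ℤ)) N) :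
    verticalAverage k f = 0 := by
  have h1 := verticalAverage_mem_modeSpace hf k
  rw [modeSpace_eq_bot_of_lt hk0] at h1
  · exact h1
  · rw [Finset.mem_Icc, ← abs_le, not_le] at hk
    exact hN.trans (by exact_mod_cast hk)

theorem finrank_eigenspace_eq {μ : ℝ} {N : ℕ} (hN : μ < N) : FiniteDimensional ℂ (eigenspace μ) ∧
    Module.finrank ℂ (eigenspace μ) =
      ∑ m ∈ Finset.Icc (-(N : ℤ)) N, Module.finrank ℂ (modeSpace m μ) := by
  refine finrank_eq_sum_modeSpace (fun f hf => ⟨hf, fun k hk => ?_⟩) fun m _ => inf_le_left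
  refine verticalAverage_eq_zero_of_lt hf hN ?_ hk
  rintro rfl
  exact hk (by simp)

theorem verticalAverage_zero_apply (f : Heis → ℂ) (p : Heis) :
    verticalAverage 0 f p =
      (2 * Real.pi : ℝ)⁻¹ • ∫ z in p.z..p.z + 2 * Real.pi, f ⟨p.x, p.y, z⟩ := by
  have h1 := intervalIntegral.integral_comp_mul_add (fun z => f ⟨p.x, p.y, z⟩) (a := 0) (b := 1)
    (c := 2 * Real.pi) (by positivity) p.z
  simp only [mul_zero, zero_add, mul_one] at h1
  rw [add_comm p.z, ← h1]
  refine intervalIntegral.integral_congr fun s _ => ?_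
  simp [translate, mul_comm, add_comm]

theorem integral_vertical_eq_zero_iff {f : Heis → ℂ} (hinv : ∀ γ ∈ lattice, ∀ p, f (γ * p) = f p) :
    (∀ x y : ℝ, ∫ z in (0 : ℝ)..2 * Real.pi, f ⟨x, y, z⟩ = 0) ↔ verticalAverage 0 f = 0 := by
  have hπ : (2 * Real.pi : ℝ)⁻¹ ≠ 0 := by positivity
  have h1 : ∀ x y z : ℝ, ∫ z in z..z + 2 * Real.pi, f ⟨x, y, z⟩ =
      ∫ z in (0 : ℝ)..2 * Real.pi, f ⟨x, y, z⟩ := by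
    intro x y z
    have hper : Function.Periodic (fun z => f ⟨x, y, z⟩) (2 * Real.pi) := by
      intro z
      have h2 := hinv _ mem_lattice_z ⟨x, y, z⟩
      rwa [vertical_mul] at h2
    have h3 := hper.intervalIntegral_add_eq z 0
    rwa [zero_add] at h3
  constructor
  · intro h
    funext p
    rw [verticalAverage_zero_apply, h1, h, smul_zero]
    rfl
  · intro h x y
    have h2 := congrFun h ⟨x, y, 0⟩
    rw [verticalAverage_zero_apply, h1] at h2
    exact (smul_eq_zero.1 h2).resolve_left hπ

/-- Vanishing means over the vertical circles amount to the absence of the vertical mode `0`. -/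
theorem finrank_nonTorusEigenspace_eq {μ : ℝ} {N : ℕ} (hN : μ < N) :
    FiniteDimensional ℂ (nonTorusEigenspace μ) ∧ Module.finrank ℂ (nonTorusEigenspace μ) =
      ∑ m ∈ (Finset.Icc (-(N : ℤ)) N).erase 0, Module.finrank ℂ (modeSpace m μ) := by
  refine finrank_eq_sum_modeSpace (fun f hf => ⟨hf.1, fun k hk => ?_⟩) fun m hm f hf => ?_
  · by_cases hk0 : k = 0
    · rw [hk0]
      exact (integral_vertical_eq_zero_iff hf.1.2.1).1 hf.2
    · exact verticalAverage_eq_zero_of_lt hf.1 hN hk0 fun h => hk (Finset.mem_erase.2 ⟨hk0, h⟩)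
  · refine ⟨hf.1, (integral_vertical_eq_zero_iff hf.1.2.1).2 ?_⟩
    rw [verticalAverage_of_mem hf.2, if_neg (Finset.ne_of_mem_erase hm)]

theorem finiteDimensional_eigenspace (μ : ℝ) : FiniteDimensional ℂ (eigenspace μ) := by
  obtain ⟨N, hN⟩ := exists_nat_gt μ
  exact (finrank_eigenspace_eq hN).1

theorem finrank_eigenspace_eq_add (μ : ℝ) : Module.finrank ℂ (eigenspace μ) =
    Module.finrank ℂ (torusEigenspace μ) + Module.finrank ℂ (nonTorusEigenspace μ) := by
  obtain ⟨N, hN⟩ := exists_nat_gt μ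
  rw [(finrank_eigenspace_eq hN).2, (finrank_nonTorusEigenspace_eq hN).2, torusEigenspace_eq]
  exact (Finset.add_sum_erase _ (fun m => Module.finrank ℂ (modeSpace m μ)) (by simp)).symm

/-! ### Multiplicities of the Landau levels -/

theorem sum_Icc_erase_zero (N : ℕ) {g : ℤ → ℕ} (hg : ∀ m, g (-m) = g m) :
    ∑ m ∈ (Finset.Icc (-(N : ℤ)) N).erase 0, g m = ∑ m ∈ Finset.Icc 1 N, 2 * g m := by
  induction N with
  | zero => simp
  | succ N ih =>
    have h1 : (Finset.Icc (-((N + 1 : ℕ) : ℤ)) (N + 1 : ℕ)).erase 0 =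
        insert (-((N + 1 : ℕ) : ℤ)) (insert ((N + 1 : ℕ) : ℤ)
          ((Finset.Icc (-(N : ℤ)) N).erase 0)) := by
      ext m
      simp only [Finset.mem_erase, Finset.mem_Icc, Finset.mem_insert]
      omega
    rw [h1, Finset.sum_insert, Finset.sum_insert, ih, Finset.sum_Icc_succ_top (by omega), hg]
    · ring
    · simp
    · simp
      omega

/-- The eigenvalue of the Landau level with index `n` of the vertical modes `±m`. -/
def landauLevel (q : ℕ+ × ℕ) : ℝ := (2 * q.2 + 1) * (q.1 : ℕ)

theorem landauLevel_fst_injOn {q q' : ℕ+ × ℕ} (h : landauLevel q = landauLevel q')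
    (h1 : q.1 = q'.1) : q = q' := by
  have hq : ((q'.1 : ℕ) : ℝ) ≠ 0 := by exact_mod_cast q'.1.ne_zero
  simp only [landauLevel, h1] at h
  have h2 := mul_right_cancel₀ hq h
  have h3 : (q.2 : ℝ) = q'.2 := by linarith
  exact Prod.ext h1 (by exact_mod_cast h3)

theorem fst_le_landauLevel (q : ℕ+ × ℕ) : ((q.1 : ℕ) : ℝ) ≤ landauLevel q := by
  have h1 : (0 : ℝ) ≤ q.2 := Nat.cast_nonneg _
  have h2 : (0 : ℝ) ≤ (q.1 : ℕ) := Nat.cast_nonneg _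
  rw [landauLevel]
  nlinarith

theorem finite_landauLevel_fiber (μ : ℝ) : Finite (landauLevel ⁻¹' {μ}) := by
  obtain ⟨N, hN⟩ := exists_nat_gt μ
  let i : landauLevel ⁻¹' {μ} → Fin (N + 1) := fun q => ⟨q.1.1, by
    have h1 := fst_le_landauLevel q.1
    rw [show landauLevel q.1 = μ from q.2] at h1
    have h2 : ((q.1.1 : ℕ) : ℝ) < N := h1.trans_lt hN
    have h3 : (q.1.1 : ℕ) < N := by exact_mod_cast h2
    omega⟩
  refine Finite.of_injective i fun q q' h => Subtype.ext ?_
  have h1 : landauLevel q.1 = landauLevel q'.1 := (q.2 : _ = _).trans (q'.2 : _ = _).symm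
  refine landauLevel_fst_injOn h1 (PNat.coe_injective ?_)
  simpa [i] using h

/-- The multiplicity of `μ` in the non-torus part of the spectrum: each Landau level of the modes
`m` and `-m` contributes `2m`. -/
theorem hasSum_finrank_nonTorusEigenspace (μ : ℝ) :
    HasSum (fun q : landauLevel ⁻¹' {μ} => 2 * ((q.1.1 : ℕ) : ℂ))
      (Module.finrank ℂ (nonTorusEigenspace μ) : ℂ) := by
  classical
  have := finite_landauLevel_fiber μ
  have := Fintype.ofFinite (landauLevel ⁻¹' {μ})
  obtain ⟨N, hN⟩ := exists_nat_gt μ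
  have h1 : Module.finrank ℂ (nonTorusEigenspace μ) =
      ∑ q : landauLevel ⁻¹' {μ}, 2 * (q.1.1 : ℕ) := by
    rw [(finrank_nonTorusEigenspace_eq hN).2, sum_Icc_erase_zero N fun m =>
      finrank_modeSpace_neg m μ]
    have h2 : ∀ m ∈ Finset.Icc 1 N, 2 * Module.finrank ℂ (modeSpace (m : ℤ) μ) =
        if ∃ k : ℕ, μ = (2 * k + 1) * m then 2 * m else 0 := by
      intro m hm
      rw [finrank_modeSpace_of_pos (Finset.mem_Icc.1 hm).1]
      split_ifs <;> simp
    rw [Finset.sum_congr rfl h2, ← Finset.sum_filter]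
    symm
    refine Finset.sum_nbij (fun q : landauLevel ⁻¹' {μ} => (q.1.1 : ℕ)) ?_ ?_ ?_ fun _ _ => rfl
    · intro q _
      have hq : landauLevel q.1 = μ := q.2
      refine Finset.mem_filter.2 ⟨Finset.mem_Icc.2 ⟨q.1.1.pos, ?_⟩, q.1.2, hq.symm⟩
      have h3 := fst_le_landauLevel q.1
      rw [hq] at h3
      have h4 : ((q.1.1 : ℕ) : ℝ) < N := h3.trans_lt hN
      exact le_of_lt (by exact_mod_cast h4)
    · intro q _ q' _ h
      have h3 : landauLevel q.1 = landauLevel q'.1 := (q.2 : _ = _).trans (q'.2 : _ = _).symm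
      exact Subtype.ext (landauLevel_fst_injOn h3 (PNat.coe_injective h))
    · intro m hm
      obtain ⟨h3, k, hk⟩ := Finset.mem_filter.1 (Finset.mem_coe.1 hm)
      refine ⟨⟨(⟨m, (Finset.mem_Icc.1 h3).1⟩, k), hk.symm⟩, by simp, rfl⟩
  rw [h1]
  push_cast
  exact hasSum_fintype _

/-! ### The heat trace -/

theorem cubic_exp_neg_le {u : ℝ} (hu : 0 < u) : Real.exp (-u) ≤ 6 / u ^ 3 := by
  have h := Real.pow_div_factorial_le_exp u hu.le 3
  have h6 : ((Nat.factorial 3 : ℕ) : ℝ) = 6 := by norm_num [Nat.factorial]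
  rw [h6] at h
  have h3 : 0 < u ^ 3 := by positivity
  rw [Real.exp_neg, le_div_iff₀ h3, ← div_eq_inv_mul, div_le_iff₀ (Real.exp_pos u)]
  linarith

theorem summable_pnat_one_div_sq : Summable fun m : ℕ+ => 1 / ((m : ℕ) : ℝ) ^ 2 :=
  (Real.summable_one_div_nat_pow.2 one_lt_two).comp_injective PNat.coe_injective

theorem summable_odd_one_div_sq : Summable fun n : ℕ => 1 / (2 * (n : ℝ) + 1) ^ 2 := by
  have h1 : Summable fun n : ℕ => 1 / ((2 * n + 1 : ℕ) : ℝ) ^ 2 :=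
    (Real.summable_one_div_nat_pow.2 one_lt_two).comp_injective (i := fun n : ℕ => 2 * n + 1)
      fun a b h => by simpa using h
  exact h1.congr fun n => by push_cast; rfl

theorem norm_landau_term (z : ℂ) (p : ℕ+ × ℕ) :
    ‖2 * (p.1 : ℂ) * Complex.exp (-((2 * p.2 + 1) * p.1 * z))‖ =
      2 * (p.1 : ℕ) * Real.exp (-((2 * p.2 + 1) * (p.1 : ℕ) * z.re)) := by
  have h1 : (-((2 * (p.2 : ℂ) + 1) * (p.1 : ℂ) * z)) =
      ((-((2 * p.2 + 1) * (p.1 : ℕ)) : ℝ) : ℂ) * z := by push_cast; ring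
  rw [norm_mul, norm_mul, Complex.norm_exp, h1, Complex.re_ofReal_mul]
  simp

theorem summable_landau {z : ℂ} (hz : 0 < z.re) :
    Summable fun p : ℕ+ × ℕ => 2 * (p.1 : ℂ) * Complex.exp (-((2 * p.2 + 1) * p.1 * z)) := by
  have h1 := (summable_pnat_one_div_sq.mul_of_nonneg summable_odd_one_div_sq
    (fun m => by positivity) (fun n => by positivity)).mul_left (12 / z.re ^ 3)
  refine h1.of_norm_bounded fun p => ?_
  rw [norm_landau_term]
  have hm : (0 : ℝ) < (p.1 : ℕ) := by exact_mod_cast p.1.pos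
  have hn : (1 : ℝ) ≤ 2 * p.2 + 1 := by
    have : (0 : ℝ) ≤ p.2 := Nat.cast_nonneg _
    linarith
  have hn0 : (0 : ℝ) < 2 * p.2 + 1 := by linarith
  have h2 := cubic_exp_neg_le (u := (2 * p.2 + 1) * (p.1 : ℕ) * z.re) (by positivity)
  calc _ ≤ 2 * (p.1 : ℕ) * (6 / ((2 * p.2 + 1) * (p.1 : ℕ) * z.re) ^ 3) := by gcongr
    _ = 12 / z.re ^ 3 * (1 / ((p.1 : ℕ) : ℝ) ^ 2 * (1 / (2 * (p.2 : ℝ) + 1) ^ 3)) := by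
      field_simp
      norm_num
    _ ≤ _ := by
      gcongr
      norm_num

theorem tsum_fiber_landau (z : ℂ) (μ : ℝ) :
    ∑' q : landauLevel ⁻¹' {μ}, 2 * (q.1.1 : ℂ) * Complex.exp (-((2 * q.1.2 + 1) * q.1.1 * z)) =
      traceTerm nonTorusEigenspace z μ := by
  have h1 := (hasSum_finrank_nonTorusEigenspace μ).mul_right (Complex.exp (-z * μ))
  refine Eq.trans (tsum_congr fun q => ?_) h1.tsum_eq
  have hq : landauLevel q.1 = μ := q.2
  have hμ : (μ : ℂ) = ((landauLevel q.1 : ℝ) : ℂ) := congrArg _ hq.symm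
  rw [hμ, landauLevel]
  push_cast
  ring_nf

theorem hasSum_traceTerm_nonTorus {z : ℂ} (hz : 0 < z.re) :
    HasSum (traceTerm nonTorusEigenspace z)
      (∑' p : ℕ+ × ℕ, 2 * (p.1 : ℂ) * Complex.exp (-((2 * p.2 + 1) * p.1 * z))) := by
  have h1 := (summable_landau hz).hasSum.tsum_fiberwise landauLevel
  exact h1.congr_fun (fun μ => (tsum_fiber_landau z μ).symm)

theorem Zo_eq_tsum_prod {z : ℂ} (hz : 0 < z.re) :
    Zo z = ∑' p : ℕ+ × ℕ, 2 * (p.1 : ℂ) * Complex.exp (-((2 * p.2 + 1) * p.1 * z)) :=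
  (hasSum_traceTerm_nonTorus hz).tsum_eq

theorem Zo_eq_tsum_tsum {z : ℂ} (hz : 0 < z.re) :
    Zo z = ∑' m : ℕ+, 2 * (m : ℂ) * ∑' n : ℕ, Complex.exp (-((2 * n + 1) * m * z)) := by
  rw [Zo_eq_tsum_prod hz, (summable_landau hz).tsum_prod]
  exact tsum_congr fun m => tsum_mul_left (a := 2 * (m : ℂ))

theorem hasSum_exp_odd {w : ℂ} (hw : 0 < w.re) :
    HasSum (fun n : ℕ => Complex.exp (-((2 * n + 1) * w))) (1 / (2 * Complex.sinh w)) := by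
  have hr : ‖Complex.exp (-(2 * w))‖ < 1 := by
    rw [Complex.norm_exp, Real.exp_lt_one_iff]
    simpa using hw
  have h1 := (hasSum_geometric_of_norm_lt_one hr).mul_left (Complex.exp (-w))
  have h2 : Complex.exp (-w) * (1 - Complex.exp (-(2 * w)))⁻¹ = 1 / (2 * Complex.sinh w) := by
    have h3 : 2 * Complex.sinh w = Complex.exp w * (1 - Complex.exp (-(2 * w))) := by
      rw [Complex.two_sinh, mul_sub, ← Complex.exp_add, mul_one]
      ring_nf
    rw [h3, one_div, mul_inv, Complex.exp_neg]
  rw [← h2]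
  refine h1.congr_fun fun n => ?_
  rw [← Complex.exp_nat_mul, ← Complex.exp_add]
  ring_nf

theorem hasSum_Zo {z : ℂ} (hz : 0 < z.re) :
    HasSum (fun m : ℕ+ => (m : ℂ) / Complex.sinh (m * z)) (Zo z) := by
  rw [Zo_eq_tsum_prod hz]
  refine (summable_landau hz).hasSum.prod_fiberwise fun m => ?_
  have hm : 0 < ((m : ℂ) * z).re := by
    have h1 : ((m : ℂ) * z).re = (m : ℕ) * z.re := by
      rw [← Complex.ofReal_natCast, Complex.re_ofReal_mul]
    rw [h1]
    exact mul_pos (by exact_mod_cast m.pos) hz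
  have h1 := (hasSum_exp_odd hm).mul_left (2 * (m : ℂ))
  have h2 : 2 * (m : ℂ) * (1 / (2 * Complex.sinh (m * z))) = m / Complex.sinh (m * z) := by
    rw [mul_one_div, mul_div_mul_left _ _ two_ne_zero]
  rw [h2] at h1
  exact h1.congr_fun fun n => by ring_nf

theorem summable_int_gaussian {x : ℝ} (hx : 0 < x) :
    Summable fun j : ℤ => Real.exp (-(2 * Real.pi * (j : ℝ) ^ 2 * x)) := by
  have h1 : 0 < (2 * x * Complex.I).im := by simpa using hx
  have h2 := ((summable_jacobiTheta₂_term_iff 0 (2 * x * Complex.I)).2 h1).norm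
  refine h2.congr fun j => ?_
  rw [norm_jacobiTheta₂_term]
  congr 1
  simp
  ring

/-- The multiplicities of the torus are bounded by the numbers of frequencies, and the series over all
frequencies is the square of a convergent Gaussian series. -/
theorem summable_traceTerm_torus {z : ℂ} (hz : 0 < z.re) :
    Summable (traceTerm torusEigenspace z) := by
  let g : ℤ × ℤ → ℝ := fun q => 2 * Real.pi * ((q.1 : ℝ) ^ 2 + (q.2 : ℝ) ^ 2)
  have h1 := (summable_int_gaussian hz).mul_of_nonneg (summable_int_gaussian hz)
    (fun j => (Real.exp_pos _).le) (fun j => (Real.exp_pos _).le)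
  have h2 := (h1.hasSum.tsum_fiberwise g).summable
  refine h2.of_norm_bounded fun μ => ?_
  have h3 : (∑' q : g ⁻¹' {μ}, Real.exp (-(2 * Real.pi * (q.1.1 : ℝ) ^ 2 * z.re)) *
      Real.exp (-(2 * Real.pi * (q.1.2 : ℝ) ^ 2 * z.re))) =
      Nat.card (frequencies μ) * Real.exp (-(z.re * μ)) := by
    have h4 : ∀ q : g ⁻¹' {μ}, Real.exp (-(2 * Real.pi * (q.1.1 : ℝ) ^ 2 * z.re)) *
        Real.exp (-(2 * Real.pi * (q.1.2 : ℝ) ^ 2 * z.re)) = Real.exp (-(z.re * μ)) := by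
      intro q
      have hq : 2 * Real.pi * ((q.1.1 : ℝ) ^ 2 + (q.1.2 : ℝ) ^ 2) = μ := q.2
      rw [← Real.exp_add]
      congr 1
      linear_combination -z.re * hq
    rw [tsum_congr h4, tsum_const, nsmul_eq_mul]
    rfl
  rw [h3, traceTerm, norm_mul, Complex.norm_exp, torusEigenspace_eq, Complex.norm_natCast]
  have h5 : (-z * μ).re = -(z.re * μ) := by
    rw [mul_comm, Complex.re_ofReal_mul, Complex.neg_re]
    ring
  rw [h5]
  have h6 : (Module.finrank ℂ (modeSpace 0 μ) : ℝ) ≤ Nat.card (frequencies μ) := by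
    exact_mod_cast finrank_modeSpace_zero_le μ
  gcongr

theorem traceTerm_eigenspace (z : ℂ) : traceTerm eigenspace z = fun μ =>
    traceTerm torusEigenspace z μ + traceTerm nonTorusEigenspace z μ := by
  funext μ
  simp only [traceTerm, finrank_eigenspace_eq_add]
  push_cast
  ring

theorem summable_traceTerm_and_trace_eq {z : ℂ} (hz : 0 < z.re) :
    Summable (traceTerm eigenspace z) ∧ Summable (traceTerm torusEigenspace z) ∧
      Summable (traceTerm nonTorusEigenspace z) ∧
      trace eigenspace z = trace torusEigenspace z + Zo z := by
  have h1 := summable_traceTerm_torus hz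
  have h2 := (hasSum_traceTerm_nonTorus hz).summable
  refine ⟨?_, h1, h2, ?_⟩
  · rw [traceTerm_eigenspace]
    exact h1.add h2
  · rw [trace, traceTerm_eigenspace]
    exact h1.tsum_add h2

/-! ### The Fourier transform of `x / sinh x` -/

theorem add_cube_le_sinh {x : ℝ} (hx : 0 ≤ x) : x + x ^ 3 / 6 ≤ Real.sinh x := by
  have h := sum_le_hasSum (Finset.range 2) (fun n _ => by positivity) (Real.hasSum_sinh x)
  norm_num [Finset.sum_range_succ, Nat.factorial] at h
  exact h

theorem one_add_sq_le_cosh (x : ℝ) : 1 + x ^ 2 / 2 ≤ Real.cosh x := by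
  have h := sum_le_hasSum (Finset.range 2)
    (fun n _ => by rw [pow_mul]; positivity) (Real.hasSum_cosh x)
  norm_num [Finset.sum_range_succ, Nat.factorial] at h
  exact h

theorem div_sinh_neg (x : ℝ) : (-x) / Real.sinh (-x) = x / Real.sinh x := by
  rw [Real.sinh_neg, neg_div_neg_eq]

theorem div_sinh_abs (x : ℝ) : |x| / Real.sinh |x| = x / Real.sinh x := by
  rcases abs_choice x with h | h <;> rw [h]
  exact div_sinh_neg x

theorem abs_div_sinh_le (x : ℝ) : |x / Real.sinh x| ≤ 6 * (1 + x ^ 2)⁻¹ := by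
  rw [← div_sinh_abs, ← sq_abs x]
  have hx := abs_nonneg x
  set y := |x|
  have h1 := add_cube_le_sinh hx
  have h2 : 0 ≤ Real.sinh y := Real.sinh_nonneg_iff.2 hx
  rw [abs_of_nonneg (by positivity), ← div_eq_mul_inv]
  rcases hx.eq_or_lt with h0 | h0
  · rw [← h0]
    simp
  · have h3 : 0 < Real.sinh y := Real.sinh_pos_iff.2 h0
    rw [div_le_div_iff₀ h3 (by positivity)]
    nlinarith [pow_pos h0 3]

theorem measurable_div_sinh : Measurable fun x : ℝ => x / Real.sinh x :=
  measurable_id.div Real.continuous_sinh.measurable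

theorem integrable_div_sinh : Integrable fun x : ℝ => x / Real.sinh x :=
  (integrable_inv_one_add_sq.const_mul 6).mono' measurable_div_sinh.aestronglyMeasurable
    (Eventually.of_forall abs_div_sinh_le)

theorem integrableOn_mul_exp {c : ℝ} (hc : 0 < c) :
    IntegrableOn (fun x : ℝ => x * Real.exp (-(c * x))) (Set.Ioi 0) := by
  have h := integrableOn_rpow_mul_exp_neg_mul_rpow (s := 1) (p := 1) (b := c) (by norm_num)
    one_pos hc
  simpa using h

theorem integral_mul_exp {c : ℂ} (hc : 0 < c.re) :
    ∫ x in Set.Ioi (0 : ℝ), (x : ℂ) * Complex.exp (-(c * x)) = 1 / c ^ 2 := by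
  have hc0 : c ≠ 0 := by
    rintro rfl
    simp at hc
  have hd : ∀ x : ℝ, HasDerivAt (fun x : ℝ => -((x : ℂ) / c + 1 / c ^ 2) * Complex.exp (-(c * x)))
      ((x : ℂ) * Complex.exp (-(c * x))) x := by
    intro x
    have hE : HasDerivAt (fun s : ℝ => (s : ℂ)) 1 x := Complex.ofRealCLM.hasDerivAt
    have h1 := ((hE.div_const c).add_const (1 / c ^ 2)).neg.mul (hE.const_mul c).neg.cexp
    refine h1.congr_deriv ?_
    simp only [Pi.neg_apply]
    field_simp
    ring
  have hn : ∀ x : ℝ, ‖Complex.exp (-(c * x))‖ = Real.exp (-(c.re * x)) := by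
    intro x
    rw [Complex.norm_exp]
    simp
  have ht : Tendsto (fun x : ℝ => -((x : ℂ) / c + 1 / c ^ 2) * Complex.exp (-(c * x))) atTop
      (𝓝 0) := by
    have h1 := tendsto_rpow_mul_exp_neg_mul_atTop_nhds_zero 1 c.re hc
    have h2 := tendsto_rpow_mul_exp_neg_mul_atTop_nhds_zero 0 c.re hc
    have h3 := (h1.const_mul ‖c‖⁻¹).add (h2.const_mul ‖1 / c ^ 2‖)
    simp only [mul_zero, add_zero] at h3
    refine squeeze_zero_norm' ?_ h3
    filter_upwards [eventually_ge_atTop 0] with x hx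
    rw [norm_mul, norm_neg, hn, Real.rpow_one, Real.rpow_zero, one_mul, neg_mul]
    calc _ ≤ (‖(x : ℂ) / c‖ + ‖1 / c ^ 2‖) * Real.exp (-(c.re * x)) := by
          gcongr
          exact norm_add_le _ _
      _ = _ := by
          rw [norm_div, Complex.norm_of_nonneg hx]
          ring
  have hi : IntegrableOn (fun x : ℝ => (x : ℂ) * Complex.exp (-(c * x))) (Set.Ioi 0) := by
    refine (integrableOn_mul_exp hc).mono' (by fun_prop) ?_
    filter_upwards [ae_restrict_mem measurableSet_Ioi] with x hx
    rw [norm_mul, hn, Complex.norm_of_nonneg (le_of_lt hx)]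
  have h := integral_Ioi_of_hasDerivAt_of_tendsto' (fun x _ => hd x) hi ht
  rw [h]
  simp

theorem integrableOn_mul_cexp {c : ℂ} (hc : 0 < c.re) :
    IntegrableOn (fun x : ℝ => (x : ℂ) * Complex.exp (-(c * x))) (Set.Ioi 0) := by
  refine (integrableOn_mul_exp hc).mono' (by fun_prop) ?_
  filter_upwards [ae_restrict_mem measurableSet_Ioi] with x hx
  rw [norm_mul, Complex.norm_exp, Complex.norm_of_nonneg (le_of_lt hx)]
  simp

theorem norm_mul_cexp {c : ℂ} {x : ℝ} (hx : 0 < x) :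
    ‖(x : ℂ) * Complex.exp (-(c * x))‖ = x * Real.exp (-(c.re * x)) := by
  rw [norm_mul, Complex.norm_exp, Complex.norm_of_nonneg hx.le]
  simp

theorem integral_mul_exp_real {c : ℝ} (hc : 0 < c) :
    ∫ x in Set.Ioi (0 : ℝ), x * Real.exp (-(c * x)) = 1 / c ^ 2 := by
  have h := integral_mul_exp (c := c) (by simpa using hc)
  have h2 : ∀ x : ℝ, (x : ℂ) * Complex.exp (-(c * x)) = ((x * Real.exp (-(c * x)) : ℝ) : ℂ) := by
    intro x
    push_cast
    rfl
  simp only [h2, integral_complex_ofReal] at h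
  exact_mod_cast h

/-- The half-line Fourier integral of `x / sinh x`, from the expansion
`x / sinh x = ∑ 2x e^{-(2n+1)x}`. -/
theorem hasSum_integral_Ioi_div_sinh (k : ℝ) :
    HasSum (fun n : ℕ => 2 / ((2 * n + 1 : ℂ) + Complex.I * k) ^ 2)
      (∫ x in Set.Ioi (0 : ℝ), ((x / Real.sinh x : ℝ) : ℂ) * Complex.exp (-(Complex.I * k * x))) := by
  have hre : ∀ n : ℕ, ((2 * n + 1 : ℂ) + Complex.I * k).re = 2 * n + 1 := by
    intro n
    simp
  have hpos : ∀ n : ℕ, (0 : ℝ) < 2 * n + 1 := fun n => by positivity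
  have h1 := hasSum_integral_of_summable_integral_norm (μ := volume.restrict (Set.Ioi (0 : ℝ)))
    (F := fun (n : ℕ) (x : ℝ) =>
      2 * ((x : ℂ) * Complex.exp (-(((2 * n + 1 : ℂ) + Complex.I * k) * x))))
    (fun n => (integrableOn_mul_cexp (by rw [hre]; exact hpos n)).const_mul 2) ?_
  · have h2 : ∀ n : ℕ, ∫ x in Set.Ioi (0 : ℝ),
        2 * ((x : ℂ) * Complex.exp (-(((2 * n + 1 : ℂ) + Complex.I * k) * x))) =
        2 / ((2 * n + 1 : ℂ) + Complex.I * k) ^ 2 := by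
      intro n
      rw [integral_const_mul, integral_mul_exp (by rw [hre]; exact hpos n), mul_one_div]
    simp only [h2] at h1
    have h3 : (∫ x in Set.Ioi (0 : ℝ), ∑' n : ℕ,
        2 * ((x : ℂ) * Complex.exp (-(((2 * n + 1 : ℂ) + Complex.I * k) * x)))) =
        ∫ x in Set.Ioi (0 : ℝ), ((x / Real.sinh x : ℝ) : ℂ) * Complex.exp (-(Complex.I * k * x)) := by
      refine setIntegral_congr_fun measurableSet_Ioi fun x hx => ?_
      have h4 := (hasSum_exp_odd (w := (x : ℂ)) (by simpa using hx)).mul_left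
        (2 * (x : ℂ) * Complex.exp (-(Complex.I * k * x)))
      refine Eq.trans (tsum_congr fun n => ?_) (h4.tsum_eq.trans ?_)
      · have h5 : -(((2 * n + 1 : ℂ) + Complex.I * k) * x) =
          -(Complex.I * k * x) + -((2 * n + 1) * x) := by ring
        rw [h5, Complex.exp_add]
        ring
      · push_cast
        have h6 : Complex.sinh x ≠ 0 := by
          rw [← Complex.ofReal_sinh]
          exact_mod_cast (Real.sinh_pos_iff.2 hx).ne'
        field_simp
    rw [h3] at h1
    exact h1
  · refine (summable_odd_one_div_sq.mul_left 2).congr fun n => ?_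
    rw [← integral_mul_exp_real (hpos n), ← integral_const_mul]
    refine setIntegral_congr_fun measurableSet_Ioi fun x hx => ?_
    simp only [norm_mul (2 : ℂ), norm_mul_cexp hx, hre]
    simp

/-- The function `x ↦ (x / sinh x) e^{-ikx}`. -/
def fourierIntegrand (k x : ℝ) : ℂ :=
  ((x / Real.sinh x : ℝ) : ℂ) * Complex.exp (-(Complex.I * k * x))

theorem norm_fourierIntegrand (k x : ℝ) : ‖fourierIntegrand k x‖ = |x / Real.sinh x| := by
  rw [fourierIntegrand, norm_mul, Complex.norm_exp, Complex.norm_real]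
  simp [abs_div]

theorem measurable_fourierIntegrand (k : ℝ) : Measurable (fourierIntegrand k) :=
  (Complex.measurable_ofReal.comp measurable_div_sinh).mul
    (Continuous.measurable (by fun_prop))

theorem integrable_fourierIntegrand (k : ℝ) : Integrable (fourierIntegrand k) :=
  integrable_div_sinh.norm.mono' (measurable_fourierIntegrand k).aestronglyMeasurable
    (Eventually.of_forall fun x => (norm_fourierIntegrand k x).le)

theorem hasSum_integral_fourierIntegrand (k : ℝ) :
    HasSum (fun n : ℕ => 2 / ((2 * n + 1 : ℂ) + Complex.I * k) ^ 2 +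
      2 / ((2 * n + 1 : ℂ) - Complex.I * k) ^ 2) (∫ x, fourierIntegrand k x) := by
  have h1 : ∫ x in Set.Iic (0 : ℝ), fourierIntegrand k x =
      ∫ x in Set.Ioi (0 : ℝ), fourierIntegrand (-k) x := by
    have h2 := integral_comp_neg_Iic 0 (fourierIntegrand (-k))
    rw [neg_zero] at h2
    rw [← h2]
    congr 1
    funext x
    simp only [fourierIntegrand, div_sinh_neg]
    push_cast
    ring_nf
  rw [← intervalIntegral.integral_Iic_add_Ioi (b := 0) (integrable_fourierIntegrand k).integrableOn
    (integrable_fourierIntegrand k).integrableOn, h1, add_comm]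
  refine (hasSum_integral_Ioi_div_sinh k).add ((hasSum_integral_Ioi_div_sinh (-k)).congr_fun
    fun n => ?_)
  push_cast
  ring_nf

theorem integral_fourierIntegrand_neg (k : ℝ) :
    ∫ x, fourierIntegrand (-k) x = ∫ x, fourierIntegrand k x := by
  refine (hasSum_integral_fourierIntegrand (-k)).unique
    ((hasSum_integral_fourierIntegrand k).congr_fun fun n => ?_)
  push_cast
  rw [add_comm]
  ring_nf

theorem continuous_integral_fourierIntegrand : Continuous fun k => ∫ x, fourierIntegrand k x := by
  refine continuous_of_dominated
    (fun k => (measurable_fourierIntegrand k).aestronglyMeasurable)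
    (fun k => Eventually.of_forall fun x => (norm_fourierIntegrand k x).le)
    integrable_div_sinh.norm (Eventually.of_forall fun x => ?_)
  simp only [fourierIntegrand]
  fun_prop

/-- For `k > 0` the partial fractions are summed by the Lipschitz formula
`∑ (τ + n)⁻² = -4π² ∑ n e^{2πinτ}` at `τ = (1 + ik)/2`. -/
theorem integral_fourierIntegrand_of_pos {k : ℝ} (hk : 0 < k) :
    ∫ x, fourierIntegrand k x = ((Real.pi ^ 2 / (1 + Real.cosh (Real.pi * k)) : ℝ) : ℂ) := by
  let τ : UpperHalfPlane := ⟨(1 + Complex.I * k) / 2, by simpa using hk⟩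
  have hτ : (τ : ℂ) = (1 + Complex.I * k) / 2 := rfl
  have h1 := EisensteinSeries.qExpansion_identity (le_refl 1) τ
  have hq : Complex.exp (2 * Real.pi * Complex.I * τ) = -Real.exp (-(Real.pi * k)) := by
    have h2 : 2 * Real.pi * Complex.I * (τ : ℂ) = Real.pi * Complex.I + -(Real.pi * k) := by
      rw [hτ]
      linear_combination (Real.pi * k : ℂ) * Complex.I_sq
    rw [h2, Complex.exp_add, Complex.exp_pi_mul_I]
    push_cast
    ring
  have hE : Real.exp (-(Real.pi * k)) < 1 := by
    rw [Real.exp_lt_one_iff]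
    have := mul_pos Real.pi_pos hk
    linarith
  have hnorm : ‖(-Real.exp (-(Real.pi * k)) : ℂ)‖ < 1 := by
    rw [norm_neg, Complex.norm_of_nonneg (Real.exp_pos _).le]
    exact hE
  rw [hq] at h1
  simp only [pow_one] at h1
  rw [(hasSum_coe_mul_geometric_of_norm_lt_one hnorm).tsum_eq] at h1
  have h3 : HasSum (fun j : ℤ => 1 / ((τ : ℂ) + j) ^ 2 / 2) (∫ x, fourierIntegrand k x) := by
    have ha := hasSum_integral_Ioi_div_sinh k
    have hb := hasSum_integral_Ioi_div_sinh (-k)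
    have h4 : HasSum (fun j : ℤ => 1 / ((τ : ℂ) + j) ^ 2 / 2)
        ((∫ x in Set.Ioi (0 : ℝ), fourierIntegrand k x) +
          ∫ x in Set.Ioi (0 : ℝ), fourierIntegrand (-k) x) := by
      refine HasSum.of_nat_of_neg_add_one (ha.congr_fun fun n => ?_) (hb.congr_fun fun n => ?_)
      · rw [hτ]
        have h5 : (1 + Complex.I * k) / 2 + ((n : ℤ) : ℂ) =
          ((2 * n + 1 : ℂ) + Complex.I * k) / 2 := by push_cast; ring
        rw [h5, div_pow, one_div_div, div_div]
        rw [mul_comm, ← div_div]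
        norm_num
      · rw [hτ]
        have h5 : (1 + Complex.I * k) / 2 + ((-((n : ℤ) + 1) : ℤ) : ℂ) =
          (-((2 * n + 1 : ℂ) + Complex.I * (-k : ℝ))) / 2 := by push_cast; ring
        rw [h5, div_pow, neg_sq, one_div_div, div_div]
        rw [mul_comm, ← div_div]
        norm_num
    have h6 := (hasSum_integral_fourierIntegrand k).unique ((ha.add hb).congr_fun fun n => by
      push_cast
      ring_nf)
    rwa [h6]
  have h7 := h3.tsum_eq
  rw [tsum_div_const, h1] at h7
  rw [← h7, Real.cosh_eq]
  have h8 : Real.exp (Real.pi * k) = (Real.exp (-(Real.pi * k)))⁻¹ := by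
    rw [← Real.exp_neg, neg_neg]
  rw [h8]
  set e := Real.exp (-(Real.pi * k)) with he
  have he0 : 0 < e := Real.exp_pos _
  have h9 : (Real.pi ^ 2 / (1 + (e⁻¹ + e) / 2) : ℝ) = 2 * Real.pi ^ 2 * e / (1 + e) ^ 2 := by
    field_simp
    ring
  rw [h9]
  have h10 : (1 + e : ℂ) ≠ 0 := by
    have : (0 : ℝ) < 1 + e := by linarith
    exact_mod_cast this.ne'
  push_cast
  rw [sub_neg_eq_add]
  norm_num
  field_simp
  linear_combination (-e : ℂ) * Complex.I_sq

theorem integral_fourierIntegrand (k : ℝ) :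
    ∫ x, fourierIntegrand k x = ((Real.pi ^ 2 / (1 + Real.cosh (Real.pi * k)) : ℝ) : ℂ) := by
  have hc : Continuous fun k : ℝ =>
      ((Real.pi ^ 2 / (1 + Real.cosh (Real.pi * k)) : ℝ) : ℂ) := by
    refine Complex.continuous_ofReal.comp (continuous_const.div ?_ fun k => ?_)
    · exact continuous_const.add (Real.continuous_cosh.comp (by fun_prop))
    · have := Real.cosh_pos (Real.pi * k)
      positivity
  have h := Continuous.ext_on (dense_compl_singleton (0 : ℝ)) continuous_integral_fourierIntegrand hc
    fun k hk => ?_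
  · exact congrFun h k
  · rcases lt_or_gt_of_ne (Set.mem_compl_singleton_iff.1 hk) with h0 | h0
    · have h1 := integral_fourierIntegrand_of_pos (neg_pos.2 h0)
      rw [← integral_fourierIntegrand_neg, h1, mul_neg, Real.cosh_neg]
    · exact integral_fourierIntegrand_of_pos h0

/-! ### Poisson summation -/

theorem sinh_re_le_norm_cosh (w : ℂ) : Real.sinh w.re ≤ ‖Complex.cosh w‖ := by
  have h1 : ‖2 * Complex.cosh w‖ = 2 * ‖Complex.cosh w‖ := by simp
  have h2 := norm_sub_norm_le (Complex.exp w) (-Complex.exp (-w))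
  rw [norm_neg, sub_neg_eq_add, ← Complex.two_cosh, h1, Complex.norm_exp, Complex.norm_exp,
    Complex.neg_re] at h2
  rw [Real.sinh_eq]
  linarith

theorem sinh_re_le_norm_sinh (w : ℂ) : Real.sinh w.re ≤ ‖Complex.sinh w‖ := by
  have h1 : ‖2 * Complex.sinh w‖ = 2 * ‖Complex.sinh w‖ := by simp
  have h2 := norm_sub_norm_le (Complex.exp w) (Complex.exp (-w))
  rw [← Complex.two_sinh, h1, Complex.norm_exp, Complex.norm_exp, Complex.neg_re] at h2
  rw [Real.sinh_eq]
  linarith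

theorem one_add_cosh_eq (w : ℂ) : 1 + Complex.cosh w = 2 * Complex.cosh (w / 2) ^ 2 := by
  have h1 := Complex.cosh_two_mul (w / 2)
  have h2 := Complex.cosh_sq (w / 2)
  rw [mul_div_cancel₀ _ two_ne_zero] at h1
  linear_combination h1 - h2

theorem sq_le_norm_one_add_cosh {w : ℂ} (hw : 0 < w.re) : w.re ^ 2 / 2 ≤ ‖1 + Complex.cosh w‖ := by
  have h1 := sinh_re_le_norm_cosh (w / 2)
  have h2 : (w / 2).re = w.re / 2 := by simp
  rw [h2] at h1
  have h3 := add_cube_le_sinh (x := w.re / 2) (by linarith)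
  have h4 : 0 < (w.re / 2) ^ 3 := by positivity
  have h5 : w.re / 2 ≤ ‖Complex.cosh (w / 2)‖ := by linarith
  rw [one_add_cosh_eq, norm_mul, norm_pow, Complex.norm_ofNat]
  nlinarith

theorem one_add_cosh_ne_zero {w : ℂ} (hw : 0 < w.re) : 1 + Complex.cosh w ≠ 0 := by
  have h1 := sq_le_norm_one_add_cosh hw
  rw [← norm_pos_iff]
  have : 0 < w.re ^ 2 / 2 := by positivity
  linarith

theorem norm_one_div_one_add_cosh_le {w : ℂ} (hw : 0 < w.re) :
    ‖1 / (1 + Complex.cosh w)‖ ≤ 2 / w.re ^ 2 := by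
  rw [norm_div, norm_one, div_le_div_iff₀ (norm_pos_iff.2 (one_add_cosh_ne_zero hw))
    (by positivity)]
  linarith [sq_le_norm_one_add_cosh hw]

theorem re_two_pi_sq_div (l : ℕ+) (z : ℂ) :
    (2 * (Real.pi : ℂ) ^ 2 * l / z).re = 2 * Real.pi ^ 2 * (l : ℕ) * (z.re / Complex.normSq z) := by
  have h1 : 2 * (Real.pi : ℂ) ^ 2 * l / z = ((2 * Real.pi ^ 2 * (l : ℕ) : ℝ) : ℂ) * z⁻¹ := by
    push_cast
    rfl
  rw [h1, Complex.re_ofReal_mul, Complex.inv_re]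

theorem re_two_pi_sq_div_pos {z : ℂ} (hz : 0 < z.re) (l : ℕ+) :
    0 < (2 * (Real.pi : ℂ) ^ 2 * l / z).re := by
  have h0 : z ≠ 0 := by
    rintro rfl
    simp at hz
  have h1 : (0 : ℝ) < (l : ℕ) := by exact_mod_cast l.pos
  have h2 := Complex.normSq_pos.2 h0
  have h3 := Real.pi_pos
  rw [re_two_pi_sq_div]
  positivity

/-- The continuous function `x / sinh (tx)`, with the value `1/t` at the origin. -/
def poissonFunction (t x : ℝ) : ℂ := (((dslope Real.sinh 0 (t * x))⁻¹ / t : ℝ) : ℂ)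

theorem inv_dslope_sinh {y : ℝ} (hy : y ≠ 0) : (dslope Real.sinh 0 y)⁻¹ = y / Real.sinh y := by
  rw [dslope_of_ne _ hy, slope_def_field, Real.sinh_zero, sub_zero, sub_zero, inv_div]

theorem poissonFunction_of_ne {t x : ℝ} (ht : 0 < t) (hx : x ≠ 0) :
    poissonFunction t x = ((x / Real.sinh (t * x) : ℝ) : ℂ) := by
  rw [poissonFunction, inv_dslope_sinh (mul_ne_zero ht.ne' hx)]
  congr 1
  field_simp

theorem continuous_dslope_sinh : Continuous (dslope Real.sinh 0) := by
  rw [← continuousOn_univ, continuousOn_dslope univ_mem]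
  exact ⟨Real.continuous_sinh.continuousOn, Real.differentiable_sinh 0⟩

theorem dslope_sinh_ne_zero (y : ℝ) : dslope Real.sinh 0 y ≠ 0 := by
  rcases eq_or_ne y 0 with rfl | hy
  · simp
  · intro h
    have h1 := inv_dslope_sinh hy
    rw [h, inv_zero] at h1
    exact div_ne_zero hy (by simpa using hy) h1.symm

theorem continuous_poissonFunction (t : ℝ) : Continuous (poissonFunction t) := by
  refine Complex.continuous_ofReal.comp (Continuous.div_const (Continuous.inv₀
    (continuous_dslope_sinh.comp (by fun_prop)) fun x => dslope_sinh_ne_zero _) t)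

theorem eventually_cocompact_ne_zero : ∀ᶠ x : ℝ in cocompact ℝ, x ≠ 0 :=
  (isCompact_singleton (x := (0 : ℝ))).compl_mem_cocompact

theorem abs_rpow_neg_two (x : ℝ) : |x| ^ (-2 : ℝ) = (x ^ 2)⁻¹ := by
  rw [Real.rpow_neg (abs_nonneg x), Real.rpow_two, sq_abs]

theorem isBigO_poissonFunction {t : ℝ} (ht : 0 < t) :
    poissonFunction t =O[cocompact ℝ] fun x : ℝ => |x| ^ (-2 : ℝ) := by
  refine IsBigO.of_bound (6 / t ^ 3) ?_
  filter_upwards [eventually_cocompact_ne_zero] with x hx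
  have h1 := abs_div_sinh_le (t * x)
  have hx2 : 0 < x ^ 2 := by positivity
  rw [poissonFunction, inv_dslope_sinh (mul_ne_zero ht.ne' hx), Complex.norm_real, norm_div,
    Real.norm_eq_abs, Real.norm_eq_abs, abs_of_pos ht, abs_rpow_neg_two, Real.norm_eq_abs,
    abs_of_pos (inv_pos.2 hx2), div_le_iff₀ ht]
  refine h1.trans ?_
  have h2 : 6 / t ^ 3 * (x ^ 2)⁻¹ * t = 6 * ((t * x) ^ 2)⁻¹ := by
    field_simp
  rw [h2]
  gcongr
  linarith

open FourierTransform in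
/-- The Fourier transform at `w` is that of `x / sinh x` at `2πw/t`, up to the factor `1/t²`. -/
theorem fourier_poissonFunction {t : ℝ} (ht : 0 < t) (w : ℝ) : 𝓕 (poissonFunction t) w =
    ((Real.pi ^ 2 / t ^ 2 / (1 + Real.cosh (2 * Real.pi ^ 2 * w / t)) : ℝ) : ℂ) := by
  rw [Real.fourier_real_eq_integral_exp_smul]
  have h1 : (fun v : ℝ => Complex.exp (((-2 * Real.pi * v * w : ℝ) : ℂ) * Complex.I) •
      poissonFunction t v) =ᵐ[volume]
      fun v => (t : ℂ)⁻¹ * fourierIntegrand (2 * Real.pi * w / t) (t * v) := by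
    have h2 : ∀ᵐ v : ℝ, v ≠ 0 := by simp [ae_iff]
    filter_upwards [h2] with v hv
    rw [poissonFunction, inv_dslope_sinh (mul_ne_zero ht.ne' hv), fourierIntegrand, smul_eq_mul]
    have h3 : ((-2 * Real.pi * v * w : ℝ) : ℂ) * Complex.I =
        -(Complex.I * ((2 * Real.pi * w / t : ℝ) : ℂ) * ((t * v : ℝ) : ℂ)) := by
      have ht' : (t : ℂ) ≠ 0 := by exact_mod_cast ht.ne'
      push_cast
      field_simp
    rw [h3]
    push_cast
    ring
  rw [integral_congr_ae h1, integral_const_mul, Measure.integral_comp_mul_left,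
    integral_fourierIntegrand, abs_of_pos (inv_pos.2 ht), Complex.real_smul]
  have h4 : Real.pi * (2 * Real.pi * w / t) = 2 * Real.pi ^ 2 * w / t := by ring
  rw [h4]
  push_cast
  field_simp

open FourierTransform in
theorem isBigO_fourier_poissonFunction {t : ℝ} (ht : 0 < t) :
    (𝓕 (poissonFunction t)) =O[cocompact ℝ] fun x : ℝ => |x| ^ (-2 : ℝ) := by
  refine IsBigO.of_bound (1 / (2 * Real.pi ^ 2)) ?_
  filter_upwards [eventually_cocompact_ne_zero] with w hw
  have h1 := one_add_sq_le_cosh (2 * Real.pi ^ 2 * w / t)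
  have hw2 : 0 < w ^ 2 := by positivity
  have hπ := Real.pi_pos
  have h2 := Real.cosh_pos (2 * Real.pi ^ 2 * w / t)
  rw [fourier_poissonFunction ht, Complex.norm_real, Real.norm_of_nonneg (by positivity),
    abs_rpow_neg_two, Real.norm_of_nonneg (by positivity)]
  have h3 : 1 / (2 * Real.pi ^ 2) * (w ^ 2)⁻¹ =
      Real.pi ^ 2 / t ^ 2 / ((2 * Real.pi ^ 2 * w / t) ^ 2 / 2) := by
    field_simp
  rw [h3]
  have h4 : 0 < (2 * Real.pi ^ 2 * w / t) ^ 2 := by positivity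
  gcongr
  linarith

/-- Poisson summation for `x / sinh (tx)`. -/
theorem Zo_ofReal {t : ℝ} (ht : 0 < t) :
    Zo t = (Real.pi : ℂ) ^ 2 / (4 * (t : ℂ) ^ 2) - 1 / (2 * (t : ℂ)) +
      (Real.pi : ℂ) ^ 2 / (t : ℂ) ^ 2 *
        ∑' l : ℕ+, 1 / (1 + Complex.cosh (2 * (Real.pi : ℂ) ^ 2 * l / t)) := by
  have hP := Real.tsum_eq_tsum_fourier_of_rpow_decay (continuous_poissonFunction t) one_lt_two
    (isBigO_poissonFunction ht) (isBigO_fourier_poissonFunction ht) 0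
  have hs1 : Summable fun n : ℤ => poissonFunction t n :=
    summable_of_isBigO (Real.summable_abs_int_rpow one_lt_two)
      ((isBigO_poissonFunction ht).comp_tendsto Int.tendsto_coe_cofinite)
  have hs2 : Summable fun n : ℤ => FourierTransform.fourier (poissonFunction t) n :=
    summable_of_isBigO (Real.summable_abs_int_rpow one_lt_two)
      ((isBigO_fourier_poissonFunction ht).comp_tendsto Int.tendsto_coe_cofinite)
  have he1 : Function.Even fun n : ℤ => poissonFunction t n := by
    intro n
    rcases eq_or_ne n 0 with rfl | hn
    · simp
    · have hn' : (n : ℝ) ≠ 0 := by exact_mod_cast hn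
      have hn'' : ((-n : ℤ) : ℝ) ≠ 0 := by simpa using hn
      simp only [poissonFunction_of_ne ht hn', poissonFunction_of_ne ht hn'']
      push_cast
      simp only [mul_neg, Complex.sinh_neg, neg_div_neg_eq]
  have he2 : Function.Even fun n : ℤ => FourierTransform.fourier (poissonFunction t) n := by
    intro n
    simp only [fourier_poissonFunction ht]
    push_cast
    simp only [mul_neg, neg_div, Complex.cosh_neg]
  simp only [zero_add, QuotientAddGroup.mk_zero, fourier_eval_zero, mul_one] at hP
  rw [tsum_int_eq_zero_add_two_mul_tsum_pnat he1 hs1,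
    tsum_int_eq_zero_add_two_mul_tsum_pnat he2 hs2] at hP
  have h0 : poissonFunction t ((0 : ℤ) : ℝ) = 1 / t := by
    simp [poissonFunction]
  have h1 : (∑' n : ℕ+, poissonFunction t (((n : ℕ) : ℤ) : ℝ)) = Zo t := by
    rw [← (hasSum_Zo (z := t) (by simpa using ht)).tsum_eq]
    refine tsum_congr fun n => ?_
    have hn : (((n : ℕ) : ℤ) : ℝ) ≠ 0 := by simp
    rw [poissonFunction_of_ne ht hn]
    push_cast
    rw [mul_comm]
  have h2 : FourierTransform.fourier (poissonFunction t) ((0 : ℤ) : ℝ) =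
      (Real.pi : ℂ) ^ 2 / (2 * (t : ℂ) ^ 2) := by
    rw [fourier_poissonFunction ht]
    push_cast
    norm_num
    ring
  have h3 : (∑' n : ℕ+, FourierTransform.fourier (poissonFunction t) (((n : ℕ) : ℤ) : ℝ)) =
      (Real.pi : ℂ) ^ 2 / (t : ℂ) ^ 2 *
        ∑' l : ℕ+, 1 / (1 + Complex.cosh (2 * (Real.pi : ℂ) ^ 2 * l / t)) := by
    rw [← tsum_mul_left]
    refine tsum_congr fun n => ?_
    rw [fourier_poissonFunction ht]
    push_cast
    ring
  rw [h0, h1, h2, h3, two_nsmul, two_nsmul] at hP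
  have h4 : (t : ℂ) ≠ 0 := by exact_mod_cast ht.ne'
  linear_combination hP / 2

/-! ### Analytic continuation to the half-plane -/

theorem norm_div_sinh_le {z : ℂ} (hz : 0 < z.re) (m : ℕ+) :
    ‖(m : ℂ) / Complex.sinh (m * z)‖ ≤ 6 / z.re ^ 3 * (1 / ((m : ℕ) : ℝ) ^ 2) := by
  have hm : (0 : ℝ) < (m : ℕ) := by exact_mod_cast m.pos
  have h1 : ((m : ℂ) * z).re = (m : ℕ) * z.re := by
    rw [← Complex.ofReal_natCast, Complex.re_ofReal_mul]
  have h2 := sinh_re_le_norm_sinh (m * z)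
  rw [h1] at h2
  have h3 := add_cube_le_sinh (x := (m : ℕ) * z.re) (by positivity)
  have h4 : 0 < (m : ℕ) * z.re := by positivity
  have h5 : ((m : ℕ) * z.re) ^ 3 / 6 ≤ ‖Complex.sinh (m * z)‖ := by linarith
  rw [norm_div, Complex.norm_natCast]
  calc ((m : ℕ) : ℝ) / ‖Complex.sinh (m * z)‖ ≤ (m : ℕ) / (((m : ℕ) * z.re) ^ 3 / 6) := by gcongr
    _ = _ := by field_simp

theorem sinh_mul_ne_zero {z : ℂ} (hz : 0 < z.re) (m : ℕ+) : Complex.sinh (m * z) ≠ 0 := by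
  have hm : (0 : ℝ) < (m : ℕ) := by exact_mod_cast m.pos
  have h1 : ((m : ℂ) * z).re = (m : ℕ) * z.re := by
    rw [← Complex.ofReal_natCast, Complex.re_ofReal_mul]
  have h2 := sinh_re_le_norm_sinh (m * z)
  have h3 : 0 < Real.sinh ((m : ℂ) * z).re := by
    rw [h1]
    exact Real.sinh_pos_iff.2 (by positivity)
  exact norm_pos_iff.1 (h3.trans_le h2)

theorem isOpen_half_plane (δ : ℝ) : IsOpen {z : ℂ | δ < z.re} :=
  isOpen_lt continuous_const Complex.continuous_re

theorem differentiableOn_Zo : DifferentiableOn ℂ Zo {z : ℂ | 0 < z.re} := by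
  intro z (hz : 0 < z.re)
  have hU := isOpen_half_plane (z.re / 2)
  have h1 : DifferentiableOn ℂ (fun w : ℂ => ∑' m : ℕ+, (m : ℂ) / Complex.sinh (m * w))
      {w : ℂ | z.re / 2 < w.re} := by
    refine Complex.differentiableOn_tsum_of_summable_norm
      (summable_pnat_one_div_sq.mul_left (6 / (z.re / 2) ^ 3)) (fun m => ?_) hU fun m w hw => ?_
    · intro w (hw : z.re / 2 < w.re)
      have hw0 : 0 < w.re := by linarith
      have h2 : DifferentiableAt ℂ (fun w : ℂ => Complex.sinh (m * w)) w := by fun_prop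
      exact ((differentiableAt_const _).div h2 (sinh_mul_ne_zero hw0 m)).differentiableWithinAt
    · have hw' : z.re / 2 < w.re := hw
      have hw0 : 0 < w.re := by linarith
      refine (norm_div_sinh_le hw0 m).trans ?_
      gcongr
  have h3 : DifferentiableAt ℂ Zo z := by
    refine (h1.differentiableAt (hU.mem_nhds (by simpa using hz))).congr_of_eventuallyEq ?_
    filter_upwards [hU.mem_nhds (by simpa using hz : z ∈ {w : ℂ | z.re / 2 < w.re})] with w hw
    have hw' : z.re / 2 < w.re := hw
    exact (hasSum_Zo (by linarith)).tsum_eq.symm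
  exact h3.differentiableWithinAt

theorem summable_cosh_terms {z : ℂ} (hz : 0 < z.re) :
    Summable fun l : ℕ+ => 1 / (1 + Complex.cosh (2 * (Real.pi : ℂ) ^ 2 * l / z)) := by
  have h1 : 0 < z.re / Complex.normSq z := by
    refine div_pos hz (Complex.normSq_pos.2 ?_)
    rintro rfl
    simp at hz
  refine (summable_pnat_one_div_sq.mul_left
    (2 / (2 * Real.pi ^ 2 * (z.re / Complex.normSq z)) ^ 2)).of_norm_bounded fun l => ?_
  refine (norm_one_div_one_add_cosh_le (re_two_pi_sq_div_pos hz l)).trans (le_of_eq ?_)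
  rw [re_two_pi_sq_div]
  ring

theorem differentiableOn_cosh_series : DifferentiableOn ℂ
    (fun z : ℂ => ∑' l : ℕ+, 1 / (1 + Complex.cosh (2 * (Real.pi : ℂ) ^ 2 * l / z)))
    {z : ℂ | 0 < z.re} := by
  intro z (hz : 0 < z.re)
  -- on this neighbourhood of `z` the real parts of `1 / w` are bounded below by `c`
  let U : Set ℂ := {w : ℂ | z.re / 2 < w.re} ∩ {w : ℂ | Complex.normSq w < Complex.normSq z + 1}
  have hU : IsOpen U := (isOpen_half_plane _).inter
    (isOpen_lt Complex.continuous_normSq continuous_const)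
  have hzU : z ∈ U := ⟨by simpa using hz, by simp⟩
  set c := (z.re / 2) / (Complex.normSq z + 1) with hc
  have hns := Complex.normSq_nonneg z
  have hc0 : 0 < c := by positivity
  have hre : ∀ w ∈ U, 0 < w.re ∧ c ≤ w.re / Complex.normSq w := by
    rintro w ⟨hw1 : z.re / 2 < w.re, hw2 : Complex.normSq w < Complex.normSq z + 1⟩
    have hw0 : 0 < w.re := by linarith
    refine ⟨hw0, ?_⟩
    have hwn : 0 < Complex.normSq w := by
      refine Complex.normSq_pos.2 ?_
      rintro rfl
      simp at hw0
    rw [hc]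
    gcongr
  have h1 : DifferentiableOn ℂ
      (fun w : ℂ => ∑' l : ℕ+, 1 / (1 + Complex.cosh (2 * (Real.pi : ℂ) ^ 2 * l / w))) U := by
    refine Complex.differentiableOn_tsum_of_summable_norm
      (summable_pnat_one_div_sq.mul_left (2 / (2 * Real.pi ^ 2 * c) ^ 2))
      (fun l => ?_) hU fun l w hw => ?_
    · intro w hw
      have hw0 : w ≠ 0 := by
        rintro rfl
        simpa using (hre 0 hw).1
      have h2 : DifferentiableAt ℂ (fun w : ℂ => 2 * (Real.pi : ℂ) ^ 2 * l / w) w :=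
        (differentiableAt_const _).div differentiableAt_id hw0
      exact ((differentiableAt_const _).div ((differentiableAt_const _).add h2.ccosh)
        (one_add_cosh_ne_zero (re_two_pi_sq_div_pos (hre w hw).1 l))).differentiableWithinAt
    · refine (norm_one_div_one_add_cosh_le (re_two_pi_sq_div_pos (hre w hw).1 l)).trans ?_
      have hl : (0 : ℝ) < (l : ℕ) := by exact_mod_cast l.pos
      have h2 : 2 / (2 * Real.pi ^ 2 * c) ^ 2 * (1 / ((l : ℕ) : ℝ) ^ 2) =
        2 / (2 * Real.pi ^ 2 * (l : ℕ) * c) ^ 2 := by ring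
      have hπ := Real.pi_pos
      rw [re_two_pi_sq_div, h2]
      gcongr
      exact (hre w hw).2
  exact (h1.differentiableAt (hU.mem_nhds hzU)).differentiableWithinAt

/-- Both sides are holomorphic in the right half-plane and agree on the positive half-line. -/
theorem trace_formula {z : ℂ} (hz : 0 < z.re) :
    Zo z = (Real.pi : ℂ) ^ 2 / (4 * z ^ 2) - 1 / (2 * z) + (Real.pi : ℂ) ^ 2 / z ^ 2 *
        ∑' l : ℕ+, 1 / (1 + Complex.cosh (2 * (Real.pi : ℂ) ^ 2 * l / z)) := by
  let g : ℂ → ℂ := fun z => (Real.pi : ℂ) ^ 2 / (4 * z ^ 2) - 1 / (2 * z) +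
    (Real.pi : ℂ) ^ 2 / z ^ 2 *
      ∑' l : ℕ+, 1 / (1 + Complex.cosh (2 * (Real.pi : ℂ) ^ 2 * l / z))
  have hU := isOpen_half_plane 0
  have hne : ∀ w ∈ {z : ℂ | 0 < z.re}, w ≠ 0 := by
    rintro w hw rfl
    simp at hw
  have hg : DifferentiableOn ℂ g {z : ℂ | 0 < z.re} := by
    refine DifferentiableOn.add (DifferentiableOn.sub ?_ ?_)
      (DifferentiableOn.mul ?_ differentiableOn_cosh_series)
    · exact (differentiableOn_const _).div (by fun_prop) fun w hw => by simpa using hne w hw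
    · exact (differentiableOn_const _).div (by fun_prop) fun w hw => by simpa using hne w hw
    · exact (differentiableOn_const _).div (by fun_prop) fun w hw => by simpa using hne w hw
  have hconn : IsPreconnected {z : ℂ | 0 < z.re} := (convex_halfSpace_re_gt 0).isPreconnected
  have hfreq : ∃ᶠ w in 𝓝[≠] (1 : ℂ), Zo w = g w := by
    have h1 : Tendsto (fun t : ℝ => (t : ℂ)) (𝓝[>] (1 : ℝ)) (𝓝[≠] (1 : ℂ)) := by
      refine tendsto_nhdsWithin_iff.2 ⟨?_, ?_⟩
      · have h2 : Tendsto (fun t : ℝ => (t : ℂ)) (𝓝 (1 : ℝ)) (𝓝 ((1 : ℝ) : ℂ)) :=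
          Complex.continuous_ofReal.tendsto 1
        rw [Complex.ofReal_one] at h2
        exact h2.mono_left nhdsWithin_le_nhds
      · filter_upwards [self_mem_nhdsWithin] with t ht
        have : t ≠ 1 := ne_of_gt ht
        simpa using this
    refine h1.frequently (Eventually.frequently ?_)
    filter_upwards [self_mem_nhdsWithin] with t (ht : 1 < t)
    exact Zo_ofReal (by linarith)
  exact (differentiableOn_Zo.analyticOnNhd hU).eqOn_of_preconnected_of_frequently_eq
    (hg.analyticOnNhd hU) hconn (z₀ := 1) (by simp) hfreq hz

/-! ### Exponentially small corrections -/

/-- The expansion `1 / (1 + cosh w) = 2 ∑ (-1)^{d+1} d e^{-dw}`. -/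
theorem hasSum_one_div_one_add_cosh {w : ℂ} (hw : 0 < w.re) :
    HasSum (fun d : ℕ+ => 2 * ((-1) ^ ((d : ℕ) + 1) * ((d : ℕ) : ℂ) * Complex.exp (-(d * w))))
      (1 / (1 + Complex.cosh w)) := by
  have hr : ‖-Complex.exp (-w)‖ < 1 := by
    rw [norm_neg, Complex.norm_exp, Real.exp_lt_one_iff]
    simpa using hw
  have h1 := (hasSum_coe_mul_geometric_of_norm_lt_one hr).mul_left (-2)
  have h0 : 1 + Complex.exp (-w) ≠ 0 := by
    intro h
    have h2 : -Complex.exp (-w) = 1 := by linear_combination -h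
    rw [h2, norm_one] at hr
    exact lt_irrefl _ hr
  have h2 : -2 * (-Complex.exp (-w) / (1 - -Complex.exp (-w)) ^ 2) = 1 / (1 + Complex.cosh w) := by
    have h3 := one_add_cosh_ne_zero hw
    have h4 : 2 * (1 + Complex.cosh w) * Complex.exp (-w) = (1 + Complex.exp (-w)) ^ 2 := by
      have h5 : Complex.exp w * Complex.exp (-w) = 1 := by rw [← Complex.exp_add]; simp
      linear_combination Complex.exp (-w) * Complex.two_cosh w + h5
    rw [sub_neg_eq_add, ← h4]
    have h6 := Complex.exp_ne_zero (-w)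
    field_simp
  rw [h2] at h1
  have h7 : Function.support (fun n : ℕ => -2 * ((n : ℂ) * (-Complex.exp (-w)) ^ n)) ⊆
      Set.range ((↑) : ℕ+ → ℕ) := by
    intro n hn
    refine ⟨⟨n, Nat.pos_of_ne_zero ?_⟩, rfl⟩
    rintro rfl
    simp at hn
  refine ((PNat.coe_injective.hasSum_iff (fun n hn => ?_)).2 h1).congr_fun fun d => ?_
  · by_contra h8
    exact hn (h7 h8)
  · simp only [Function.comp_apply]
    rw [neg_pow (Complex.exp (-w)), ← Complex.exp_nat_mul, pow_succ, mul_neg]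
    ring_nf

theorem norm_neg_one_pow_mul (d : ℕ) (x : ℂ) : ‖(-1 : ℂ) ^ d * x‖ = ‖x‖ := by
  rw [norm_mul, norm_pow, norm_neg, norm_one, one_pow, one_mul]

theorem exp_div_eq (z : ℂ) (d l : ℕ+) : Complex.exp (-(d * (2 * (Real.pi : ℂ) ^ 2 * l / z))) =
    Complex.exp (-(2 * (Real.pi : ℂ) ^ 2 * ((d * l : ℕ) : ℂ) / z)) := by
  congr 1
  push_cast
  ring

theorem summable_double_correction {z : ℂ} (hz : 0 < z.re) :
    Summable fun q : ℕ+ × ℕ+ => (-1) ^ ((q.1 : ℕ) + 1) * ((q.1 : ℕ) : ℂ) *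
      Complex.exp (-(2 * (Real.pi : ℂ) ^ 2 * ((q.1 * q.2 : ℕ) : ℂ) / z)) := by
  have hX : 0 < z.re / Complex.normSq z := by
    refine div_pos hz (Complex.normSq_pos.2 ?_)
    rintro rfl
    simp at hz
  set X := z.re / Complex.normSq z
  have h1 := (summable_pnat_one_div_sq.mul_of_nonneg summable_pnat_one_div_sq
    (fun m => by positivity) (fun n => by positivity)).mul_left (6 / (2 * Real.pi ^ 2 * X) ^ 3)
  refine h1.of_norm_bounded fun q => ?_
  have hd : (0 : ℝ) < (q.1 : ℕ) := by exact_mod_cast q.1.pos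
  have hl : (1 : ℝ) ≤ (q.2 : ℕ) := by exact_mod_cast q.2.pos
  have hl0 : (0 : ℝ) < (q.2 : ℕ) := by linarith
  have hπ := Real.pi_pos
  have h2 := cubic_exp_neg_le (u := (q.1 : ℕ) * (2 * Real.pi ^ 2 * (q.2 : ℕ) * X)) (by positivity)
  rw [mul_assoc, norm_neg_one_pow_mul, norm_mul, Complex.norm_natCast, ← exp_div_eq,
    Complex.norm_exp]
  have h3 : (-((q.1 : ℂ) * (2 * (Real.pi : ℂ) ^ 2 * q.2 / z))).re =
      -((q.1 : ℕ) * (2 * Real.pi ^ 2 * (q.2 : ℕ) * X)) := by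
    rw [Complex.neg_re, ← Complex.ofReal_natCast (q.1 : ℕ), Complex.re_ofReal_mul,
      re_two_pi_sq_div]
  rw [h3]
  calc _ ≤ ((q.1 : ℕ) : ℝ) * (6 / ((q.1 : ℕ) * (2 * Real.pi ^ 2 * (q.2 : ℕ) * X)) ^ 3) := by gcongr
    _ = 6 / (2 * Real.pi ^ 2 * X) ^ 3 * (1 / ((q.1 : ℕ) : ℝ) ^ 2 * (1 / ((q.2 : ℕ) : ℝ) ^ 3)) := by
      field_simp
    _ ≤ _ := by
      gcongr
      norm_num

/-- Expanding each term of the trace formula and collecting the pairs `(d, l)` with `dl = N`. -/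
theorem hasSum_correction {z : ℂ} (hz : 0 < z.re) :
    HasSum (fun N : ℕ+ => (correctionCoeff N : ℂ) *
      Complex.exp (-(2 * (Real.pi : ℂ) ^ 2 * N / z)))
      ((∑' l : ℕ+, 1 / (1 + Complex.cosh (2 * (Real.pi : ℂ) ^ 2 * l / z))) / 2) := by
  have hs := summable_double_correction hz
  have h1 : (∑' q : ℕ+ × ℕ+, (-1) ^ ((q.1 : ℕ) + 1) * ((q.1 : ℕ) : ℂ) *
      Complex.exp (-(2 * (Real.pi : ℂ) ^ 2 * ((q.1 * q.2 : ℕ) : ℂ) / z))) =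
      (∑' l : ℕ+, 1 / (1 + Complex.cosh (2 * (Real.pi : ℂ) ^ 2 * l / z))) / 2 := by
    have h2 := ((Equiv.prodComm ℕ+ ℕ+).summable_iff.2 hs).hasSum.prod_fiberwise
      (g := fun l : ℕ+ => 1 / (1 + Complex.cosh (2 * (Real.pi : ℂ) ^ 2 * l / z)) / 2) fun l => by
        have h3 := (hasSum_one_div_one_add_cosh (re_two_pi_sq_div_pos hz l)).div_const 2
        refine h3.congr_fun fun d => ?_
        simp only [Function.comp_apply, Equiv.prodComm_apply, Prod.swap_prod_mk]
        rw [← exp_div_eq, mul_div_cancel_left₀ _ (two_ne_zero' ℂ)]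
    rw [← (Equiv.prodComm ℕ+ ℕ+).tsum_eq, ← tsum_div_const, h2.tsum_eq]
    rfl
  rw [← h1]
  have h4 := (sigmaAntidiagonalEquivProd.hasSum_iff.2 hs.hasSum)
  refine h4.sigma fun N => ?_
  have h5 : ∀ c : Nat.divisorsAntidiagonal N,
      ((fun q : ℕ+ × ℕ+ => (-1) ^ ((q.1 : ℕ) + 1) * ((q.1 : ℕ) : ℂ) *
      Complex.exp (-(2 * (Real.pi : ℂ) ^ 2 * ((q.1 * q.2 : ℕ) : ℂ) / z))) ∘
        sigmaAntidiagonalEquivProd) ⟨N, c⟩ = (-1) ^ (c.1.1 + 1) * (c.1.1 : ℂ) *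
        Complex.exp (-(2 * (Real.pi : ℂ) ^ 2 * N / z)) := by
    intro c
    have h6 := (Nat.mem_divisorsAntidiagonal.1 c.2).1
    have h7 : ((sigmaAntidiagonalEquivProd ⟨N, c⟩).1 : ℕ) = c.1.1 := rfl
    have h8 : ((sigmaAntidiagonalEquivProd ⟨N, c⟩).2 : ℕ) = c.1.2 := rfl
    simp only [Function.comp_apply, h7, h8, h6]
  simp only [h5]
  have h9 : (correctionCoeff N : ℂ) * Complex.exp (-(2 * (Real.pi : ℂ) ^ 2 * N / z)) =
      ∑ c : Nat.divisorsAntidiagonal N, (-1) ^ (c.1.1 + 1) * (c.1.1 : ℂ) *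
        Complex.exp (-(2 * (Real.pi : ℂ) ^ 2 * N / z)) := by
    rw [← Finset.sum_mul, correctionCoeff, Finset.sum_coe_sort (Nat.divisorsAntidiagonal N)
      (fun c => (-1 : ℂ) ^ (c.1 + 1) * (c.1 : ℂ)),
      Nat.sum_divisorsAntidiagonal (fun d _ => (-1 : ℂ) ^ (d + 1) * (d : ℂ))]
    push_cast
    rfl
  rw [h9]
  exact hasSum_fintype _

theorem Zo_eq_correction {z : ℂ} (hz : 0 < z.re) :
    Zo z = (Real.pi : ℂ) ^ 2 / (4 * z ^ 2) - 1 / (2 * z) + 2 * (Real.pi : ℂ) ^ 2 / z ^ 2 *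
      ∑' N : ℕ+, (correctionCoeff N : ℂ) * Complex.exp (-(2 * (Real.pi : ℂ) ^ 2 * N / z)) := by
  rw [(hasSum_correction hz).tsum_eq, trace_formula hz]
  ring

theorem neg_one_pow_succ_mul (d : ℕ) :
    (-1 : ℤ) ^ (d + 1) * d = if Odd d then (d : ℤ) else -d := by
  split_ifs with h
  · rw [h.add_one.neg_one_pow, one_mul]
  · rw [(Nat.not_odd_iff_even.1 h).add_one.neg_one_pow]
    ring

/-- The odd divisors of `2M` are divisors of `M`, and its even divisors are the doubles of the
divisors of `M`; so the latter dominate. -/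
theorem correctionCoeff_two_mul_neg {M : ℕ} (hM : 0 < M) : correctionCoeff (2 * M) < 0 := by
  have h1 : correctionCoeff (2 * M) =
      ∑ d ∈ (2 * M).divisors.filter Odd, (d : ℤ) -
        ∑ d ∈ (2 * M).divisors.filter (¬ Odd ·), (d : ℤ) := by
    rw [correctionCoeff, Finset.sum_congr rfl fun d _ => neg_one_pow_succ_mul d,
      Finset.sum_ite, Finset.sum_neg_distrib, sub_eq_add_neg]
  have h2 : ∑ d ∈ (2 * M).divisors.filter Odd, (d : ℤ) ≤ ∑ d ∈ M.divisors, (d : ℤ) := by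
    refine Finset.sum_le_sum_of_subset_of_nonneg (fun d hd => ?_) fun d _ _ => by positivity
    obtain ⟨hd1, hd2⟩ := Finset.mem_filter.1 hd
    refine Nat.mem_divisors.2 ⟨?_, hM.ne'⟩
    exact (Nat.Coprime.dvd_of_dvd_mul_left (Nat.coprime_two_right.2 hd2)
      (Nat.dvd_of_mem_divisors hd1))
  have h3 : ∑ d ∈ M.divisors, (2 * d : ℤ) ≤ ∑ d ∈ (2 * M).divisors.filter (¬ Odd ·), (d : ℤ) := by
    have h4 : ∑ d ∈ M.divisors, (2 * d : ℤ) =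
        ∑ d ∈ M.divisors.image (fun e : ℕ => 2 * e), ((d : ℕ) : ℤ) := by
      rw [Finset.sum_image fun a _ b _ h => Nat.eq_of_mul_eq_mul_left two_pos h]
      push_cast
      rfl
    rw [h4]
    refine Finset.sum_le_sum_of_subset_of_nonneg (fun d hd => ?_) fun d _ _ => by positivity
    obtain ⟨e, he, rfl⟩ := Finset.mem_image.1 hd
    refine Finset.mem_filter.2 ⟨Nat.mem_divisors.2 ⟨?_, by omega⟩, by simp⟩
    exact Nat.mul_dvd_mul_left 2 (Nat.dvd_of_mem_divisors he)
  have h5 : 0 < ∑ d ∈ M.divisors, (d : ℤ) :=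
    Finset.sum_pos (fun d hd => by exact_mod_cast Nat.pos_of_mem_divisors hd)
      ⟨1, Nat.one_mem_divisors.2 hM.ne'⟩
  rw [← Finset.mul_sum] at h3
  linarith

/-- For odd `N` all the divisors count positively; for even `N` the even ones dominate. -/
theorem correctionCoeff_ne_zero (N : ℕ+) : correctionCoeff N ≠ 0 := by
  rcases Nat.even_or_odd' (N : ℕ) with ⟨M, hM | hM⟩
  · have hM0 : 0 < M := by
      have := N.pos
      omega
    rw [hM]
    exact (correctionCoeff_two_mul_neg hM0).ne
  · have hodd : Odd (N : ℕ) := ⟨M, hM⟩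
    have h1 : correctionCoeff N = ∑ d ∈ (N : ℕ).divisors, (d : ℤ) :=
      Finset.sum_congr rfl fun d hd => by
        rw [neg_one_pow_succ_mul, if_pos (hodd.of_dvd_nat (Nat.dvd_of_mem_divisors hd))]
    rw [h1]
    exact (Finset.sum_pos (fun d hd => by exact_mod_cast Nat.pos_of_mem_divisors hd)
      ⟨1, Nat.one_mem_divisors.2 N.ne_zero⟩).ne'

/-- A crude bound: there are at most `N` divisors, each at most `N`. -/
theorem abs_correctionCoeff_le (N : ℕ+) : ‖(correctionCoeff N : ℂ)‖ ≤ ((N : ℕ) : ℝ) ^ 2 := by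
  rw [correctionCoeff]
  push_cast
  refine (norm_sum_le _ _).trans ?_
  have h1 : ∀ d ∈ (N : ℕ).divisors, ‖(-1 : ℂ) ^ (d + 1) * (d : ℂ)‖ ≤ ((N : ℕ) : ℝ) := by
    intro d hd
    rw [norm_neg_one_pow_mul, Complex.norm_natCast]
    exact_mod_cast Nat.divisor_le hd
  refine (Finset.sum_le_card_nsmul _ _ _ h1).trans ?_
  rw [nsmul_eq_mul, sq]
  gcongr
  exact Nat.card_divisors_le_self N

theorem correctionCoeff_one : correctionCoeff 1 = 1 := by
  simp [correctionCoeff]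

/-- As a power series in `q = e^{-2π²/t}`, divided by `q`, the correction has the constant term
`a₁ = 1`. -/
theorem tendsto_correction_series : Tendsto (fun q : ℝ => ∑' N : ℕ+, (correctionCoeff N : ℂ) *
    (q : ℂ) ^ ((N : ℕ) - 1)) (𝓝[>] 0) (𝓝 1) := by
  have h0 : (1 : ℂ) = ∑' N : ℕ+, if N = 1 then (1 : ℂ) else 0 := 
    (tsum_ite_eq (1 : ℕ+) (fun _ => (1 : ℂ))).symm
  rw [h0]
  have hsum : Summable fun N : ℕ+ => ((N : ℕ) : ℝ) ^ 2 * (1 / 2) ^ ((N : ℕ) - 1) := by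
    have h1 := (summable_pow_mul_geometric_of_norm_lt_one 2 (r := (1 / 2 : ℝ))
      (by norm_num)).mul_left 2
    refine (h1.comp_injective PNat.coe_injective).congr fun N => ?_
    obtain ⟨n, hn⟩ := Nat.exists_eq_succ_of_ne_zero N.ne_zero
    simp only [Function.comp_apply, hn, Nat.succ_eq_add_one, Nat.add_sub_cancel, pow_succ]
    push_cast
    ring
  refine tendsto_tsum_of_dominated_convergence hsum (fun N => ?_) ?_
  · rcases eq_or_ne N 1 with rfl | hN
    · simp [correctionCoeff_one]
    · rw [if_neg hN]
      have hN' : (N : ℕ) - 1 ≠ 0 := by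
        have h1 : (N : ℕ) ≠ 1 := fun h => hN (PNat.coe_injective h)
        have := N.pos
        omega
      have hc : Tendsto (fun q : ℝ => (correctionCoeff N : ℂ) * (q : ℂ) ^ ((N : ℕ) - 1)) (𝓝 0)
          (𝓝 ((correctionCoeff N : ℂ) * ((0 : ℝ) : ℂ) ^ ((N : ℕ) - 1))) :=
        Continuous.tendsto (by fun_prop) 0
      rw [Complex.ofReal_zero, zero_pow hN', mul_zero] at hc
      exact hc.mono_left nhdsWithin_le_nhds
  · filter_upwards [Ioc_mem_nhdsGT (show (0 : ℝ) < 1 / 2 by norm_num)] with q hq N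
    rw [norm_mul, norm_pow, Complex.norm_of_nonneg hq.1.le]
    gcongr
    · exact pow_nonneg hq.1.le _
    · exact abs_correctionCoeff_le N
    · exact hq.1.le
    · exact hq.2

theorem tendsto_exp_neg_div : Tendsto (fun t : ℝ => Real.exp (-(2 * Real.pi ^ 2 / t))) (𝓝[>] 0)
    (𝓝[>] 0) := by
  refine tendsto_nhdsWithin_iff.2 ⟨?_, Eventually.of_forall fun t => Real.exp_pos _⟩
  have h1 : Tendsto (fun t : ℝ => 2 * Real.pi ^ 2 / t) (𝓝[>] 0) atTop := by
    have h2 := tendsto_inv_nhdsGT_zero (𝕜 := ℝ)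
    exact h2.const_mul_atTop (r := 2 * Real.pi ^ 2) (by have := Real.pi_pos; positivity)
  exact Real.tendsto_exp_neg_atTop_nhds_zero.comp h1

theorem isEquivalent_correction :
    (fun t : ℝ => Zo t - ((Real.pi : ℂ) ^ 2 / (4 * (t : ℂ) ^ 2) - 1 / (2 * (t : ℂ))))
      ~[𝓝[>] (0 : ℝ)] fun t : ℝ =>
        2 * (Real.pi : ℂ) ^ 2 / (t : ℂ) ^ 2 * Complex.exp (-(2 * (Real.pi : ℂ) ^ 2 / t)) := by
  have h1 := tendsto_correction_series.comp tendsto_exp_neg_div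
  refine isEquivalent_iff_exists_eq_mul.2 ⟨_, h1, ?_⟩
  filter_upwards [self_mem_nhdsWithin] with t (ht : 0 < t)
  have hz : 0 < (t : ℂ).re := by simpa using ht
  have h2 : (∑' N : ℕ+, (correctionCoeff N : ℂ) *
      Complex.exp (-(2 * (Real.pi : ℂ) ^ 2 * N / t))) =
      Complex.exp (-(2 * (Real.pi : ℂ) ^ 2 / t)) * ∑' N : ℕ+, (correctionCoeff N : ℂ) *
        ((Real.exp (-(2 * Real.pi ^ 2 / t)) : ℝ) : ℂ) ^ ((N : ℕ) - 1) := by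
    rw [← tsum_mul_left]
    refine tsum_congr fun N => ?_
    obtain ⟨n, hn⟩ := Nat.exists_eq_succ_of_ne_zero N.ne_zero
    have h3 : ((Real.exp (-(2 * Real.pi ^ 2 / t)) : ℝ) : ℂ) =
      Complex.exp (-(2 * (Real.pi : ℂ) ^ 2 / t)) := by push_cast; rfl
    rw [h3, hn, Nat.succ_eq_add_one, Nat.add_sub_cancel, mul_left_comm, ← pow_succ',
      ← Complex.exp_nat_mul]
    congr 2
    push_cast
    ring
  simp only [Pi.mul_apply, Function.comp_apply]
  rw [Zo_eq_correction hz, h2]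
  ring

/-! ### Closed geodesics -/

/-- Equality in the nilmanifold, in coordinates. -/
theorem proj_eq_iff {p q : Heis} : proj p = proj q ↔ ∃ a b c : ℤ, p.x = q.x + √(2 * Real.pi) * a ∧
    p.y = q.y + √(2 * Real.pi) * b ∧ p.z = q.z + 2 * Real.pi * c - √(2 * Real.pi) * a * q.y := by
  have h1 : proj p = proj q ↔ p * q⁻¹ ∈ lattice := by
    rw [eq_comm]
    exact Quotient.eq.trans QuotientGroup.rightRel_apply
  rw [h1]
  constructor
  · rintro ⟨⟨a, ha⟩, ⟨b, hb⟩, ⟨c, hc⟩⟩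
    simp only [mul_def, inv_def] at ha hb hc
    refine ⟨a, b, c, by linarith, by linarith, ?_⟩
    rw [← ha]
    linarith
  · rintro ⟨a, b, c, ha, hb, hc⟩
    refine ⟨⟨a, ?_⟩, ⟨b, ?_⟩, ⟨c, ?_⟩⟩
    · simp only [mul_def, inv_def, ha]
      ring
    · simp only [mul_def, inv_def, hb]
      ring
    · simp only [mul_def, inv_def, hc, ha]
      ring

theorem exists_pnat_cast_eq {n : ℤ} (hn : 0 < (n : ℝ)) : ∃ l : ℕ+, ((l : ℕ) : ℝ) = n := by
  have hn' : 0 < n := by exact_mod_cast hn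
  lift n to ℕ using hn'.le
  exact ⟨⟨n, by exact_mod_cast hn'⟩, rfl⟩

theorem hamiltonian_eq (q : Heis) (ξ : Vec) :
    hamiltonian q ξ = (ξ.1 ^ 2 + (ξ.2.1 - q.x * ξ.2.2) ^ 2) / 2 := by
  simp only [hamiltonian, cometric, pairing]
  ring

/-- Hamilton's equations, in terms of the velocity `(u, v) = (ξ(X), ξ(Y))`. -/
theorem isUnitGeodesic_iff (q : ℝ → Heis) (ξ : ℝ → Vec) : IsUnitGeodesic q ξ ↔
    (∀ t, (ξ t).1 ^ 2 + ((ξ t).2.1 - (q t).x * (ξ t).2.2) ^ 2 = 1) ∧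
    (∀ t, HasDerivAt (fun s => (q s).x) (ξ t).1 t) ∧
    (∀ t, HasDerivAt (fun s => (q s).y) ((ξ t).2.1 - (q t).x * (ξ t).2.2) t) ∧
    (∀ t, HasDerivAt (fun s => (q s).z) (-(q t).x * ((ξ t).2.1 - (q t).x * (ξ t).2.2)) t) ∧
    (∀ t, HasDerivAt (fun s => (ξ s).1) ((ξ t).2.2 * ((ξ t).2.1 - (q t).x * (ξ t).2.2)) t) ∧
    (∀ t, HasDerivAt (fun s => (ξ s).2.1) 0 t) ∧ ∀ t, HasDerivAt (fun s => (ξ s).2.2) 0 t := by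
  have h0 : ∀ t, cometric (q t) (ξ t) =
      (ξ t).1 ^ 2 + ((ξ t).2.1 - (q t).x * (ξ t).2.2) ^ 2 := fun t => by
    have := hamiltonian_eq (q t) (ξ t)
    rw [hamiltonian] at this
    linarith
  have h1 : ∀ t, deriv (fun u => hamiltonian (q t) (u, (ξ t).2.1, (ξ t).2.2)) (ξ t).1 =
      (ξ t).1 := fun t => by
    simp only [hamiltonian_eq]
    refine HasDerivAt.deriv ?_
    exact ((((hasDerivAt_id (ξ t).1).pow 2).add_const _).div_const 2).congr_deriv
      (by simp)
  have h2 : ∀ t, deriv (fun u => hamiltonian (q t) ((ξ t).1, u, (ξ t).2.2)) (ξ t).2.1 =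
      (ξ t).2.1 - (q t).x * (ξ t).2.2 := fun t => by
    simp only [hamiltonian_eq]
    refine HasDerivAt.deriv ?_
    exact (((((hasDerivAt_id (ξ t).2.1).sub_const _).pow 2).const_add _).div_const 2).congr_deriv
      (by simp)
  have h3 : ∀ t, deriv (fun u => hamiltonian (q t) ((ξ t).1, (ξ t).2.1, u)) (ξ t).2.2 =
      -(q t).x * ((ξ t).2.1 - (q t).x * (ξ t).2.2) := fun t => by
    simp only [hamiltonian_eq]
    refine HasDerivAt.deriv ?_
    exact ((((((hasDerivAt_id (ξ t).2.2).const_mul _).const_sub _).pow 2).const_add _).div_const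
      2).congr_deriv (by simp; ring)
  have h4 : ∀ t, -deriv (fun u => hamiltonian ⟨u, (q t).y, (q t).z⟩ (ξ t)) (q t).x =
      (ξ t).2.2 * ((ξ t).2.1 - (q t).x * (ξ t).2.2) := fun t => by
    simp only [hamiltonian_eq]
    rw [neg_eq_iff_eq_neg]
    refine HasDerivAt.deriv ?_
    exact ((((((hasDerivAt_id (q t).x).mul_const _).const_sub _).pow 2).const_add _).div_const
      2).congr_deriv (by simp; ring)
  have h5 : ∀ t, -deriv (fun u => hamiltonian ⟨(q t).x, u, (q t).z⟩ (ξ t)) (q t).y = 0 :=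
    fun t => by simp [hamiltonian_eq]
  have h6 : ∀ t, -deriv (fun u => hamiltonian ⟨(q t).x, (q t).y, u⟩ (ξ t)) (q t).z = 0 :=
    fun t => by simp [hamiltonian_eq]
  constructor
  · intro h
    exact ⟨fun t => h0 t ▸ h.unit t, fun t => h1 t ▸ h.dx t, fun t => h2 t ▸ h.dy t,
      fun t => h3 t ▸ h.dz t, fun t => h4 t ▸ h.dξx t, fun t => h5 t ▸ h.dξy t,
      fun t => h6 t ▸ h.dξz t⟩
  · rintro ⟨g0, g1, g2, g3, g4, g5, g6⟩
    exact ⟨fun t => (h0 t).trans (g0 t), fun t => (h1 t).symm ▸ g1 t, fun t => (h2 t).symm ▸ g2 t,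
      fun t => (h3 t).symm ▸ g3 t, fun t => (h4 t).symm ▸ g4 t, fun t => (h5 t).symm ▸ g5 t,
      fun t => (h6 t).symm ▸ g6 t⟩

theorem eq_of_hasDerivAt_zero {f : ℝ → ℝ} (hf : ∀ t, HasDerivAt f 0 t) (s t : ℝ) : f s = f t :=
  is_const_of_deriv_eq_zero (fun t => (hf t).differentiableAt) (fun t => (hf t).deriv) s t

/-- A continuous function with values in a lattice `rℤ` which is negated by a translation
vanishes. -/
theorem eq_zero_of_mem_lattice {g : ℝ → ℝ} {r c : ℝ} (hr : r ≠ 0) (hg : Continuous g)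
    (hgr : ∀ t, ∃ a : ℤ, g t = r * a) (hneg : ∀ t, g (t + c) = -g t) (t : ℝ) : g t = 0 := by
  choose a ha using hgr
  have h1 : Continuous a := by
    rw [Int.isClosedEmbedding_coe_real.isEmbedding.isInducing.continuous_iff]
    have h2 : ((↑) : ℤ → ℝ) ∘ a = fun t => g t / r := by
      funext t
      simp only [Function.comp_apply, ha t]
      field_simp
    rw [h2]
    exact hg.div_const r
  have h3 : a (t + c) = a t := PreconnectedSpace.constant inferInstance h1
  have h4 := hneg t
  rw [ha, h3, ← ha] at h4
  linarith

/-- With `w` the vertical momentum and `(u, v)` the velocity, the projection to the `(x, y)`-plane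
is a circle traversed at frequency `w`. A closed geodesic closes up there already, so that
`w L ∈ 2πℤ`; and the height gained is then `L / (2w)`, which has to lie in `2πℤ`. -/
theorem exists_length_eq {q : ℝ → Heis} {ξ : ℝ → Vec} {L : ℝ} (hL : 0 < L)
    (hq : IsUnitGeodesic q ξ) (hξ : ∀ t, pairing (ξ t) (0, 0, 1) ≠ 0)
    (hc : ∀ t, proj (q (t + L)) = proj (q t)) :
    ∃ l : ℕ+, L = 2 * Real.pi * √(2 * (l : ℝ)) := by
  obtain ⟨g0, g1, g2, g3, g4, g5, g6⟩ := (isUnitGeodesic_iff q ξ).1 hq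
  obtain ⟨w, hw⟩ : ∃ w, ∀ t, (ξ t).2.2 = w := ⟨_, fun t => eq_of_hasDerivAt_zero g6 t 0⟩
  obtain ⟨b, hb⟩ : ∃ b, ∀ t, (ξ t).2.1 = b := ⟨_, fun t => eq_of_hasDerivAt_zero g5 t 0⟩
  have hw0 : w ≠ 0 := by
    have := hξ 0
    simpa [pairing, hw] using this
  set u : ℝ → ℝ := fun t => (ξ t).1
  set v : ℝ → ℝ := fun t => b - (q t).x * w with hv
  simp only [hw, hb] at g0 g1 g2 g3 g4
  have hu' : ∀ t, HasDerivAt u (w * v t) t := g4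
  have hv' : ∀ t, HasDerivAt v (-w * u t) t := fun t =>
    (((g1 t).mul_const w).const_sub b).congr_deriv (by simp only [u]; ring)
  have hx : ∀ t, (q t).x = (b - v t) / w := fun t => by
    simp only [hv]
    field_simp
    ring
  have hcos : ∀ t, HasDerivAt (fun s => Real.cos (w * s)) (-w * Real.sin (w * t)) t := fun t =>
    (((hasDerivAt_id t).const_mul w).cos).congr_deriv (by simp; ring)
  have hsin : ∀ t, HasDerivAt (fun s => Real.sin (w * s)) (w * Real.cos (w * t)) t := fun t =>
    (((hasDerivAt_id t).const_mul w).sin).congr_deriv (by simp; ring)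
  have hc1 : ∀ t, u t * Real.cos (w * t) - v t * Real.sin (w * t) = u 0 := fun t => by
    have := eq_of_hasDerivAt_zero (fun t => (((hu' t).mul (hcos t)).sub
      ((hv' t).mul (hsin t))).congr_deriv (by ring)) t 0
    simpa using this
  have hc2 : ∀ t, u t * Real.sin (w * t) + v t * Real.cos (w * t) = v 0 := fun t => by
    have := eq_of_hasDerivAt_zero (fun t => (((hu' t).mul (hsin t)).add
      ((hv' t).mul (hcos t))).congr_deriv (by ring)) t 0
    simpa using this
  have hvt : ∀ t, v t = v 0 * Real.cos (w * t) - u 0 * Real.sin (w * t) := fun t => by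
    linear_combination Real.cos (w * t) * hc2 t - Real.sin (w * t) * hc1 t -
      v t * Real.sin_sq_add_cos_sq (w * t)
  have hut : ∀ t, u t = u 0 * Real.cos (w * t) + v 0 * Real.sin (w * t) := fun t => by
    linear_combination Real.sin (w * t) * hc2 t + Real.cos (w * t) * hc1 t -
      u t * Real.sin_sq_add_cos_sq (w * t)
  have hvneg : ∀ t, v (t + Real.pi / w) = -v t := fun t => by
    have h1 : w * (t + Real.pi / w) = w * t + Real.pi := by field_simp
    rw [hvt, hvt t, h1, Real.cos_add_pi, Real.sin_add_pi]
    ring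
  have hvc : Continuous v := continuous_iff_continuousAt.2 fun t => (hv' t).continuousAt
  -- `v` is a sinusoid and `x (t + L) - x t`, which lies in `√(2π)ℤ`, is a multiple
  -- of `v (t + L) - v t`
  have hper : ∀ t, v (t + L) - v t = 0 := by
    refine eq_zero_of_mem_lattice (r := -(√(2 * Real.pi) * w)) (c := Real.pi / w)
      (neg_ne_zero.2 (mul_ne_zero (Real.sqrt_ne_zero'.2 (by positivity)) hw0)) (by fun_prop)
      (fun t => ?_) (fun t => ?_)
    · obtain ⟨a, -, -, ha, -, -⟩ := proj_eq_iff.1 (hc t)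
      refine ⟨a, ?_⟩
      simp only [hv, ha]
      ring
    · rw [add_right_comm, hvneg, hvneg]
      ring
  have hC : Real.cos (w * L) = 1 := by
    have e1 := hper 0
    have e2 := hper (Real.pi / 2 / w)
    have e3 : w * (Real.pi / 2 / w + L) = w * L + Real.pi / 2 := by field_simp; ring
    have e4 : w * (Real.pi / 2 / w) = Real.pi / 2 := by field_simp
    rw [zero_add, hvt] at e1
    rw [hvt, hvt (_ / w), e3, e4, Real.cos_add_pi_div_two, Real.sin_add_pi_div_two,
      Real.cos_pi_div_two, Real.sin_pi_div_two] at e2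
    have e5 : u 0 ^ 2 + v 0 ^ 2 = 1 := g0 0
    linear_combination v 0 * e1 - u 0 * e2 + (1 - Real.cos (w * L)) * e5
  obtain ⟨j, hj⟩ := (Real.cos_eq_one_iff _).1 hC
  have hS : Real.sin (w * L) = 0 := by
    rw [← hj]
    have h1 := Real.sin_int_mul_pi (2 * j)
    push_cast at h1
    rwa [mul_comm (2 : ℝ), mul_assoc] at h1
  -- the height in terms of the velocity, up to a constant
  have hz : ∀ t, HasDerivAt (fun t => (q t).z + b * u t / w ^ 2 - t / (2 * w) -
      u t * v t / (2 * w ^ 2)) 0 t := fun t => by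
    refine (((((g3 t).add (((hu' t).const_mul b).div_const (w ^ 2))).sub
      ((hasDerivAt_id t).div_const (2 * w))).sub
      (((hu' t).mul (hv' t)).div_const (2 * w ^ 2)))).congr_deriv ?_
    have e5 : u t ^ 2 + v t ^ 2 = 1 := g0 t
    have e6 : b - (q t).x * w = v t := rfl
    rw [e6, hx]
    field_simp
    linear_combination e5
  have hzL := eq_of_hasDerivAt_zero hz (0 + L) 0
  obtain ⟨a, -, c, ha, -, hc3⟩ := proj_eq_iff.1 (hc 0)
  have hvL : v (0 + L) = v 0 := sub_eq_zero.1 (hper 0)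
  have huL : u (0 + L) = u 0 := by
    rw [hut, zero_add, hC, hS]
    ring
  have ha0 : √(2 * Real.pi) * (a : ℝ) = 0 := by
    have := hx (0 + L)
    rw [hvL, ← hx] at this
    linarith
  rw [hvL, huL, hc3, ha0] at hzL
  have hLw : L = 4 * Real.pi * c * w := by
    have e7 : L / (2 * w) = 2 * Real.pi * c := by
      rw [zero_add, zero_div] at hzL
      linarith
    field_simp at e7
    linarith
  have hπ := Real.pi_pos
  have hL2 : L ^ 2 = 8 * Real.pi ^ 2 * ((j * c : ℤ) : ℝ) := by
    push_cast
    linear_combination L * hLw - 4 * Real.pi * c * hj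
  have hjc : 0 < ((j * c : ℤ) : ℝ) :=
    (mul_pos_iff_of_pos_left (by positivity)).1 (hL2 ▸ by positivity : 0 < 8 * Real.pi ^ 2 * _)
  obtain ⟨l, hl⟩ := exists_pnat_cast_eq hjc
  refine ⟨l, ?_⟩
  refine (pow_left_inj₀ hL.le (by positivity) two_ne_zero).1 ?_
  rw [mul_pow, Real.sq_sqrt (by positivity), hL2, hl]
  ring

/-- A helix over a circle of radius `√(2l)`, which rises by `2πl` during one revolution. -/
theorem length_mem_nonTorusLengths (l : ℕ+) :
    2 * Real.pi * √(2 * (l : ℝ)) ∈ nonTorusLengths := by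
  have hπ := Real.pi_pos
  have hl : (0 : ℝ) < l := by exact_mod_cast l.pos
  set r : ℝ := √(2 * (l : ℝ)) with hr
  have hr0 : 0 < r := Real.sqrt_pos.2 (by positivity)
  have hr2 : r ^ 2 = 2 * l := Real.sq_sqrt (by positivity)
  have hcos : ∀ t, HasDerivAt (fun s => Real.cos (s / r)) (-Real.sin (t / r) / r) t := fun t =>
    (((hasDerivAt_id t).div_const r).cos).congr_deriv (by simp; ring)
  have hsin : ∀ t, HasDerivAt (fun s => Real.sin (s / r)) (Real.cos (t / r) / r) t := fun t =>
    (((hasDerivAt_id t).div_const r).sin).congr_deriv (by simp; ring)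
  refine ⟨by positivity, fun t => ⟨r * Real.sin (t / r), r * Real.cos (t / r),
    r * t / 2 - r ^ 2 * (Real.sin (t / r) * Real.cos (t / r)) / 2⟩,
    fun t => (Real.cos (t / r), 0, 1 / r), ?_, ?_, ?_⟩
  · refine (isUnitGeodesic_iff _ _).2 ⟨fun t => ?_, fun t => ?_, fun t => ?_, fun t => ?_,
      fun t => ?_, fun t => hasDerivAt_const _ _, fun t => hasDerivAt_const _ _⟩
    · have := Real.sin_sq_add_cos_sq (t / r)
      field_simp
      linarith
    · exact ((hsin t).const_mul r).congr_deriv (by field_simp)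
    · exact ((hcos t).const_mul r).congr_deriv (by field_simp; ring)
    · refine ((((hasDerivAt_id t).const_mul r).div_const 2).sub
        ((((hsin t).mul (hcos t)).const_mul (r ^ 2)).div_const 2)).congr_deriv ?_
      have := Real.sin_sq_add_cos_sq (t / r)
      field_simp
      linear_combination (-1 : ℝ) * this
    · exact (hcos t).congr_deriv (by field_simp; ring)
  · intro t
    simp [pairing, hr0.ne']
  · intro t
    refine proj_eq_iff.2 ⟨0, 0, l, ?_⟩
    have h1 : (t + 2 * Real.pi * r) / r = t / r + 2 * Real.pi := by field_simp
    simp only [h1, Real.sin_add_two_pi, Real.cos_add_two_pi]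
    refine ⟨by simp, by simp, ?_⟩
    push_cast
    linear_combination Real.pi * hr2

theorem nonTorusLengths_eq :
    nonTorusLengths = {L | ∃ l : ℕ+, L = 2 * Real.pi * √(2 * (l : ℝ))} := by
  ext L
  constructor
  · rintro ⟨hL, q, ξ, hq, hξ, hc⟩
    exact exists_length_eq hL hq hξ hc
  · rintro ⟨l, rfl⟩
    exact length_mem_nonTorusLengths l

/-- All coefficients are nonzero, and `L = 2π√(2l)` has `L² / 4 = 2π² l`. -/
theorem exponents_eq : {E : ℝ | ∃ N : ℕ+, correctionCoeff N ≠ 0 ∧ E = 2 * Real.pi ^ 2 * N} =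
    {E : ℝ | ∃ L ∈ nonTorusLengths, E = L ^ 2 / 4} := by
  have h : ∀ l : ℕ+, (2 * Real.pi * √(2 * (l : ℝ))) ^ 2 / 4 = 2 * Real.pi ^ 2 * l := fun l => by
    rw [mul_pow, Real.sq_sqrt (by positivity)]
    ring
  rw [nonTorusLengths_eq]
  ext E
  constructor
  · rintro ⟨N, -, rfl⟩
    exact ⟨_, ⟨N, rfl⟩, (h N).symm⟩
  · rintro ⟨_, ⟨l, rfl⟩, rfl⟩
    exact ⟨l, correctionCoeff_ne_zero l, h l⟩

/-! ### The Reeb flow -/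

theorem dContactForm_eq (p : Heis) (v w : Vec) :
    dContactForm p v w = v.1 * w.2.1 - w.1 * v.2.1 := by
  have h : ∀ v w : Vec, deriv (fun t : ℝ => contactForm
      ⟨p.x + t * v.1, p.y + t * v.2.1, p.z + t * v.2.2⟩ w) 0 = v.1 * w.2.1 := fun v w => by
    refine HasDerivAt.deriv ?_
    exact (((((hasDerivAt_id (0 : ℝ)).mul_const v.1).const_add p.x).mul_const w.2.1).const_add
      w.2.2).congr_deriv (by simp)
  rw [dContactForm, h, h]

theorem isReebVector_iff (p : Heis) (v : Vec) : IsReebVector p v ↔ v = (0, 0, 1) := by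
  simp only [IsReebVector, dContactForm_eq, contactForm]
  constructor
  · rintro ⟨h1, h2⟩
    have h3 := h2 (0, 1, 0)
    have h4 := h2 (1, 0, 0)
    simp only [mul_one, mul_zero, zero_mul, one_mul, sub_zero, zero_sub, neg_eq_zero] at h3 h4
    rw [h4, mul_zero, add_zero] at h1
    exact Prod.ext h3 (Prod.ext h4 h1)
  · rintro rfl
    simp

theorem reebPeriods_eq {s : ℝ} (hs : 0 < s) :
    reebPeriods s = {τ | ∃ l : ℕ+, τ = 2 * Real.pi * l / s} := by
  have hπ := Real.pi_pos
  ext τ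
  constructor
  · rintro ⟨hτ, c, hc, hp⟩
    have hz : ∀ t, HasDerivAt (fun u => (c u).z - s * u) 0 t := fun t => by
      obtain ⟨v, hv, -, -, h3⟩ := hc t
      rw [(isReebVector_iff _ _).1 hv] at h3
      exact (h3.sub ((hasDerivAt_id t).const_mul s)).congr_deriv (by simp)
    have hx : ∀ t, HasDerivAt (fun u => (c u).x) 0 t := fun t => by
      obtain ⟨v, hv, h1, -, -⟩ := hc t
      rw [(isReebVector_iff _ _).1 hv] at h1
      exact h1.congr_deriv (by simp)
    obtain ⟨a, -, n, ha, -, hn⟩ := proj_eq_iff.1 (hp 0)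
    have h1 := eq_of_hasDerivAt_zero hx (0 + τ) 0
    have h2 := eq_of_hasDerivAt_zero hz (0 + τ) 0
    have ha0 : √(2 * Real.pi) * (a : ℝ) = 0 := by linarith
    rw [hn, ha0] at h2
    have h3 : s * τ = 2 * Real.pi * n := by linarith
    have hn0 : 0 < (n : ℝ) :=
      (mul_pos_iff_of_pos_left (by positivity)).1 (h3 ▸ by positivity : 0 < 2 * Real.pi * _)
    obtain ⟨l, hl⟩ := exists_pnat_cast_eq hn0
    refine ⟨l, ?_⟩
    rw [hl, ← h3]
    field_simp
  · rintro ⟨l, rfl⟩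
    have hl : (0 : ℝ) < l := by exact_mod_cast l.pos
    refine ⟨by positivity, fun t => ⟨0, 0, s * t⟩, fun t => ⟨_, (isReebVector_iff _ _).2 rfl, ?_,
      ?_, ?_⟩, fun t => proj_eq_iff.2 ⟨0, 0, l, by simp, by simp, ?_⟩⟩
    · exact (hasDerivAt_const t (0 : ℝ)).congr_deriv (by simp)
    · exact (hasDerivAt_const t (0 : ℝ)).congr_deriv (by simp)
    · exact ((hasDerivAt_id t).const_mul s).congr_deriv (by simp)
    · push_cast
      field_simp
      ring

/-! ### Boundary behaviour of the heat trace -/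

/-- Summing the double series over the multiplicities first. -/
theorem hasSum_Zo_odd {z : ℂ} (hz : 0 < z.re) :
    HasSum (fun n : ℕ => 2 * (Complex.exp (-((2 * n + 1) * z)) /
      (1 - Complex.exp (-((2 * n + 1) * z))) ^ 2)) (Zo z) := by
  have h1 := ((Equiv.prodComm ℕ ℕ+).hasSum_iff.2 (summable_landau hz).hasSum)
  rw [Zo_eq_tsum_prod hz]
  refine h1.prod_fiberwise fun n => ?_
  have hr : ‖Complex.exp (-((2 * (n : ℂ) + 1) * z))‖ < 1 := by
    have h2 : ((2 * (n : ℂ) + 1) * z).re = (2 * n + 1) * z.re := by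
      have : (2 * (n : ℂ) + 1) = ((2 * n + 1 : ℝ) : ℂ) := by push_cast; rfl
      rw [this, Complex.re_ofReal_mul]
    rw [Complex.norm_exp, Real.exp_lt_one_iff, Complex.neg_re, h2, neg_lt_zero]
    positivity
  have h3 := (hasSum_coe_mul_geometric_of_norm_lt_one hr).mul_left 2
  refine ((PNat.coe_injective.hasSum_iff (fun m hm => ?_)).2 h3).congr_fun fun m => ?_
  · rcases m with _ | m
    · simp
    · exact absurd ⟨⟨m + 1, m.succ_pos⟩, rfl⟩ hm
  · simp only [Function.comp_apply, Equiv.prodComm_apply, Prod.swap_prod_mk]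
    rw [← Complex.exp_nat_mul, mul_assoc]
    congr 3
    ring

/-- The terms are `1 / (2 sinh² (w / 2))`, and `r ≤ 2 sinh (r / 2)` for `r ≥ 0`. -/
theorem norm_exp_div_sq_le {w : ℂ} (hw : 0 < w.re) :
    ‖2 * (Complex.exp (-w) / (1 - Complex.exp (-w)) ^ 2)‖ ≤ 2 / w.re ^ 2 := by
  set r := w.re
  have h1 : 1 - Real.exp (-r) ≤ ‖1 - Complex.exp (-w)‖ := by
    have := norm_sub_norm_le (1 : ℂ) (Complex.exp (-w))
    rwa [norm_one, Complex.norm_exp, Complex.neg_re] at this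
  have h2 : 0 < 1 - Real.exp (-r) := by
    have := Real.exp_lt_one_iff.2 (neg_lt_zero.2 hw)
    linarith
  have h3 : r * Real.exp (-(r / 2)) ≤ 1 - Real.exp (-r) := by
    have h4 := Real.self_le_sinh_iff.2 (half_pos hw).le
    rw [Real.sinh_eq] at h4
    have h5 : Real.exp (r / 2) * Real.exp (-(r / 2)) = 1 := by rw [← Real.exp_add]; simp
    have h6 : Real.exp (-(r / 2)) * Real.exp (-(r / 2)) = Real.exp (-r) := by
      rw [← Real.exp_add]
      ring_nf
    have h7 := mul_le_mul_of_nonneg_right h4 (Real.exp_pos (-(r / 2))).le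
    linarith
  rw [norm_mul, norm_div, norm_pow, Complex.norm_exp, Complex.neg_re, Complex.norm_ofNat]
  have h8 : Real.exp (-r) = Real.exp (-(r / 2)) ^ 2 := by
    rw [← Real.exp_nat_mul]
    ring_nf
  calc 2 * (Real.exp (-r) / ‖1 - Complex.exp (-w)‖ ^ 2)
      ≤ 2 * (Real.exp (-r) / (r * Real.exp (-(r / 2))) ^ 2) := by
        have : 0 < r * Real.exp (-(r / 2)) := by positivity
        gcongr
        exact h3.trans h1
    _ = 2 / r ^ 2 := by
        rw [h8]
        have := Real.exp_ne_zero (-(r / 2))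
        field_simp

/-- At a fixed boundary point only the terms with a double pole there survive. -/
theorem tendsto_sq_mul_term (a θ : ℝ) (ha : 0 < a) :
    Tendsto (fun ε : ℝ => (ε : ℂ) ^ 2 * (2 * (Complex.exp (-(a * (ε + Complex.I * θ))) /
      (1 - Complex.exp (-(a * (ε + Complex.I * θ)))) ^ 2))) (𝓝[>] 0)
      (𝓝 (if Complex.exp (-(a * (Complex.I * θ))) = 1 then 2 / (a : ℂ) ^ 2 else 0)) := by
  have hc : ∀ ε : ℝ, Complex.exp (-(a * (ε + Complex.I * θ))) =
      Complex.exp (-(a * ε)) * Complex.exp (-(a * (Complex.I * θ))) := fun ε => by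
    rw [← Complex.exp_add]
    ring_nf
  have hexp : Tendsto (fun ε : ℝ => Complex.exp (-(a * ε))) (𝓝[>] 0) (𝓝 1) := by
    have h1 : Continuous fun ε : ℝ => Complex.exp (-(a * ε)) := by fun_prop
    have h2 := h1.tendsto 0
    simp only [Complex.ofReal_zero, mul_zero, neg_zero, Complex.exp_zero] at h2
    exact h2.mono_left nhdsWithin_le_nhds
  simp only [hc]
  split_ifs with h
  · simp only [h, mul_one]
    have h1 : HasDerivAt (fun ε : ℝ => Complex.exp (-(a * ε))) (-(a : ℂ)) 0 := by
      have h2 : HasDerivAt (fun ε : ℝ => -((a : ℂ) * (ε : ℂ))) (-(a : ℂ)) 0 :=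
        (((hasDerivAt_id (0 : ℝ)).ofReal_comp.const_mul (a : ℂ)).neg).congr_deriv (by simp)
      exact h2.cexp.congr_deriv (by simp)
    have h2 := h1.tendsto_slope_zero_right
    have ha' : (a : ℂ) ≠ 0 := by exact_mod_cast ha.ne'
    have h3 := (hexp.div (h2.pow 2) (pow_ne_zero 2 (neg_ne_zero.2 ha'))).const_mul 2
    have h4 : (2 : ℂ) * (1 / (-(a : ℂ)) ^ 2) = 2 / (a : ℂ) ^ 2 := by
      rw [neg_sq]
      ring
    rw [h4] at h3
    refine h3.congr' ?_
    filter_upwards [self_mem_nhdsWithin] with ε (hε : 0 < ε)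
    have hε' : (ε : ℂ) ≠ 0 := by exact_mod_cast hε.ne'
    simp only [Pi.div_apply, zero_add, Complex.ofReal_zero, mul_zero, neg_zero, Complex.exp_zero,
      Complex.real_smul, Complex.ofReal_inv]
    rw [mul_pow, ← neg_sub, neg_sq, inv_pow, div_mul_eq_div_div, div_inv_eq_mul]
    ring
  · have h1 : 1 - 1 * Complex.exp (-(a * (Complex.I * θ))) ≠ 0 := by
      rw [one_mul]
      exact sub_ne_zero.2 fun h' => h h'.symm
    have h2 : Tendsto (fun ε : ℝ => (ε : ℂ) ^ 2) (𝓝[>] 0) (𝓝 0) := by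
      have h3 : Continuous fun ε : ℝ => (ε : ℂ) ^ 2 := by fun_prop
      have h4 := h3.tendsto 0
      simp only [Complex.ofReal_zero, ne_eq, OfNat.ofNat_ne_zero, not_false_eq_true, zero_pow]
        at h4
      exact h4.mono_left nhdsWithin_le_nhds
    have h3 := hexp.mul_const (Complex.exp (-(a * (Complex.I * θ))))
    have h5 := h2.mul ((h3.div ((h3.const_sub 1).pow 2) (pow_ne_zero 2 h1)).const_mul 2)
    rw [zero_mul] at h5
    exact h5

/-- The terms of `ε² Zo` are dominated by `2 / (2n + 1)²`, so the limit is taken termwise. -/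
theorem tendsto_sq_mul_Zo (θ : ℝ) :
    Tendsto (fun ε : ℝ => (ε : ℂ) ^ 2 * Zo (ε + Complex.I * θ)) (𝓝[>] 0)
      (𝓝 (∑' n : ℕ, if Complex.exp (-((2 * n + 1) * (Complex.I * θ))) = 1 then
        2 / (2 * (n : ℂ) + 1) ^ 2 else 0)) := by
  have h1 : Tendsto (fun ε : ℝ => ∑' n : ℕ, (ε : ℂ) ^ 2 *
      (2 * (Complex.exp (-((2 * n + 1) * (ε + Complex.I * θ))) /
        (1 - Complex.exp (-((2 * n + 1) * (ε + Complex.I * θ)))) ^ 2))) (𝓝[>] 0)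
      (𝓝 (∑' n : ℕ, if Complex.exp (-((2 * n + 1) * (Complex.I * θ))) = 1 then
        2 / (2 * (n : ℂ) + 1) ^ 2 else 0)) := by
    refine tendsto_tsum_of_dominated_convergence (summable_odd_one_div_sq.mul_left 2)
      (fun n => ?_) ?_
    · have h2 := tendsto_sq_mul_term (2 * n + 1) θ (by positivity)
      push_cast at h2
      exact h2
    · filter_upwards [self_mem_nhdsWithin] with ε (hε : 0 < ε) n
      have h3 : ((2 * (n : ℂ) + 1) * (ε + Complex.I * θ)).re = (2 * n + 1) * ε := by
        have : (2 * (n : ℂ) + 1) = ((2 * n + 1 : ℝ) : ℂ) := by push_cast; rfl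
        rw [this, Complex.re_ofReal_mul]
        simp
      have h4 := norm_exp_div_sq_le (w := (2 * (n : ℂ) + 1) * (ε + Complex.I * θ))
        (by rw [h3]; positivity)
      rw [h3] at h4
      rw [norm_mul, norm_pow, Complex.norm_of_nonneg hε.le]
      calc _ ≤ ε ^ 2 * (2 / ((2 * n + 1) * ε) ^ 2) := by gcongr
        _ = 2 * (1 / (2 * n + 1) ^ 2) := by field_simp
  refine h1.congr' ?_
  filter_upwards [self_mem_nhdsWithin] with ε (hε : 0 < ε)
  rw [tsum_mul_left, (hasSum_Zo_odd (z := ε + Complex.I * θ) (by simpa using hε)).tsum_eq]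

theorem hasSum_odd_one_div_sq :
    HasSum (fun n : ℕ => 1 / (2 * (n : ℝ) + 1) ^ 2) (Real.pi ^ 2 / 8) := by
  have h1 := hasSum_zeta_two
  have h2 : HasSum (fun n : ℕ => (1 : ℝ) / ((2 * n : ℕ) : ℝ) ^ 2) (Real.pi ^ 2 / 24) := by
    have h3 := h1.mul_left (1 / 4)
    have h4 : 1 / 4 * (Real.pi ^ 2 / 6) = Real.pi ^ 2 / 24 := by ring
    rw [h4] at h3
    refine h3.congr_fun fun n => ?_
    push_cast
    rw [mul_pow, one_div_mul_one_div]
    norm_num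
  have h5 := HasSum.even_add_odd (f := fun n : ℕ => (1 : ℝ) / (n : ℝ) ^ 2) h2
    (summable_odd_one_div_sq.congr fun n => by push_cast; rfl).hasSum
  have h6 := h5.unique h1
  have h7 : ∑' n : ℕ, 1 / (2 * (n : ℝ) + 1) ^ 2 = Real.pi ^ 2 / 8 := by
    push_cast at h6
    linarith
  exact h7 ▸ summable_odd_one_div_sq.hasSum

theorem exp_neg_odd_eq_one_iff (p : ℤ) (k n : ℕ) :
    Complex.exp (-((2 * n + 1) * (Complex.I * ((2 * Real.pi * p / (2 * k + 1) : ℝ) : ℂ)))) = 1 ↔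
      (2 * k + 1 : ℤ) ∣ (2 * n + 1) * p := by
  have hk : (2 * (k : ℂ) + 1) ≠ 0 := by exact_mod_cast Nat.succ_ne_zero (2 * k)
  rw [Complex.exp_eq_one_iff]
  constructor
  · rintro ⟨m, hm⟩
    refine ⟨-m, ?_⟩
    have h1 : 2 * Real.pi * Complex.I * ((2 * n + 1) * p : ℂ) =
        2 * Real.pi * Complex.I * ((2 * k + 1) * (-m)) := by
      push_cast at hm
      field_simp at hm
      linear_combination (-(2 * Real.pi * Complex.I)) * hm
    have h2 := mul_left_cancel₀ Complex.two_pi_I_ne_zero h1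
    exact_mod_cast h2
  · rintro ⟨m, hm⟩
    refine ⟨-m, ?_⟩
    have h2 : ((2 * n + 1) * p : ℂ) = (2 * k + 1) * m := by exact_mod_cast hm
    push_cast
    field_simp
    linear_combination (-1 : ℂ) * h2

/-- At `2πip/(2k+1)`, in lowest terms, the terms with a pole are those of the odd multiples
`(2k+1)(2j+1)` of `2k+1`. -/
theorem tendsto_sq_mul_Zo_of_isCoprime (p : ℤ) (k : ℕ) (h : IsCoprime p (2 * k + 1 : ℤ)) :
    Tendsto (fun ε : ℝ => (ε : ℂ) ^ 2 * Zo (ε + 2 * Real.pi * Complex.I * p / (2 * k + 1)))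
      (𝓝[>] 0) (𝓝 ((Real.pi : ℂ) ^ 2 / (4 * (2 * k + 1) ^ 2))) := by
  have h1 := tendsto_sq_mul_Zo (2 * Real.pi * p / (2 * k + 1))
  simp only [exp_neg_odd_eq_one_iff] at h1
  have hk : (2 * (k : ℂ) + 1) ≠ 0 := by exact_mod_cast Nat.succ_ne_zero (2 * k)
  have h2 : (∑' n : ℕ, if (2 * k + 1 : ℤ) ∣ (2 * n + 1) * p then 2 / (2 * (n : ℂ) + 1) ^ 2 else 0) =
      (Real.pi : ℂ) ^ 2 / (4 * (2 * k + 1) ^ 2) := by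
    have hinj : Function.Injective fun j : ℕ => (2 * k + 1) * j + k := fun a b hab =>
      Nat.eq_of_mul_eq_mul_left (by omega : 0 < 2 * k + 1) (Nat.add_right_cancel hab)
    rw [← hinj.tsum_eq]
    · have h3 : HasSum (fun j : ℕ => 1 / (2 * (j : ℂ) + 1) ^ 2) ((Real.pi : ℂ) ^ 2 / 8) := by
        have h4 := Complex.hasSum_ofReal.2 hasSum_odd_one_div_sq
        push_cast at h4
        exact h4
      have h5 := h3.mul_left (2 / (2 * (k : ℂ) + 1) ^ 2)
      have h6 : 2 / (2 * (k : ℂ) + 1) ^ 2 * ((Real.pi : ℂ) ^ 2 / 8) =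
          (Real.pi : ℂ) ^ 2 / (4 * (2 * k + 1) ^ 2) := by
        field_simp
        norm_num
      rw [← h6, ← h5.tsum_eq]
      refine tsum_congr fun j => ?_
      rw [if_pos ⟨(2 * j + 1) * p, by push_cast; ring⟩]
      have hj : (2 * (((2 * k + 1) * j + k : ℕ) : ℂ) + 1) = (2 * k + 1) * (2 * j + 1) := by
        push_cast
        ring
      rw [hj, mul_pow, div_mul_div_comm, mul_one]
    · intro n hn
      have h7 : (2 * k + 1 : ℤ) ∣ (2 * n + 1) * p := by
        by_contra h8
        exact hn (if_neg h8)
      obtain ⟨j, hj⟩ : (2 * k + 1) ∣ 2 * n + 1 := by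
        exact_mod_cast h.symm.dvd_of_dvd_mul_right h7
      obtain ⟨i, rfl | rfl⟩ := Nat.even_or_odd' j
      · have h9 : (2 * k + 1) * (2 * i) = 2 * ((2 * k + 1) * i) := by ring
        omega
      · exact ⟨i, by simp only; linarith⟩
  rw [h2] at h1
  refine h1.congr fun ε => ?_
  congr 3
  push_cast
  ring

theorem boundaryPoles_eq : boundaryPoles =
    {w : ℂ | ∃ (l : ℕ+) (k : ℤ), w = 2 * Real.pi * Complex.I * l / (2 * k + 1)} := by
  have hπ : (Real.pi : ℂ) ≠ 0 := by exact_mod_cast Real.pi_ne_zero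
  have hodd : ∀ k : ℤ, (2 * (k : ℂ) + 1) ≠ 0 := fun k => by
    have : (2 * k + 1 : ℤ) ≠ 0 := by omega
    exact_mod_cast this
  have hcosh : ∀ w : ℂ, 1 + Complex.cosh w = 0 ↔ ∃ k : ℤ, w * Complex.I = (2 * k + 1) * Real.pi := by
    intro w
    rw [one_add_cosh_eq, mul_eq_zero, or_iff_right (two_ne_zero' ℂ), sq_eq_zero_iff,
      ← Complex.cos_mul_I, Complex.cos_eq_zero_iff]
    refine exists_congr fun k => ?_
    constructor <;> intro h
    · linear_combination 2 * h
    · linear_combination h / 2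
  ext w
  constructor
  · rintro ⟨hw, l, hl⟩
    obtain ⟨k, hk⟩ := (hcosh _).1 hl
    refine ⟨l, k, ?_⟩
    have := hodd k
    field_simp at hk ⊢
    linear_combination (-1 : ℂ) * hk
  · rintro ⟨l, k, rfl⟩
    have hl : (l : ℂ) ≠ 0 := by exact_mod_cast l.ne_zero
    have h2 := hodd k
    have hI := Complex.I_ne_zero
    refine ⟨div_ne_zero (mul_ne_zero Complex.two_pi_I_ne_zero hl) h2, l, (hcosh _).2 ⟨k, ?_⟩⟩
    field_simp

/-- Off the poles every term stays bounded. -/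
theorem tendsto_sq_mul_Zo_of_notMem (θ : ℝ) (hθ : θ ≠ 0) (h : Complex.I * θ ∉ boundaryPoles) :
    Tendsto (fun ε : ℝ => (ε : ℂ) ^ 2 * Zo (ε + Complex.I * θ)) (𝓝[>] 0) (𝓝 0) := by
  have h1 := tendsto_sq_mul_Zo θ
  have h2 : ∀ n : ℕ, Complex.exp (-((2 * n + 1) * (Complex.I * θ))) ≠ 1 := by
    intro n hn
    obtain ⟨m, hm⟩ := Complex.exp_eq_one_iff.1 hn
    have hn0 : (2 * (n : ℂ) + 1) ≠ 0 := by exact_mod_cast Nat.succ_ne_zero (2 * n)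
    apply h
    rw [boundaryPoles_eq]
    rcases lt_trichotomy m 0 with h3 | rfl | h3
    · obtain ⟨l, rfl⟩ : ∃ l : ℕ+, m = -((l : ℕ) : ℤ) :=
        ⟨⟨(-m).toNat, by omega⟩, by simp only [PNat.mk_coe]; omega⟩
      refine ⟨l, n, ?_⟩
      push_cast at hm ⊢
      rw [eq_div_iff hn0]
      linear_combination (-1 : ℂ) * hm
    · simp [hn0, hθ] at hm
    · obtain ⟨l, rfl⟩ : ∃ l : ℕ+, m = ((l : ℕ) : ℤ) :=
        ⟨⟨m.toNat, by omega⟩, by simp only [PNat.mk_coe]; omega⟩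
      refine ⟨l, -n - 1, ?_⟩
      push_cast at hm ⊢
      have h4 : 2 * (-(n : ℂ) - 1) + 1 = -(2 * n + 1) := by ring
      rw [h4, eq_div_iff (neg_ne_zero.2 hn0)]
      linear_combination hm
  simpa only [if_neg (h2 _), tsum_zero] using h1

/-- The Weyl term is the singularity at the boundary point `0`. -/
theorem isEquivalent_Zo : (fun t : ℝ => Zo t) ~[𝓝[>] (0 : ℝ)]
    fun t : ℝ => (Real.pi : ℂ) ^ 2 / (4 * (t : ℂ) ^ 2) := by
  have h1 := (tendsto_sq_mul_Zo_of_isCoprime 0 0 (by simpa using isCoprime_one_right)).mul_const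
    (4 / (Real.pi : ℂ) ^ 2)
  have hπ : (Real.pi : ℂ) ≠ 0 := by exact_mod_cast Real.pi_ne_zero
  have h2 : (Real.pi : ℂ) ^ 2 / (4 * (2 * ((0 : ℕ) : ℂ) + 1) ^ 2) * (4 / (Real.pi : ℂ) ^ 2) = 1 := by
    simp [hπ]
  rw [h2] at h1
  refine isEquivalent_iff_exists_eq_mul.2 ⟨_, h1, ?_⟩
  filter_upwards [self_mem_nhdsWithin] with t (ht : 0 < t)
  have ht' : (t : ℂ) ≠ 0 := by exact_mod_cast ht.ne'
  simp only [Pi.mul_apply, Int.cast_zero, mul_zero, zero_div, add_zero]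
  field_simp

/-! ### Density of the boundary singularities -/

/-- The fractions `p / 3^N` in lowest terms are dense. -/
theorem exists_isCoprime_between {a b : ℝ} (hab : a < b) : ∃ (p : ℤ) (k : ℕ), p ≠ 0 ∧
    IsCoprime p (2 * k + 1 : ℤ) ∧ a < 2 * Real.pi * p / (2 * k + 1) ∧
      2 * Real.pi * p / (2 * k + 1) < b := by
  have hπ := Real.pi_pos
  -- at this mesh two consecutive numerators fit into the interval, and `3` divides at most
  -- one of them
  obtain ⟨N, hN⟩ := pow_unbounded_of_one_lt (4 * Real.pi / (b - a)) (by norm_num : (1 : ℝ) < 3)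
  obtain ⟨k, hk⟩ : Odd (3 ^ N) := Odd.pow (by decide)
  have hkR : (2 * (k : ℝ) + 1) = 3 ^ N := by exact_mod_cast hk.symm
  have hkZ : (2 * (k : ℤ) + 1) = 3 ^ N := by exact_mod_cast hk.symm
  have hQ : (0 : ℝ) < 3 ^ N := by positivity
  rw [div_lt_iff₀ (sub_pos.2 hab)] at hN
  set m := ⌊a * 3 ^ N / (2 * Real.pi)⌋
  have hm1 : a * 3 ^ N < 2 * Real.pi * (m + 1) := by
    have := Int.lt_floor_add_one (a * 3 ^ N / (2 * Real.pi))
    rw [div_lt_iff₀ (by positivity)] at this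
    linarith
  have hm2 : 2 * Real.pi * m ≤ a * 3 ^ N := by
    have := Int.floor_le (a * 3 ^ N / (2 * Real.pi))
    rw [le_div_iff₀ (by positivity)] at this
    linarith
  obtain ⟨p, hp, hp1, hp2⟩ : ∃ p : ℤ, ¬ (3 : ℤ) ∣ p ∧ m + 1 ≤ p ∧ p ≤ m + 2 := by
    by_cases h : (3 : ℤ) ∣ m + 1
    · exact ⟨m + 2, by omega, by omega, by omega⟩
    · exact ⟨m + 1, h, by omega, by omega⟩
  have hp1' : (m : ℝ) + 1 ≤ p := by exact_mod_cast hp1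
  have hp2' : (p : ℝ) ≤ m + 2 := by exact_mod_cast hp2
  refine ⟨p, k, ?_, ?_, ?_, ?_⟩
  · rintro rfl
    exact hp (dvd_zero _)
  · rw [hkZ]
    exact ((Int.prime_three.coprime_iff_not_dvd.2 hp).symm).pow_right
  · rw [hkR, lt_div_iff₀ hQ]
    nlinarith
  · rw [hkR, div_lt_iff₀ hQ]
    nlinarith

theorem mem_boundaryPoles_of_ne_zero {p : ℤ} (hp : p ≠ 0) (k : ℕ) :
    Complex.I * ((2 * Real.pi * p / (2 * k + 1) : ℝ) : ℂ) ∈ boundaryPoles := by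
  rw [boundaryPoles_eq]
  have hk : (2 * (k : ℂ) + 1) ≠ 0 := by exact_mod_cast Nat.succ_ne_zero (2 * k)
  rcases lt_or_gt_of_ne hp with h3 | h3
  · obtain ⟨l, rfl⟩ : ∃ l : ℕ+, p = -((l : ℕ) : ℤ) :=
      ⟨⟨(-p).toNat, by omega⟩, by simp only [PNat.mk_coe]; omega⟩
    refine ⟨l, -k - 1, ?_⟩
    push_cast
    have h4 : 2 * (-(k : ℂ) - 1) + 1 = -(2 * k + 1) := by ring
    rw [h4]
    field_simp
  · obtain ⟨l, rfl⟩ : ∃ l : ℕ+, p = ((l : ℕ) : ℤ) :=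
      ⟨⟨p.toNat, by omega⟩, by simp only [PNat.mk_coe]; omega⟩
    refine ⟨l, k, ?_⟩
    push_cast
    field_simp

/-- The poles lie on the imaginary axis, and the fractions with denominators `3^N` are dense there. -/
theorem closure_boundaryPoles : closure boundaryPoles = {w : ℂ | w.re = 0} := by
  refine Set.Subset.antisymm (closure_minimal ?_
    (isClosed_eq Complex.continuous_re continuous_const)) fun w (hw : w.re = 0) => ?_
  · rw [boundaryPoles_eq]
    rintro _ ⟨l, k, rfl⟩
    have h1 : 2 * Real.pi * Complex.I * l / (2 * k + 1) =
        ((2 * Real.pi * (l : ℕ) / (2 * k + 1) : ℝ) : ℂ) * Complex.I := by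
      push_cast
      ring
    rw [h1, Set.mem_ofPred_eq, Complex.re_ofReal_mul, Complex.I_re, mul_zero]
  · refine Metric.mem_closure_iff.2 fun ε hε => ?_
    obtain ⟨p, k, hp, -, h1, h2⟩ := exists_isCoprime_between (lt_add_of_pos_right w.im hε)
    refine ⟨_, mem_boundaryPoles_of_ne_zero hp k, ?_⟩
    have h3 : w = Complex.I * (w.im : ℂ) := by
      apply Complex.ext <;> simp [hw]
    rw [h3, dist_eq_norm, ← mul_sub, norm_mul, Complex.norm_I, one_mul, ← Complex.ofReal_sub,
      Complex.norm_real, Real.norm_eq_abs, abs_lt]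
    constructor <;> linarith

/-- A meromorphic function is continuous in a punctured neighbourhood of each point, whereas `Zo`
is of order `ε⁻²` at a dense set of boundary points. -/
theorem not_exists_meromorphic_extension (U : Set ℂ) (θ : ℝ) (hU : IsOpen U)
    (hθ : Complex.I * θ ∈ U) :
    ¬∃ g : ℂ → ℂ, MeromorphicOn g U ∧ ∀ z ∈ U, 0 < z.re → g z = Zo z := by
  rintro ⟨g, hg, hgZ⟩
  have h1 := (hg _ hθ).eventually_analyticAt
  rw [eventually_nhdsWithin_iff] at h1
  obtain ⟨r, hr, hr'⟩ := Metric.eventually_nhds_iff.1 (h1.and (hU.mem_nhds hθ))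
  obtain ⟨p, k, -, hpk, hp1, hp2⟩ := exists_isCoprime_between (lt_add_of_pos_right θ hr)
  set φ : ℝ := 2 * Real.pi * p / (2 * k + 1)
  have hd : dist (Complex.I * (φ : ℂ)) (Complex.I * θ) < r := by
    rw [dist_eq_norm, ← mul_sub, norm_mul, Complex.norm_I, one_mul, ← Complex.ofReal_sub,
      Complex.norm_real, Real.norm_eq_abs, abs_lt]
    constructor <;> linarith
  obtain ⟨h2, h3⟩ := hr' hd
  have hne : Complex.I * (φ : ℂ) ≠ Complex.I * θ := fun h => by
    have h4 := mul_left_cancel₀ Complex.I_ne_zero h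
    exact hp1.ne' (Complex.ofReal_injective h4)
  have hcont := (h2 hne).continuousAt
  have hpath : Tendsto (fun ε : ℝ => (ε : ℂ) + Complex.I * φ) (𝓝[>] 0) (𝓝 (Complex.I * φ)) := by
    have h5 : Continuous fun ε : ℝ => (ε : ℂ) + Complex.I * φ := by fun_prop
    have h6 := h5.tendsto 0
    rw [Complex.ofReal_zero, zero_add] at h6
    exact h6.mono_left nhdsWithin_le_nhds
  have hsq : Tendsto (fun ε : ℝ => (ε : ℂ) ^ 2) (𝓝[>] 0) (𝓝 0) := by
    have h5 : Continuous fun ε : ℝ => (ε : ℂ) ^ 2 := by fun_prop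
    have h6 := h5.tendsto 0
    simp only [Complex.ofReal_zero, ne_eq, OfNat.ofNat_ne_zero, not_false_eq_true, zero_pow] at h6
    exact h6.mono_left nhdsWithin_le_nhds
  have h7 := hsq.mul (hcont.tendsto.comp hpath)
  rw [zero_mul] at h7
  have h8 := tendsto_sq_mul_Zo_of_isCoprime p k hpk
  have h9 : (Real.pi : ℂ) ^ 2 / (4 * (2 * k + 1) ^ 2) ≠ 0 := by
    have hk : (2 * (k : ℂ) + 1) ≠ 0 := by exact_mod_cast Nat.succ_ne_zero (2 * k)
    have hπ : (Real.pi : ℂ) ≠ 0 := by exact_mod_cast Real.pi_ne_zero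
    exact div_ne_zero (pow_ne_zero 2 hπ) (mul_ne_zero (by norm_num) (pow_ne_zero 2 hk))
  refine h9 (tendsto_nhds_unique h8 (h7.congr' ?_))
  filter_upwards [self_mem_nhdsWithin, hpath (hU.mem_nhds h3)] with ε (hε : 0 < ε) hεU
  have h10 : (ε : ℂ) + 2 * Real.pi * Complex.I * p / (2 * k + 1) = ε + Complex.I * φ := by
    simp only [φ]
    push_cast
    ring
  rw [h10, Function.comp_apply, hgZ _ hεU (by simpa using hε)]

theorem boundaryPoles_eq_reebPeriods :
    {τ : ℝ | 0 < τ ∧ Complex.I * τ ∈ boundaryPoles} = ⋃ k : ℕ, reebPeriods (2 * k + 1) := by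
  have hπ := Real.pi_pos
  ext τ
  rw [Set.mem_iUnion]
  constructor
  · rintro ⟨hτ, h⟩
    rw [boundaryPoles_eq] at h
    obtain ⟨l, k, hk⟩ := h
    have h1 : τ = 2 * Real.pi * (l : ℕ) / (2 * k + 1) := by
      have h2 : Complex.I * (τ : ℂ) =
          Complex.I * ((2 * Real.pi * (l : ℕ) / (2 * k + 1) : ℝ) : ℂ) := by
        rw [hk]
        push_cast
        ring
      exact Complex.ofReal_injective (mul_left_cancel₀ Complex.I_ne_zero h2)
    have hl : (0 : ℝ) < (l : ℕ) := by exact_mod_cast l.pos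
    have h3 : (0 : ℝ) < 2 * k + 1 := by
      rw [h1] at hτ
      exact (div_pos_iff_of_pos_left (by positivity)).1 hτ
    have h4 : 0 ≤ k := by
      have : (0 : ℤ) < 2 * k + 1 := by exact_mod_cast h3
      omega
    lift k to ℕ using h4
    refine ⟨k, ?_⟩
    rw [reebPeriods_eq (by positivity)]
    exact ⟨l, by exact_mod_cast h1⟩
  · rintro ⟨k, hk⟩
    refine ⟨hk.1, ?_⟩
    rw [reebPeriods_eq (by positivity)] at hk
    obtain ⟨l, rfl⟩ := hk
    have := mem_boundaryPoles_of_ne_zero (p := (l : ℕ)) (by exact_mod_cast l.ne_zero) k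
    exact_mod_cast this

end Heisenberg

end

theorem mainTheorem2 :
    -- the spectrum is discrete with finite multiplicities, and the heat trace splits
    (∀ μ : ℝ, FiniteDimensional ℂ (eigenspace μ)) ∧
    (∀ z : ℂ, 0 < z.re →
      Summable (traceTerm eigenspace z) ∧ Summable (traceTerm torusEigenspace z) ∧
      Summable (traceTerm nonTorusEigenspace z) ∧
      trace eigenspace z = trace torusEigenspace z + Zo z) ∧
    -- the explicit form of the non-torus part
    (∀ z : ℂ, 0 < z.re →
      Summable (fun p : ℕ+ × ℕ => 2 * (p.1 : ℂ) * Complex.exp (-((2 * p.2 + 1) * p.1 * z))) ∧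
      Zo z = ∑' m : ℕ+, 2 * (m : ℂ) * ∑' n : ℕ, Complex.exp (-((2 * n + 1) * m * z)) ∧
      HasSum (fun m : ℕ+ => (m : ℂ) / Complex.sinh (m * z)) (Zo z)) ∧
    -- the Fourier transform of `x / sinh x`
    (Integrable (fun x : ℝ => x / Real.sinh x) ∧
      ∀ k : ℝ, ∫ x : ℝ, ((x / Real.sinh x : ℝ) : ℂ) * Complex.exp (-(Complex.I * k * x)) =
        ((Real.pi ^ 2 / (1 + Real.cosh (Real.pi * k)) : ℝ) : ℂ)) ∧
    -- the trace formula
    (∀ z : ℂ, 0 < z.re →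
      (∀ l : ℕ+, 1 + Complex.cosh (2 * (Real.pi : ℂ) ^ 2 * l / z) ≠ 0) ∧
      Summable (fun l : ℕ+ => 1 / (1 + Complex.cosh (2 * (Real.pi : ℂ) ^ 2 * l / z))) ∧
      Zo z = (Real.pi : ℂ) ^ 2 / (4 * z ^ 2) - 1 / (2 * z) + (Real.pi : ℂ) ^ 2 / z ^ 2 *
        ∑' l : ℕ+, 1 / (1 + Complex.cosh (2 * (Real.pi : ℂ) ^ 2 * l / z))) ∧
    -- the Weyl term
    ((fun t : ℝ => Zo t) ~[𝓝[>] (0 : ℝ)] fun t : ℝ => (Real.pi : ℂ) ^ 2 / (4 * (t : ℂ) ^ 2)) ∧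
    -- the exponentially small corrections
    (∀ z : ℂ, 0 < z.re →
      Summable (fun N : ℕ+ =>
        (correctionCoeff N : ℂ) * Complex.exp (-(2 * (Real.pi : ℂ) ^ 2 * N / z))) ∧
      Zo z = (Real.pi : ℂ) ^ 2 / (4 * z ^ 2) - 1 / (2 * z) + 2 * (Real.pi : ℂ) ^ 2 / z ^ 2 *
        ∑' N : ℕ+, (correctionCoeff N : ℂ) * Complex.exp (-(2 * (Real.pi : ℂ) ^ 2 * N / z))) ∧
    ((fun t : ℝ => Zo t - ((Real.pi : ℂ) ^ 2 / (4 * (t : ℂ) ^ 2) - 1 / (2 * (t : ℂ))))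
      ~[𝓝[>] (0 : ℝ)] fun t : ℝ =>
        2 * (Real.pi : ℂ) ^ 2 / (t : ℂ) ^ 2 * Complex.exp (-(2 * (Real.pi : ℂ) ^ 2 / t))) ∧
    -- the exponents which occur are `L² / 4`, for `L` the lengths of closed geodesics
    (∀ N : ℕ+, correctionCoeff N ≠ 0) ∧
    nonTorusLengths = {L | ∃ l : ℕ+, L = 2 * Real.pi * √(2 * (l : ℝ))} ∧
    {E : ℝ | ∃ N : ℕ+, correctionCoeff N ≠ 0 ∧ E = 2 * Real.pi ^ 2 * N} =
      {E : ℝ | ∃ L ∈ nonTorusLengths, E = L ^ 2 / 4} ∧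
    -- the boundary singularities
    boundaryPoles = {w : ℂ | ∃ (l : ℕ+) (k : ℤ), w = 2 * Real.pi * Complex.I * l / (2 * k + 1)} ∧
    (∀ (p : ℤ) (k : ℕ), IsCoprime p (2 * k + 1 : ℤ) →
      Tendsto (fun ε : ℝ => (ε : ℂ) ^ 2 * Zo (ε + 2 * Real.pi * Complex.I * p / (2 * k + 1)))
        (𝓝[>] 0) (𝓝 ((Real.pi : ℂ) ^ 2 / (4 * (2 * k + 1) ^ 2)))) ∧
    (∀ θ : ℝ, θ ≠ 0 → Complex.I * θ ∉ boundaryPoles →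
      Tendsto (fun ε : ℝ => (ε : ℂ) ^ 2 * Zo (ε + Complex.I * θ)) (𝓝[>] 0) (𝓝 0)) ∧
    closure boundaryPoles = {w : ℂ | w.re = 0} ∧
    (∀ (U : Set ℂ) (θ : ℝ), IsOpen U → Complex.I * θ ∈ U →
      ¬∃ g : ℂ → ℂ, MeromorphicOn g U ∧ ∀ z ∈ U, 0 < z.re → g z = Zo z) ∧
    -- their match with the periods of odd multiples of the Reeb vector field
    (∀ k : ℕ, reebPeriods (2 * k + 1) = {τ | ∃ l : ℕ+, τ = 2 * Real.pi * l / (2 * k + 1)}) ∧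
    {τ : ℝ | 0 < τ ∧ Complex.I * τ ∈ boundaryPoles} = ⋃ k : ℕ, reebPeriods (2 * k + 1) :=
  ⟨finiteDimensional_eigenspace,
    fun _ hz => summable_traceTerm_and_trace_eq hz,
    fun _ hz => ⟨summable_landau hz, Zo_eq_tsum_tsum hz, hasSum_Zo hz⟩,
    ⟨integrable_div_sinh, integral_fourierIntegrand⟩,
    fun _ hz => ⟨fun l => one_add_cosh_ne_zero (re_two_pi_sq_div_pos hz l),
      summable_cosh_terms hz, trace_formula hz⟩,
    isEquivalent_Zo,
    fun _ hz => ⟨(hasSum_correction hz).summable, Zo_eq_correction hz⟩,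
    isEquivalent_correction,
    correctionCoeff_ne_zero,
    nonTorusLengths_eq,
    exponents_eq,
    boundaryPoles_eq,
    tendsto_sq_mul_Zo_of_isCoprime,
    tendsto_sq_mul_Zo_of_notMem,
    closure_boundaryPoles,
    not_exists_meromorphic_extension,
    fun _ => reebPeriods_eq (by positivity),
    boundaryPoles_eq_reebPeriods⟩
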